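/- Let $K$ be a field of characteristic $0$. Let $X$ be a topological space with a base point $x_0\in X$, and suppose that $\mathrm{cat}_{LS}(X)\le 1$. Here $\mathrm{cat}_{LS}(X)$ is the least integer $n\ge 0$ such that $X$ is covered by $n+1$ open subsets whose inclusions into $X$ are null-homotopic (it is $\infty$ if there is no such $n$). Then the augmented singular cochain dg-algebra $\widetilde C^*(X;K)$ is formal. Here dg-algebras are $\mathbb Z$-graded, associative and not necessarily unital, and the terms are understood as follows. (a) The underlying complex of $\widetilde C^*(X;K)$ is $$\cdots\to 0\to K\xrightarrow{\ \epsilon\ }C^0(X;K)\to C^1(X;K)\to\cdots ,$$ where $K$ stands in degree $-1$, $\epsilon(c)$ is the constant $0$-cochain with value $c$, and $C^*(X;K)$ is the complex of singular cochains. Its cohomology is the reduced cohomology $\widetilde H^*(X;K)$. It is the direct sum of the ideal $I\subset C^*(X;K)$ of the cochains that vanish on the $0$-simplex $x_0$ and of the acyclic complex $K\xrightarrow{\epsilon}K\cdot 1$. The product of $\widetilde C^*(X;K)$ is the cup product on $I$, and it is zero when one of the factors lies in $K\xrightarrow{\epsilon}K\cdot 1$. (b) A dg-algebra $A$ is an $A_\infty$-algebra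 with $m_1=d$, $m_2$ the product and $m_n=0$ for $n\ge 3$. An $A_\infty$-morphism $f\colon H\to A$ is a family of linear maps $f_n\colon H^{\otimes n}\to A$ ($n\ge 1$) of degree $1-n$ such that for all $n\ge 1$ $$\sum_{r+s+t=n,\ s\ge 1}(-1)^{r+st}f_{r+1+t}\,(\mathrm{id}^{\otimes r}\otimes m_s\otimes \mathrm{id}^{\otimes t})=\sum_{k=1}^{n}\ \sum_{i_1+\cdots+i_k=n}(-1)^{u}\,m_k\,(f_{i_1}\otimes\cdots\otimes f_{i_k}),\qquad u=\sum_{t=1}^{k-1}t\,(i_{k-t}-1),$$ with the Koszul sign rule on elements. It is a quasi-isomorphism if $f_1$ induces an isomorphism in cohomology. $A$ is formal if there are a dg-algebra $H$ with zero differential and an $A_\infty$-quasi-isomorphism $H\to A$. -/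

import Mathlib

open CategoryTheory Finset

universe u v w w'

/-- Replace the block `v r, …, v (r + s - 1)` of a sequence by the single entry `x`. -/
def spliceSeq {V : Type w} (v : ℕ → V) (r s : ℕ) (x : V) : ℕ → V :=
  fun i => if i < r then v i else if i = r then x else v (i - 1 + s)

/-- An `A_∞`-algebra over `K`: a `ℤ`-graded vector space `carrier = ⨁ gr i` with linear maps
`m n : carrier^{⊗ n} → carrier` (`n ≥ 1`) of degree `2 - n` such that, for all `n`,
`∑_{r+s+t=n, s ≥ 1} (-1)^{r+st} m_{r+1+t} (id^{⊗ r} ⊗ m_s ⊗ id^{⊗ t}) = 0`.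
The identity is evaluated on homogeneous elements `v 0, …, v (n-1)` of degrees
`deg 0, …, deg (n-1)`; by the Koszul rule, moving `m_s` past the first `r` of them contributes
the sign `(-1)^{(2-s)(deg 0 + ⋯ + deg (r-1))}`. There is no operation of arity `0`, which is
recorded as `m 0 = 0`. -/
structure AInfAlgebra (K : Type v) [Field K] where
  carrier : Type w
  [addCommGroup : AddCommGroup carrier]
  [module : Module K carrier]
  gr : ℤ → Submodule K carrier
  isInternal : DirectSum.IsInternal gr
  m : (n : ℕ) → MultilinearMap K (fun _ : Fin n => carrier) carrier
  m_zero : m 0 = 0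
  m_mem : ∀ (n : ℕ) (v : Fin n → carrier) (deg : Fin n → ℤ), (∀ i, v i ∈ gr (deg i)) →
    m n v ∈ gr (∑ i, deg i + 2 - n)
  stasheff : ∀ (n : ℕ) (v : ℕ → carrier) (deg : ℕ → ℤ), (∀ i, v i ∈ gr (deg i)) →
    ∑ x ∈ antidiagonal n, ∑ y ∈ antidiagonal x.2 with 1 ≤ y.1,
      (((x.1 : ℤ) + y.1 * y.2) + (2 - (y.1 : ℤ)) * ∑ l ∈ range x.1, deg l).negOnePow •
        m (x.1 + 1 + y.2) (fun i =>
          spliceSeq v x.1 y.1 (m y.1 (fun j => v (x.1 + j))) i) = 0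

attribute [instance] AInfAlgebra.addCommGroup AInfAlgebra.module

namespace AInfAlgebra

variable {K : Type v} [Field K]

/-- The differential `m_1`. -/
def d (A : AInfAlgebra.{v, w} K) : A.carrier →ₗ[K] A.carrier :=
  (MultilinearMap.ofSubsingleton K A.carrier A.carrier (0 : Fin 1)).symm (A.m 1)

/-- The cohomology `ker m_1 / im m_1`. -/
abbrev Cohomology (A : AInfAlgebra.{v, w} K) : Type w :=
  LinearMap.ker A.d ⧸ (LinearMap.range A.d).comap (LinearMap.ker A.d).subtype

/-- An `A_∞`-morphism `A → B`: linear maps `f n : A^{⊗ n} → B` (`n ≥ 1`) of degree `1 - n` with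
`∑_{r+s+t=n, s ≥ 1} (-1)^{r+st} f_{r+1+t} (id^{⊗ r} ⊗ m_s ⊗ id^{⊗ t})
  = ∑_{k, i_1+⋯+i_k=n} (-1)^{u} m_k (f_{i_1} ⊗ ⋯ ⊗ f_{i_k})`, where
`u = ∑_{t=1}^{k-1} t (i_{k-t} - 1)`. As above the identity is evaluated on homogeneous elements
with the Koszul signs; on the right, the map of degree `1 - i_j` moves past all the elements that
belong to the earlier blocks. The tuples `(i_1, …, i_k)` of positive integers with sum `n` are
the compositions of `n`; with blocks indexed from `0`, the block `j` has size `c.blocksFun j`, it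
starts at position `c.sizeUpTo j`, and it enters `u` with the weight `k - 1 - j`. -/
structure Hom (A : AInfAlgebra.{v, w} K) (B : AInfAlgebra.{v, w'} K) where
  f : (n : ℕ) → MultilinearMap K (fun _ : Fin n => A.carrier) B.carrier
  f_zero : f 0 = 0
  f_mem : ∀ (n : ℕ) (v : Fin n → A.carrier) (deg : Fin n → ℤ), (∀ i, v i ∈ A.gr (deg i)) →
    f n v ∈ B.gr (∑ i, deg i + 1 - n)
  relation : ∀ (n : ℕ) (v : ℕ → A.carrier) (deg : ℕ → ℤ), 1 ≤ n → (∀ i, v i ∈ A.gr (deg i)) →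
    ∑ x ∈ antidiagonal n, ∑ y ∈ antidiagonal x.2 with 1 ≤ y.1,
      (((x.1 : ℤ) + y.1 * y.2) + (2 - (y.1 : ℤ)) * ∑ l ∈ range x.1, deg l).negOnePow •
        f (x.1 + 1 + y.2) (fun i =>
          spliceSeq v x.1 y.1 (A.m y.1 (fun j => v (x.1 + j))) i) =
    ∑ c : Composition n,
      ((∑ j : Fin c.length, ((c.length : ℤ) - 1 - j) * ((c.blocksFun j : ℤ) - 1)) +
        ∑ j : Fin c.length, (1 - (c.blocksFun j : ℤ)) *
          ∑ l ∈ range (c.sizeUpTo j), deg l).negOnePow •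
        B.m c.length (fun j => f (c.blocksFun j) (fun i => v (c.sizeUpTo j + i)))

namespace Hom

variable {A : AInfAlgebra.{v, w} K} {B : AInfAlgebra.{v, w'} K}

/-- The linear component `f_1`. -/
def linear (F : Hom A B) : A.carrier →ₗ[K] B.carrier :=
  (MultilinearMap.ofSubsingleton K A.carrier B.carrier (0 : Fin 1)).symm (F.f 1)

theorem sum_mem_of_mem {A : AInfAlgebra.{v, w} K} (x : A.carrier) :
    x ∈ ⨆ i, A.gr i := by
  rw [A.isInternal.submodule_iSup_eq_top]
  trivial

/-- `f_1` is a cochain map. -/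
theorem linear_d (F : Hom A B) (x : A.carrier) : F.linear (A.d x) = B.d (F.linear x) := by
  have hx := sum_mem_of_mem x
  induction hx using Submodule.iSup_induction' with
  | zero => simp
  | add x y _ _ hx hy => simp [hx, hy]
  | mem i x hx =>
    have h := F.relation 1 (fun _ => x) (fun _ => i) le_rfl (fun _ => hx)
    have hu : ∀ c : Composition 1, c = Composition.single 1 one_pos := fun c =>
      (Fintype.card_le_one_iff_subsingleton.1 (by simp [composition_card])).elim _ _
    rw [Fintype.sum_eq_single (Composition.single 1 one_pos) (fun c hc => (hc (hu c)).elim)] at h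
    simp [Finset.Nat.antidiagonal_succ, Finset.sum_filter, spliceSeq] at h
    have e : (fun i : Fin 1 => if i = 0 then (A.m 1) fun _ => x else x) =
        fun _ => (A.m 1) fun _ => x := by
      funext i
      simp [Subsingleton.elim i 0]
    rw [e] at h
    refine h.trans (congrArg (B.m 1) (funext fun j : Fin 1 => ?_))
    fin_cases j
    rfl

/-- The map induced by `f_1` in cohomology. -/
def cohomologyMap (F : Hom A B) : A.Cohomology →ₗ[K] B.Cohomology :=
  Submodule.mapQ _ _
    (F.linear.restrict (p := LinearMap.ker A.d) (q := LinearMap.ker B.d) (fun x hx => by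
      rw [LinearMap.mem_ker] at hx ⊢
      rw [← F.linear_d, hx, map_zero]))
    (by
      rintro ⟨x, hx⟩ ⟨y, hy⟩
      exact ⟨F.linear y, by rw [← F.linear_d, hy]; rfl⟩)

/-- `F` is an `A_∞`-quasi-isomorphism: `f_1` induces an isomorphism in cohomology. -/
def IsQuasiIso (F : Hom A B) : Prop :=
  Function.Bijective F.cohomologyMap

end Hom

end AInfAlgebra

/-- A (not necessarily unital) dg-algebra over `K`, cohomologically graded. -/
structure DGAlgebra (K : Type v) [Field K] where
  carrier : Type w
  [addCommGroup : AddCommGroup carrier]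
  [module : Module K carrier]
  gr : ℤ → Submodule K carrier
  isInternal : DirectSum.IsInternal gr
  d : carrier →ₗ[K] carrier
  mul : carrier →ₗ[K] carrier →ₗ[K] carrier
  d_mem : ∀ (i : ℤ) (a : carrier), a ∈ gr i → d a ∈ gr (i + 1)
  mul_mem : ∀ (i j : ℤ) (a b : carrier), a ∈ gr i → b ∈ gr j → mul a b ∈ gr (i + j)
  d_d : ∀ a, d (d a) = 0
  mul_assoc : ∀ a b c, mul (mul a b) c = mul a (mul b c)
  leibniz : ∀ (i : ℤ) (a b : carrier), a ∈ gr i →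
    d (mul a b) = mul (d a) b + i.negOnePow • mul a (d b)

attribute [instance] DGAlgebra.addCommGroup DGAlgebra.module

namespace DGAlgebra

variable {K : Type v} [Field K]

/-- The product, as a multilinear map of two variables. -/
def mulMultilinear (A : DGAlgebra.{v, w} K) :
    MultilinearMap K (fun _ : Fin 2 => A.carrier) A.carrier where
  toFun v := A.mul (v 0) (v 1)
  map_update_add' v i x y := by
    fin_cases i <;> simp [Function.update]
  map_update_smul' v i c x := by
    fin_cases i <;> simp [Function.update]

/-- The operations of a dg-algebra as an `A_∞`-algebra: `m_1 = d`, `m_2` is the product, and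
`m_n = 0` for `n ≥ 3`. -/
def ops (A : DGAlgebra.{v, w} K) : (n : ℕ) → MultilinearMap K (fun _ : Fin n => A.carrier) A.carrier
  | 1 => MultilinearMap.ofSubsingleton K A.carrier A.carrier (0 : Fin 1) A.d
  | 2 => A.mulMultilinear
  | _ => 0

theorem ops_one (A : DGAlgebra.{v, w} K) (v : Fin 1 → A.carrier) : A.ops 1 v = A.d (v 0) := rfl

theorem ops_two (A : DGAlgebra.{v, w} K) (v : Fin 2 → A.carrier) :
    A.ops 2 v = A.mul (v 0) (v 1) := rfl

theorem ops_eq_zero (A : DGAlgebra.{v, w} K) (n : ℕ) (hn : n = 0 ∨ 3 ≤ n) : A.ops n = 0 := by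
  match n, hn with
  | 0, _ => rfl
  | n + 3, _ => rfl

/-- A dg-algebra, regarded as an `A_∞`-algebra. -/
def toAInf (A : DGAlgebra.{v, w} K) : AInfAlgebra.{v, w} K where
  carrier := A.carrier
  gr := A.gr
  isInternal := A.isInternal
  m := A.ops
  m_zero := rfl
  m_mem n v deg hv := by
    match n with
    | 0 => rw [ops_eq_zero _ _ (Or.inl rfl)]; simp
    | 1 =>
      rw [ops_one]
      convert A.d_mem _ _ (hv 0) using 2
      simp
      ring
    | 2 =>
      rw [ops_two]
      convert A.mul_mem _ _ _ _ (hv 0) (hv 1) using 2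
      simp
    | n + 3 => rw [ops_eq_zero _ _ (Or.inr (by omega))]; simp
  stasheff n v deg hv := by
    match n with
    | 0 => simp [Finset.sum_filter]
    | 1 =>
      simp [Finset.Nat.antidiagonal_succ, Finset.sum_filter, spliceSeq, ops_one, A.d_d]
    | 2 =>
      have h := A.leibniz _ _ (v 1) (hv 0)
      simp [Finset.Nat.antidiagonal_succ, Finset.sum_filter, spliceSeq, ops_one, ops_two]
      rw [h, add_comm 1 (deg 0), Int.negOnePow_succ, Units.neg_smul]
      abel
    | 3 =>
      have h := A.mul_assoc (v 0) (v 1) (v 2)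
      simp [Finset.Nat.antidiagonal_succ, Finset.sum_filter, spliceSeq, ops_one, ops_two]
      simp [h, ops_eq_zero A 3 (Or.inr le_rfl), show (2 : ℤ).negOnePow = 1 from rfl]
    | n + 4 =>
      refine Finset.sum_eq_zero fun x hx => Finset.sum_eq_zero fun y hy => ?_
      rw [Finset.HasAntidiagonal.mem_antidiagonal] at hx
      rw [Finset.mem_filter, Finset.HasAntidiagonal.mem_antidiagonal] at hy
      by_cases h : 3 ≤ y.1
      · rw [ops_eq_zero A y.1 (Or.inr h)]
        rw [MultilinearMap.map_coord_zero (i := ⟨x.1, by omega⟩), smul_zero]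
        simp [spliceSeq]
      · rw [ops_eq_zero A (x.1 + 1 + y.2) (Or.inr (by omega))]
        simp

/-- A dg-algebra is formal if it is `A_∞`-quasi-isomorphic to a dg-algebra with trivial
differential. -/
def IsFormal (A : DGAlgebra.{v, w} K) : Prop :=
  ∃ H : DGAlgebra.{v, w} K, H.d = 0 ∧
    ∃ F : AInfAlgebra.Hom H.toAInf A.toAInf, F.IsQuasiIso

end DGAlgebra

section Cochains

open Simplicial

variable (K : Type v) [Field K] (S : SSet.{u})

/-- The cochains of a simplicial set with values in `K`, all degrees together: families of
functions `φ n` on the `n`-simplices, only finitely many of them non-zero. This is the direct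
sum of the spaces `C^n(S; K)` of all functions on the `n`-simplices. -/
def cochains : Submodule K ((n : ℕ) → S _⦋n⦌ → K) where
  carrier := {φ | ∃ N, ∀ n, N ≤ n → φ n = 0}
  add_mem' := by
    rintro φ ψ ⟨N, hN⟩ ⟨M, hM⟩
    exact ⟨max N M, fun n hn => by
      simp [hN n (le_trans (le_max_left _ _) hn), hM n (le_trans (le_max_right _ _) hn)]⟩
  zero_mem' := ⟨0, fun _ _ => rfl⟩
  smul_mem' := by
    rintro c φ ⟨N, hN⟩
    exact ⟨N, fun n hn => by simp [hN n hn]⟩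

variable {S}

/-- The monotone map `[k] → [n]`, `i ↦ a + i`. (It is only used for `a + k ≤ n`; in general it
is truncated at `n`.) -/
def intervalMap (n a k : ℕ) : ⦋k⦌ ⟶ ⦋n⦌ :=
  SimplexCategory.mkHom
    ⟨fun i => ⟨min (a + i) n, by omega⟩, fun i j h => by
      have : (i : ℕ) ≤ j := h
      simp only [Fin.mk_le_mk]
      omega⟩

/-- The face of the simplex `σ` spanned by its vertices `a, a + 1, …, a + k`. -/
def intervalFace {n : ℕ} (σ : S _⦋n⦌) (a k : ℕ) : S _⦋k⦌ :=
  S.map (intervalMap n a k).op σ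

variable {K}

/-- The differential of cochains, the alternating sum over the faces. -/
def cochainD (φ : (n : ℕ) → S _⦋n⦌ → K) : (n : ℕ) → S _⦋n⦌ → K := fun n =>
  match n with
  | 0 => 0
  | n + 1 => fun σ => ∑ j : Fin (n + 2), (-1 : K) ^ (j : ℕ) * φ n (S.δ j σ)

/-- The cup product of cochains: front face times back face. -/
def cup (φ ψ : (n : ℕ) → S _⦋n⦌ → K) (n : ℕ) (σ : S _⦋n⦌) : K :=
  ∑ x ∈ antidiagonal n, φ x.1 (intervalFace σ 0 x.1) * ψ x.2 (intervalFace σ x.1 x.2)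

theorem cochainD_cochainD (φ : (n : ℕ) → S _⦋n⦌ → K) : cochainD (cochainD φ) = 0 := by
  funext n σ
  match n with
  | 0 => rfl
  | 1 => simp [cochainD]
  | n + 2 =>
    simp only [cochainD, Finset.mul_sum, Pi.zero_apply]
    rw [Finset.sum_comm, ← Finset.sum_product', Finset.univ_product_univ]
    let T : Finset (Fin (n + 2) × Fin (n + 3)) := {ij | (ij.2 : ℕ) ≤ (ij.1 : ℕ)}
    rw [← Finset.sum_add_sum_compl T, ← eq_neg_iff_add_eq_zero, ← Finset.sum_neg_distrib]
    have hT : ∀ ij, ij ∈ T ↔ (ij.2 : ℕ) ≤ (ij.1 : ℕ) := by simp [T]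
    refine Finset.sum_bij
      (fun ij hij => (Fin.castLT ij.2 (lt_of_le_of_lt ((hT _).1 hij) ij.1.is_lt), ij.1.succ))
      ?_ ?_ ?_ ?_
    · intro ij hij
      rw [Finset.mem_compl, hT]
      rw [hT] at hij
      simp
      omega
    · rintro ⟨i, j⟩ hij ⟨i', j'⟩ hij' h
      simp only [Prod.mk.injEq, Fin.ext_iff, Fin.val_castLT] at h ⊢
      exact ⟨by simpa using h.2, h.1⟩
    · rintro ⟨i', j'⟩ hij'
      rw [Finset.mem_compl, hT, not_le] at hij'
      have h0 : j' ≠ 0 := by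
        rintro rfl
        simp at hij'
      refine ⟨(j'.pred h0, i'.castSucc), ?_, ?_⟩
      · rw [hT]
        simp
        simp at hij'
        omega
      · simp
    · rintro ⟨i, j⟩ hij
      rw [hT] at hij
      have h1 : S.δ i (S.δ j σ) =
          S.δ (Fin.castLT j (lt_of_le_of_lt hij i.is_lt)) (S.δ i.succ σ) :=
        (congrArg (fun f => f σ)
          (SimplicialObject.δ_comp_δ'' (X := S) (i := j) (j := i) hij)).symm
      simp only [h1, Fin.val_castLT, Fin.val_succ, pow_succ]
      ring

theorem simplexHom_ext {k n : ℕ} {f g : ⦋k⦌ ⟶ ⦋n⦌}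
    (h : ∀ i : Fin (k + 1), (f.toOrderHom i : ℕ) = (g.toOrderHom i : ℕ)) : f = g := by
  ext i
  exact h i

theorem simplexHom_comp {k n l : ℕ} (f : ⦋k⦌ ⟶ ⦋n⦌) (g : ⦋n⦌ ⟶ ⦋l⦌) (i : Fin (k + 1)) :
    (f ≫ g).toOrderHom i = g.toOrderHom (f.toOrderHom i) := rfl

theorem intervalMap_val (n a k : ℕ) (i : Fin (k + 1)) :
    (((intervalMap n a k).toOrderHom i : Fin (n + 1)) : ℕ) = min (a + i) n := rfl

theorem δ_val {n : ℕ} (j : Fin (n + 2)) (i : Fin (n + 1)) :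
    (((SimplexCategory.δ j).toOrderHom i : Fin (n + 2)) : ℕ) =
      if (i : ℕ) < j then (i : ℕ) else i + 1 := by
  change ((j.succAbove i : Fin (n + 2)) : ℕ) = _
  simp only [Fin.succAbove, Fin.lt_def, Fin.val_castSucc]
  split_ifs <;> simp

theorem intervalFace_intervalFace {n : ℕ} (σ : S _⦋n⦌) (a k b l : ℕ) (h : b + l ≤ k) :
    intervalFace (intervalFace σ a k) b l = intervalFace σ (a + b) l := by
  have e : intervalMap k b l ≫ intervalMap n a k = intervalMap n (a + b) l := by
    refine simplexHom_ext fun k => ?_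
    have := k.is_lt
    simp only [simplexHom_comp, intervalMap_val]
    grind
  simp only [intervalFace, ← e, op_comp, Functor.map_comp_apply]

theorem cup_assoc (φ ψ χ : (n : ℕ) → S _⦋n⦌ → K) :
    cup (cup φ ψ) χ = cup φ (cup ψ χ) := by
  funext n σ
  simp only [cup, Finset.sum_mul, Finset.mul_sum, Finset.sum_sigma']
  refine Finset.sum_bij'
    (fun x _ => ⟨(x.2.1, x.2.2 + x.1.2), (x.2.2, x.1.2)⟩)
    (fun x _ => ⟨(x.1.1 + x.2.1, x.2.2), (x.1.1, x.2.1)⟩) ?_ ?_ ?_ ?_ ?_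
  · rintro ⟨⟨a, b⟩, c, e⟩ h
    simp at h ⊢
    omega
  · rintro ⟨⟨a, b⟩, c, e⟩ h
    simp at h ⊢
    omega
  · rintro ⟨⟨a, b⟩, c, e⟩ h
    simp at h ⊢
    omega
  · rintro ⟨⟨a, b⟩, c, e⟩ h
    simp at h ⊢
    omega
  · rintro ⟨⟨a, b⟩, c, e⟩ h
    simp only [Finset.mem_sigma, Finset.HasAntidiagonal.mem_antidiagonal] at h
    obtain ⟨h1, rfl⟩ := h
    dsimp only
    rw [intervalFace_intervalFace _ _ _ _ _ (by omega),
      intervalFace_intervalFace _ _ _ _ _ (by omega),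
      intervalFace_intervalFace _ _ _ _ _ (by omega),
      intervalFace_intervalFace _ _ _ _ _ (by omega)]
    simp only [zero_add, add_zero, mul_assoc]

theorem intervalFace_δ_of_le {p q : ℕ} (σ : S _⦋p + q + 1⦌) (i : Fin (p + q + 2))
    (hi : (i : ℕ) ≤ p) :
    intervalFace (S.δ i σ) 0 p = S.δ ⟨i, by omega⟩ (intervalFace σ 0 (p + 1)) ∧
      intervalFace (S.δ i σ) p q = intervalFace σ (p + 1) q := by
  have e1 : intervalMap (p + q) 0 p ≫ SimplexCategory.δ i =
      SimplexCategory.δ (n := p) ⟨i, by omega⟩ ≫ intervalMap (p + q + 1) 0 (p + 1) := by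
    refine simplexHom_ext fun k => ?_
    have := k.is_lt
    simp only [simplexHom_comp, intervalMap_val, δ_val]
    grind
  have e2 : intervalMap (p + q) p q ≫ SimplexCategory.δ i =
      intervalMap (p + q + 1) (p + 1) q := by
    refine simplexHom_ext fun k => ?_
    have := k.is_lt
    simp only [simplexHom_comp, intervalMap_val, δ_val]
    grind
  constructor
  · change S.map _ (S.map _ σ) = S.map _ (S.map _ σ)
    rw [← Functor.map_comp_apply, ← Functor.map_comp_apply, ← op_comp, ← op_comp, e1]
  · change S.map _ (S.map _ σ) = S.map _ σ
    rw [← Functor.map_comp_apply, ← op_comp, e2]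

theorem intervalFace_δ_of_gt {p q : ℕ} (σ : S _⦋p + q + 1⦌) (j : Fin (q + 2)) (hj : 1 ≤ (j : ℕ)) :
    intervalFace (S.δ (n := p + q) ⟨p + j, by omega⟩ σ) 0 p = intervalFace σ 0 p ∧
      intervalFace (S.δ (n := p + q) ⟨p + j, by omega⟩ σ) p q =
        S.δ j (intervalFace σ p (q + 1)) := by
  have e1 : intervalMap (p + q) 0 p ≫ SimplexCategory.δ (n := p + q) ⟨p + j, by omega⟩ =
      intervalMap (p + q + 1) 0 p := by
    refine simplexHom_ext fun k => ?_
    have := k.is_lt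
    simp only [simplexHom_comp, intervalMap_val, δ_val]
    grind
  have e2 : intervalMap (p + q) p q ≫ SimplexCategory.δ (n := p + q) ⟨p + j, by omega⟩ =
      SimplexCategory.δ j ≫ intervalMap (p + q + 1) p (q + 1) := by
    refine simplexHom_ext fun k => ?_
    have := k.is_lt
    simp only [simplexHom_comp, intervalMap_val, δ_val]
    grind
  constructor
  · change S.map _ (S.map _ σ) = S.map _ σ
    rw [← Functor.map_comp_apply, ← op_comp, e1]
  · change S.map _ (S.map _ σ) = S.map _ (S.map _ σ)
    rw [← Functor.map_comp_apply, ← Functor.map_comp_apply, ← op_comp, ← op_comp, e2]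

theorem δ_last_intervalFace {n : ℕ} (σ : S _⦋n⦌) (p : ℕ) :
    S.δ (Fin.last (p + 1)) (intervalFace σ 0 (p + 1)) = intervalFace σ 0 p := by
  have e : SimplexCategory.δ (Fin.last (p + 1)) ≫ intervalMap n 0 (p + 1) =
      intervalMap n 0 p := by
    refine simplexHom_ext fun k => ?_
    have := k.is_lt
    simp only [simplexHom_comp, intervalMap_val, δ_val]
    grind
  change S.map _ (S.map _ σ) = S.map _ σ
  rw [← Functor.map_comp_apply, ← op_comp, e]

theorem δ_zero_intervalFace {n : ℕ} (σ : S _⦋n⦌) (p q : ℕ) :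
    S.δ (0 : Fin (q + 2)) (intervalFace σ p (q + 1)) = intervalFace σ (p + 1) q := by
  have e : SimplexCategory.δ (0 : Fin (q + 2)) ≫ intervalMap n p (q + 1) =
      intervalMap n (p + 1) q := by
    refine simplexHom_ext fun k => ?_
    have := k.is_lt
    simp only [simplexHom_comp, intervalMap_val, δ_val]
    grind
  change S.map _ (S.map _ σ) = S.map _ σ
  rw [← Functor.map_comp_apply, ← op_comp, e]

theorem leibniz_aux (p q : ℕ) (φ : S _⦋p⦌ → K) (ψ : S _⦋q⦌ → K) (σ : S _⦋p + q + 1⦌) :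
    ∑ i : Fin (p + q + 2), (-1 : K) ^ (i : ℕ) *
        (φ (intervalFace (S.δ i σ) 0 p) * ψ (intervalFace (S.δ i σ) p q)) =
      (∑ i : Fin (p + 2), (-1 : K) ^ (i : ℕ) * φ (S.δ i (intervalFace σ 0 (p + 1)))) *
          ψ (intervalFace σ (p + 1) q) +
        (-1 : K) ^ p * (φ (intervalFace σ 0 p) *
          ∑ j : Fin (q + 2), (-1 : K) ^ (j : ℕ) * ψ (S.δ j (intervalFace σ p (q + 1)))) := by
  rw [Fin.sum_univ_castSucc (n := p + 1), Fin.sum_univ_succ (n := q + 1), δ_last_intervalFace,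
    δ_zero_intervalFace]
  have e : p + q + 2 = (p + 1) + (q + 1) := by omega
  rw [← (finCongr e.symm).sum_comp, Fin.sum_univ_add]
  have h1 : ∀ i : Fin (p + 1),
      (-1 : K) ^ ((finCongr e.symm (Fin.castAdd (q + 1) i) : Fin _) : ℕ) *
        (φ (intervalFace (S.δ (finCongr e.symm (Fin.castAdd (q + 1) i)) σ) 0 p) *
          ψ (intervalFace (S.δ (finCongr e.symm (Fin.castAdd (q + 1) i)) σ) p q)) =
      ((-1 : K) ^ (i.castSucc : ℕ) * φ (S.δ i.castSucc (intervalFace σ 0 (p + 1)))) *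
        ψ (intervalFace σ (p + 1) q) := by
    intro i
    obtain ⟨a, b⟩ := intervalFace_δ_of_le σ (finCongr e.symm (Fin.castAdd (q + 1) i))
      (by simp; omega)
    rw [a, b, mul_assoc]
    rfl
  have h2 : ∀ j : Fin (q + 1),
      (-1 : K) ^ ((finCongr e.symm (Fin.natAdd (p + 1) j) : Fin _) : ℕ) *
        (φ (intervalFace (S.δ (finCongr e.symm (Fin.natAdd (p + 1) j)) σ) 0 p) *
          ψ (intervalFace (S.δ (finCongr e.symm (Fin.natAdd (p + 1) j)) σ) p q)) =
      (-1 : K) ^ p * (φ (intervalFace σ 0 p) *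
        ((-1 : K) ^ (j.succ : ℕ) * ψ (S.δ j.succ (intervalFace σ p (q + 1))))) := by
    intro j
    obtain ⟨a, b⟩ := intervalFace_δ_of_gt σ j.succ (by simp)
    have hj : (finCongr e.symm (Fin.natAdd (p + 1) j) : Fin _) =
        ⟨p + (j.succ : ℕ), by have := j.succ.is_lt; omega⟩ := by
      ext
      simp
      omega
    rw [hj, a, b]
    simp only [pow_add]
    ring
  rw [Finset.sum_congr rfl (fun i _ => h1 i), Finset.sum_congr rfl (fun j _ => h2 j),
    ← Finset.sum_mul, ← Finset.mul_sum, ← Finset.mul_sum]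
  simp only [Fin.val_last, Fin.val_zero, pow_succ, pow_zero]
  ring

theorem cochainD_cup (i : ℤ) (φ ψ : (n : ℕ) → S _⦋n⦌ → K) (hφ : ∀ n : ℕ, (n : ℤ) ≠ i → φ n = 0) :
    cochainD (cup φ ψ) = cup (cochainD φ) ψ + i.negOnePow • cup φ (cochainD ψ) := by
  funext n σ
  match n with
  | 0 => simp [cochainD, cup]
  | n + 1 =>
    have hs : ∀ x : K, i.negOnePow • x = ((i.negOnePow : ℤ) : K) * x := fun x => by
      rw [Units.smul_def, zsmul_eq_mul]
    simp only [Pi.add_apply, Pi.smul_apply, hs]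
    simp only [cup, cochainD, Finset.mul_sum]
    rw [Finset.sum_comm, Finset.Nat.sum_antidiagonal_succ, Finset.Nat.sum_antidiagonal_succ']
    simp only [Pi.zero_apply, zero_mul, mul_zero, zero_add]
    rw [← Finset.sum_add_distrib]
    refine Finset.sum_congr rfl ?_
    rintro ⟨p, q⟩ hx
    rw [Finset.HasAntidiagonal.mem_antidiagonal] at hx
    subst hx
    have := leibniz_aux p q (φ p) (ψ q) σ
    by_cases hp : (p : ℤ) = i
    · subst hp
      simp only [Int.cast_negOnePow_natCast]
      simpa [Finset.mul_sum] using this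
    · simp [hφ p hp]

theorem intervalFace_zero_zero (σ : S _⦋0⦌) : intervalFace σ 0 0 = σ := by
  have e : intervalMap 0 0 0 = 𝟙 ⦋0⦌ := simplexHom_ext fun k => by
    have := k.is_lt
    change min (0 + (k : ℕ)) 0 = (k : ℕ)
    omega
  rw [intervalFace, e]
  simp

theorem cup_zero_apply (φ ψ : (n : ℕ) → S _⦋n⦌ → K) (σ : S _⦋0⦌) :
    cup φ ψ 0 σ = φ 0 σ * ψ 0 σ := by
  simp [cup, intervalFace_zero_zero]

variable (K S)

/-- The unit of the cup product, the `0`-cochain with constant value `1`. -/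
def unitCochain : cochains K S :=
  ⟨fun n => match n with
    | 0 => fun _ => 1
    | _ + 1 => 0,
   1, fun n hn => by
    match n, hn with
    | _ + 1, _ => rfl⟩

/-- The differential on `C^*(S; K)`. -/
def cochainDLin : cochains K S →ₗ[K] cochains K S where
  toFun φ := ⟨cochainD φ.1, by
    obtain ⟨N, hN⟩ := φ.2
    refine ⟨N + 1, fun n hn => ?_⟩
    match n, hn with
    | n + 1, hn =>
      funext σ
      simp [cochainD, hN n (by omega)]⟩
  map_add' φ ψ := by
    ext n σ
    match n with
    | 0 => simp [cochainD]
    | n + 1 => simp [cochainD, mul_add, Finset.sum_add_distrib]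
  map_smul' c φ := by
    ext n σ
    match n with
    | 0 => simp [cochainD]
    | n + 1 => simp [cochainD, Finset.mul_sum, mul_left_comm]

/-- The cup product on `C^*(S; K)`. -/
def cupLin : cochains K S →ₗ[K] cochains K S →ₗ[K] cochains K S :=
  LinearMap.mk₂ K
    (fun φ ψ => ⟨cup φ.1 ψ.1, by
      obtain ⟨N, hN⟩ := φ.2
      obtain ⟨M, hM⟩ := ψ.2
      refine ⟨N + M, fun n hn => ?_⟩
      funext σ
      refine Finset.sum_eq_zero fun x hx => ?_
      rw [Finset.HasAntidiagonal.mem_antidiagonal] at hx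
      by_cases h : N ≤ x.1
      · simp [hN _ h]
      · simp [hM x.2 (by omega)]⟩)
    (fun φ φ' ψ => by ext n σ; simp [cup, add_mul, Finset.sum_add_distrib])
    (fun c φ ψ => by ext n σ; simp [cup, Finset.mul_sum, mul_assoc])
    (fun φ ψ ψ' => by ext n σ; simp [cup, mul_add, Finset.sum_add_distrib])
    (fun c φ ψ => by ext n σ; simp [cup, Finset.mul_sum, mul_left_comm])

variable {S}

/-- The projection `φ ↦ φ - φ(s₀) · 1` of `C^*(S; K)` onto the ideal of the cochains that vanish
on the vertex `s₀`, i.e. the kernel of the augmentation `C^*(S; K) → K`, `φ ↦ φ(s₀)`. -/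
def augProj (s₀ : S _⦋0⦌) : cochains K S →ₗ[K] cochains K S where
  toFun φ := φ - φ.1 0 s₀ • unitCochain K S
  map_add' φ ψ := by
    simp only [Submodule.coe_add, Pi.add_apply, add_smul]
    abel
  map_smul' c φ := by
    simp only [Submodule.coe_smul, Pi.smul_apply, smul_eq_mul, mul_smul, smul_sub,
      RingHom.id_apply]

variable {K}

theorem augProj_apply (s₀ : S _⦋0⦌) (φ : cochains K S) :
    augProj K s₀ φ = φ - φ.1 0 s₀ • unitCochain K S := rfl

theorem augProj_eq_zero (s₀ : S _⦋0⦌) (i : ℤ) (φ : cochains K S)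
    (h : ∀ n : ℕ, (n : ℤ) ≠ i → φ.1 n = 0) (n : ℕ) (hn : (n : ℤ) ≠ i) :
    (augProj K s₀ φ).1 n = 0 := by
  match n with
  | 0 =>
    have := h 0 hn
    simp [augProj, this]
  | n + 1 =>
    have := h (n + 1) hn
    simp [augProj, this, unitCochain]

theorem cochainDLin_unit : cochainDLin K S (unitCochain K S) = 0 := by
  ext n σ
  match n with
  | 0 => rfl
  | 1 => simp [cochainDLin, cochainD, unitCochain, Fin.sum_univ_succ]
  | n + 2 => simp [cochainDLin, cochainD, unitCochain]

theorem cochainDLin_cochainDLin (φ : cochains K S) :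
    cochainDLin K S (cochainDLin K S φ) = 0 :=
  Subtype.ext (cochainD_cochainD φ.1)

theorem cochainDLin_augProj (s₀ : S _⦋0⦌) (φ : cochains K S) :
    cochainDLin K S (augProj K s₀ φ) = cochainDLin K S φ := by
  simp [augProj, cochainDLin_unit]

theorem augProj_d (s₀ : S _⦋0⦌) (φ : cochains K S) (c : K) :
    augProj K s₀ (cochainDLin K S φ + c • unitCochain K S) = cochainDLin K S φ := by
  have h : (cochainDLin K S φ + c • unitCochain K S).1 0 s₀ = c := by
    simp [cochainDLin, cochainD, unitCochain]
  rw [augProj_apply, h, add_sub_cancel_right]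

theorem augProj_apply_base (s₀ : S _⦋0⦌) (φ : cochains K S) : (augProj K s₀ φ).1 0 s₀ = 0 := by
  simp [augProj, unitCochain]

theorem augProj_cup (s₀ : S _⦋0⦌) (φ ψ : cochains K S) :
    augProj K s₀ (cupLin K S (augProj K s₀ φ) (augProj K s₀ ψ)) =
      cupLin K S (augProj K s₀ φ) (augProj K s₀ ψ) := by
  have h : (cupLin K S (augProj K s₀ φ) (augProj K s₀ ψ)).1 0 s₀ = 0 := by
    change cup _ _ 0 s₀ = 0
    rw [cup_zero_apply, augProj_apply_base, zero_mul]
  rw [augProj_apply, h, zero_smul, sub_zero]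

variable (K S)

/-- The elements of degree `i` of `K ⊕ C^*(S; K)`, where `K` is placed in degree `-1`. -/
def augGr (i : ℤ) : Submodule K (K × cochains K S) where
  carrier := {x | (i ≠ -1 → x.1 = 0) ∧ ∀ n : ℕ, (n : ℤ) ≠ i → x.2.1 n = 0}
  add_mem' := by
    rintro x y ⟨h1, h2⟩ ⟨h3, h4⟩
    exact ⟨fun h => by simp [h1 h, h3 h], fun n h => by simp [h2 n h, h4 n h]⟩
  zero_mem' := ⟨fun _ => rfl, fun _ _ => rfl⟩
  smul_mem' := by
    rintro c x ⟨h1, h2⟩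
    exact ⟨fun h => by simp [h1 h], fun n h => by simp [h2 n h]⟩

/-- The projection of `K ⊕ C^*(S; K)` to its part of degree `i`. -/
def augGrProj (i : ℤ) : (K × cochains K S) →ₗ[K] (K × cochains K S) where
  toFun x := (if i = -1 then x.1 else 0,
    ⟨fun n => if (n : ℤ) = i then x.2.1 n else 0, by
      obtain ⟨N, hN⟩ := x.2.2
      exact ⟨N, fun n hn => by simp [hN n hn]⟩⟩)
  map_add' x y := by
    ext n σ
    · dsimp
      split_ifs <;> simp
    · dsimp
      split_ifs <;> simp
  map_smul' c x := by
    ext n σ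
    · dsimp
      split_ifs <;> simp
    · dsimp
      split_ifs <;> simp

theorem augGrProj_mem (i : ℤ) (x : K × cochains K S) : augGrProj K S i x ∈ augGr K S i :=
  ⟨fun h => by simp [augGrProj, h], fun n h => by simp [augGrProj, h]⟩

theorem augGr_isInternal : DirectSum.IsInternal (augGr K S) := by
  apply DirectSum.isInternal_submodule_of_iSupIndep_of_iSup_eq_top
  · intro i
    rw [Submodule.disjoint_def]
    intro x hx hx'
    have h1 : augGrProj K S i x = x := by
      ext n σ
      · by_cases h : i = -1
        · simp [augGrProj, h]
        · simp [augGrProj, h, hx.1 h]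
      · by_cases h : (n : ℤ) = i
        · simp [augGrProj, h]
        · simp [augGrProj, h, hx.2 n h]
    have h2 : (⨆ j, ⨆ (_ : j ≠ i), augGr K S j) ≤ LinearMap.ker (augGrProj K S i) := by
      refine iSup_le fun j => iSup_le fun hj => ?_
      intro y hy
      rw [LinearMap.mem_ker]
      ext n σ
      · by_cases h : i = -1
        · have := hy.1 (by omega)
          simp [augGrProj, this]
        · simp [augGrProj, h]
      · by_cases h : (n : ℤ) = i
        · have := hy.2 n (by omega)
          simp [augGrProj, this]
        · simp [augGrProj, h]
    rw [← h1]
    exact h2 hx'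
  · rw [eq_top_iff]
    intro x _
    obtain ⟨N, hN⟩ := x.2.2
    have h : x = augGrProj K S (-1) x + ∑ m ∈ range N, augGrProj K S (m : ℤ) x := by
      ext n σ
      · have : ∀ m : ℕ, (m : ℤ) ≠ -1 := fun m => by omega
        simp [augGrProj, Prod.fst_sum, this]
      · have h0 : (n : ℤ) ≠ -1 := by omega
        simp only [Prod.snd_add, Prod.snd_sum, Submodule.coe_add, Submodule.coe_sum, Pi.add_apply,
          Finset.sum_apply]
        simp only [augGrProj, LinearMap.coe_mk, AddHom.coe_mk, h0, if_false, Nat.cast_inj,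
          Pi.zero_apply, zero_add]
        by_cases hn : N ≤ n
        · rw [hN n hn]
          simp
        · rw [Finset.sum_eq_single n]
          · simp
          · intro b _ hb
            simp [Ne.symm hb]
          · intro hb
            simp at hb
            omega
    rw [h]
    refine add_mem (Submodule.mem_iSup_of_mem _ (augGrProj_mem K S _ x)) (sum_mem fun m _ => ?_)
    exact Submodule.mem_iSup_of_mem _ (augGrProj_mem K S _ x)

/-- The augmented cochain dg-algebra of a simplicial set with a base vertex `s₀`. The underlying
complex is `0 → K → C^0(S; K) → C^1(S; K) → ⋯`, with `K` in degree `-1`, where `c : K` is sent to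
the constant `0`-cochain `c`; its cohomology is the reduced cohomology. The cup product with the
unit cochain `1` does not extend to this complex, because `1` is exact in it. The complex is the
direct sum of the ideal of `C^*(S; K)` of the cochains that vanish on `s₀` and of the acyclic
complex `K → K · 1`; the product is the cup product on the former, and it is zero if one
of the factors lies in the latter. So the cohomology algebra is the reduced cohomology with its
cup product. -/
def augCochains {S : SSet.{u}} (s₀ : S _⦋0⦌) : DGAlgebra.{v, max u v} K where
  carrier := K × cochains K S
  gr := augGr K S
  isInternal := augGr_isInternal K S
  d := LinearMap.prod 0
    ((cochainDLin K S).comp (LinearMap.snd K K (cochains K S)) +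
      (LinearMap.fst K K (cochains K S)).smulRight (unitCochain K S))
  mul := ((cupLin K S).compl₁₂ (augProj K s₀ ∘ₗ LinearMap.snd K K (cochains K S))
    (augProj K s₀ ∘ₗ LinearMap.snd K K (cochains K S))).compr₂
      (LinearMap.inr K K (cochains K S))
  d_mem := by
    rintro i ⟨c, φ⟩ ⟨h1, h2⟩
    refine ⟨fun _ => rfl, fun n hn => ?_⟩
    funext σ
    match n with
    | 0 =>
      have : c = 0 := h1 (by rintro rfl; simp at hn)
      simp [cochainDLin, cochainD, this]
    | n + 1 =>
      have : φ.1 n = 0 := h2 n (by rintro rfl; simp at hn)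
      simp [cochainDLin, cochainD, unitCochain, this]
  mul_mem := by
    rintro i j ⟨c, φ⟩ ⟨e, ψ⟩ ⟨h1, h2⟩ ⟨h3, h4⟩
    refine ⟨fun _ => rfl, fun n hn => ?_⟩
    funext σ
    change cup (augProj K s₀ φ).1 (augProj K s₀ ψ).1 n σ = 0
    refine Finset.sum_eq_zero fun x hx => ?_
    rw [Finset.HasAntidiagonal.mem_antidiagonal] at hx
    by_cases h : (x.1 : ℤ) = i
    · have := augProj_eq_zero s₀ j ψ h4 x.2 (by omega)
      simp [this]
    · have := augProj_eq_zero s₀ i φ h2 x.1 h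
      simp [this]
  d_d := by
    rintro ⟨c, φ⟩
    simp [cochainDLin_cochainDLin, cochainDLin_unit]
  mul_assoc := by
    rintro ⟨c, φ⟩ ⟨e, ψ⟩ ⟨g, χ⟩
    simp only [LinearMap.compr₂_apply, LinearMap.compl₁₂_apply, LinearMap.comp_apply,
      LinearMap.snd_apply, LinearMap.inr_apply, augProj_cup]
    exact congrArg (Prod.mk (0 : K)) (Subtype.ext (cup_assoc _ _ _))
  leibniz := by
    rintro i ⟨c, φ⟩ ⟨e, ψ⟩ ⟨h1, h2⟩
    have h := cochainD_cup i (augProj K s₀ φ).1 (augProj K s₀ ψ).1 (augProj_eq_zero s₀ i φ h2)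
    have h' : cochainDLin K S (cupLin K S (augProj K s₀ φ) (augProj K s₀ ψ)) =
        cupLin K S (cochainDLin K S φ) (augProj K s₀ ψ) +
          i.negOnePow • cupLin K S (augProj K s₀ φ) (cochainDLin K S ψ) := by
      rw [← cochainDLin_augProj s₀ φ, ← cochainDLin_augProj s₀ ψ]
      exact Subtype.ext h
    refine Prod.ext ?_ ?_
    · simp
    · simpa [augProj_d, -map_add] using h'

theorem augCochains_d_apply {S : SSet.{u}} (s₀ : S _⦋0⦌) (c : K) (φ : cochains K S) :
    (augCochains K s₀).d (c, φ) = ((0 : K), cochainDLin K S φ + c • unitCochain K S) := rfl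

theorem augCochains_mul_apply {S : SSet.{u}} (s₀ : S _⦋0⦌) (c e : K) (φ ψ : cochains K S) :
    (augCochains K s₀).mul (c, φ) (e, ψ) =
      ((0 : K), cupLin K S (augProj K s₀ φ) (augProj K s₀ ψ)) := rfl

end Cochains

/-- The Lusternik-Schnirelmann category of `X`: the least `n` such that `X` is covered by `n + 1`
open subsets whose inclusions into `X` are null-homotopic (`⊤` if there is no such `n`). -/
noncomputable def lsCat (X : Type u) [TopologicalSpace X] : ℕ∞ :=
  sInf {k : ℕ∞ | ∃ n : ℕ, k = n ∧ ∃ U : Fin (n + 1) → Set X,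
    (∀ i, IsOpen (U i)) ∧ (⋃ i, U i) = Set.univ ∧
      ∀ i, (⟨Subtype.val, continuous_subtype_val⟩ : C(U i, X)).Nullhomotopic}

/-- The augmented singular cochain dg-algebra of the space `X`, with base point `x₀`. -/
noncomputable def augSingularCochains (K : Type v) [Field K] (X : Type u) [TopologicalSpace X]
    (x₀ : X) : DGAlgebra.{v, max u v} K :=
  augCochains K (S := TopCat.toSSet.obj (TopCat.of X))
    ((TopCat.toSSetObjEquiv (TopCat.of X) (Opposite.op (SimplexCategory.mk 0))).symm
      (ContinuousMap.const _ x₀))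

/-! ### Linear algebra over a field -/

/-! Write X = U ∪ V with U and V open and null-homotopic in X, and let A be the augmented cochain
algebra.

Suppose first that every 0-cocycle of X is constant, so that reduced cohomology vanishes in degree
0. Coning simplices along the null-homotopy makes every cocycle of positive degree exact on the
simplices inside U. Hence every class has a representative in J₁, the right ideal of the elements
whose augmentation part vanishes on simplices inside U. In the same way every class has a
representative in J₂, defined with V (`Sing.exists_sub_d_mem_augVanishing`). The product J₁J₂ lies
in the two-sided ideal N of the cochains that vanish on all simplices inside U and on all simplices
inside V. N is acyclic by barycentric subdivision (`Sing.exists_cobdry_eq`). So products in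
cohomology vanish, and the same geometry kills the higher obstructions.

In detail (`DGAlgebra.isFormal_of_ideals`): let H be cohomology with zero product. Choose linear
maps a : H → J₁ giving representing cocycles and c : H → A of degree -1 with dc - a valued in J₂.
The family G_n = a(v_0)c(v_1)⋯c(v_{n-1}) starts with a factor in J₁, so it solves the twisting
equation dF_n = ∑ τ(F_i)F_j modulo N, where τ is the grading involution. A recursion corrects the
error using a linear section h of d on the cocycles of N (`DGAlgebra.twistRec_prodSeq_spec`).
Because H has no operations, a solution is, up to signs, an A_∞-morphism H → A with linear part -a
(`DGAlgebra.exists_hom_of_twisting`).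

The remaining case is U and V disjoint and both nonempty. Then reduced cohomology is K in degree 0,
spanned by the idempotent indicator cochain of the set that misses the base point. Its product is
not zero, so the previous argument cannot apply; instead a strict morphism from K in degree 0 is a
quasi-isomorphism (`DGAlgebra.isFormal_of_idempotent`). -/

theorem exists_linearMap_mem_of_forall_exists {K : Type*} [Field K] {V W : Type*}
    [AddCommGroup V] [Module K V] [AddCommGroup W] [Module K W] (R : Submodule K (V × W))
    (hR : ∀ x, ∃ y, (x, y) ∈ R) : ∃ s : V →ₗ[K] W, ∀ x, (x, s x) ∈ R := by
  -- The projection R → V is onto, hence has a linear section over a field. This is what makes later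
  -- choices of representatives and primitives linear.
  obtain ⟨t, ht⟩ := ((LinearMap.fst K V W).comp R.subtype).exists_rightInverse_of_surjective
    (LinearMap.range_eq_top.2 fun x => by
      obtain ⟨y, hy⟩ := hR x
      exact ⟨⟨(x, y), hy⟩, rfl⟩)
  refine ⟨(LinearMap.snd K V W).comp (R.subtype.comp t), fun x => ?_⟩
  have h : (t x).1.1 = x := LinearMap.congr_fun ht x
  have h' := (t x).2
  rwa [← Prod.mk.eta (p := (t x).1), h] at h'

/-! ### Functions of sequences that are multilinear in an initial segment -/

/-- `Φ` depends only on the first `n` entries of a sequence, and linearly on each of them. -/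
structure IsMultilinearSeq (K : Type*) [Field K] {V M : Type*} [AddCommGroup V] [Module K V]
    [AddCommGroup M] [Module K M] (n : ℕ) (Φ : (ℕ → V) → M) : Prop where
  congr : ∀ v w : ℕ → V, (∀ i < n, v i = w i) → Φ v = Φ w
  map_add : ∀ (v : ℕ → V) (i : ℕ), i < n → ∀ x y, Φ (Function.update v i (x + y)) =
    Φ (Function.update v i x) + Φ (Function.update v i y)
  map_smul : ∀ (v : ℕ → V) (i : ℕ), i < n → ∀ (c : K) x, Φ (Function.update v i (c • x)) =
    c • Φ (Function.update v i x)

namespace IsMultilinearSeq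

variable {K : Type*} [Field K] {V M M' M'' : Type*} [AddCommGroup V] [Module K V]
  [AddCommGroup M] [Module K M] [AddCommGroup M'] [Module K M'] [AddCommGroup M''] [Module K M'']

theorem zero (n : ℕ) : IsMultilinearSeq K n (fun _ : ℕ → V => (0 : M)) := by
  constructor <;> simp

theorem add {n : ℕ} {Φ Ψ : (ℕ → V) → M} (h : IsMultilinearSeq K n Φ)
    (h' : IsMultilinearSeq K n Ψ) : IsMultilinearSeq K n (fun v => Φ v + Ψ v) where
  congr v w e := by rw [h.congr v w e, h'.congr v w e]
  map_add v i hi x y := by rw [h.map_add v i hi, h'.map_add v i hi]; abel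
  map_smul v i hi c x := by rw [h.map_smul v i hi, h'.map_smul v i hi, smul_add]

theorem comp {n : ℕ} {Φ : (ℕ → V) → M} (g : M →ₗ[K] M') (h : IsMultilinearSeq K n Φ) :
    IsMultilinearSeq K n (fun v => g (Φ v)) where
  congr v w e := by rw [h.congr v w e]
  map_add v i hi x y := by rw [h.map_add v i hi, _root_.map_add]
  map_smul v i hi c x := by rw [h.map_smul v i hi, _root_.map_smul]

theorem sum {n : ℕ} {ι : Type*} (s : Finset ι) {Φ : ι → (ℕ → V) → M}
    (h : ∀ i ∈ s, IsMultilinearSeq K n (Φ i)) : IsMultilinearSeq K n (fun v => ∑ i ∈ s, Φ i v) where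
  congr v w e := Finset.sum_congr rfl fun i hi => (h i hi).congr v w e
  map_add v i hi x y := by
    rw [← Finset.sum_add_distrib]
    exact Finset.sum_congr rfl fun j hj => (h j hj).map_add v i hi x y
  map_smul v i hi c x := by
    rw [Finset.smul_sum]
    exact Finset.sum_congr rfl fun j hj => (h j hj).map_smul v i hi c x

theorem apply (g : V →ₗ[K] M) : IsMultilinearSeq K 1 (fun v : ℕ → V => g (v 0)) where
  congr v w e := by rw [e 0 one_pos]
  map_add v i hi x y := by
    obtain rfl : i = 0 := by omega
    simp
  map_smul v i hi c x := by
    obtain rfl : i = 0 := by omega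
    simp

theorem shift_update_of_lt {W : Type*} (v : ℕ → W) {n i : ℕ} (hi : i < n) (x : W) :
    (fun k => Function.update v i x (n + k)) = fun k => v (n + k) := by
  funext k
  rw [Function.update_of_ne (by omega)]

theorem shift_update_add {W : Type*} (v : ℕ → W) (n i : ℕ) (x : W) :
    (fun k => Function.update v (n + i) x (n + k)) =
      Function.update (fun k => v (n + k)) i x := by
  funext k
  simp [Function.update_apply]

theorem mul (B : M →ₗ[K] M' →ₗ[K] M'') {n m p : ℕ} (hp : n + m = p) {Φ : (ℕ → V) → M}
    {Ψ : (ℕ → V) → M'} (h : IsMultilinearSeq K n Φ) (h' : IsMultilinearSeq K m Ψ) :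
    IsMultilinearSeq K p (fun v => B (Φ v) (Ψ (fun k => v (n + k)))) := by
  subst hp
  have key (v : ℕ → V) (i : ℕ) (hi : n ≤ i) (x : V) : Φ (Function.update v i x) = Φ v :=
    h.congr _ _ fun j hj => Function.update_of_ne (by omega) _ _
  refine ⟨fun v w e => ?_, fun v i hi x y => ?_, fun v i hi c x => ?_⟩
  · rw [h.congr v w fun i hi => e i (by omega),
      h'.congr (fun k => v (n + k)) (fun k => w (n + k)) fun i hi => e _ (by omega)]
  · obtain hi' | hi' := lt_or_ge i n
    · simp only [shift_update_of_lt _ hi', h.map_add v i hi', _root_.map_add, LinearMap.add_apply]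
    · obtain ⟨i, rfl⟩ := Nat.exists_eq_add_of_le hi'
      simp only [key _ _ hi', shift_update_add, h'.map_add _ i (by omega), _root_.map_add]
  · obtain hi' | hi' := lt_or_ge i n
    · simp only [shift_update_of_lt _ hi', h.map_smul v i hi', _root_.map_smul,
        LinearMap.smul_apply]
    · obtain ⟨i, rfl⟩ := Nat.exists_eq_add_of_le hi'
      simp only [key _ _ hi', shift_update_add, h'.map_smul _ i (by omega), _root_.map_smul]

/-- Extension of a finite sequence by zero. -/
def extendZero {n : ℕ} (v : Fin n → V) (i : ℕ) : V := if h : i < n then v ⟨i, h⟩ else 0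

theorem extendZero_update {n : ℕ} (v : Fin n → V) (i : Fin n) (x : V) [DecidableEq (Fin n)] :
    extendZero (Function.update v i x) = Function.update (extendZero v) i x := by
  funext k
  by_cases hk : k < n <;> by_cases hi : k = i
  · subst hi; simp [extendZero]
  · have : (⟨k, hk⟩ : Fin n) ≠ i := fun h => hi (by rw [← h])
    simp [extendZero, hk, Function.update_of_ne, hi, this]
  · exact absurd (hi ▸ i.is_lt) hk
  · simp [extendZero, hk, hi]

/-- The multilinear map of `n` variables given by a function that is multilinear in the first `n`
entries of a sequence. -/
def toMultilinearMap {n : ℕ} {Φ : (ℕ → V) → M} (h : IsMultilinearSeq K n Φ) :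
    MultilinearMap K (fun _ : Fin n => V) M where
  toFun v := Φ (extendZero v)
  map_update_add' v i x y := by simp only [extendZero_update, h.map_add _ _ i.is_lt]
  map_update_smul' v i c x := by simp only [extendZero_update, h.map_smul _ _ i.is_lt]

theorem toMultilinearMap_apply {n : ℕ} {Φ : (ℕ → V) → M} (h : IsMultilinearSeq K n Φ)
    (v : ℕ → V) : h.toMultilinearMap (fun i => v i) = Φ v :=
  h.congr _ _ fun i hi => by simp [extendZero, hi]

end IsMultilinearSeq

/-! ### The grading of a dg-algebra -/

namespace DGAlgebra

variable {K : Type v} [Field K] (A : DGAlgebra.{v, w} K)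

theorem linearMap_ext {B : Type*} [AddCommGroup B] [Module K B] {f g : A.carrier →ₗ[K] B}
    (h : ∀ i, ∀ x ∈ A.gr i, f x = g x) : f = g := by
  ext x
  have hx : x ∈ ⨆ i, A.gr i := by
    rw [A.isInternal.submodule_iSup_eq_top]
    trivial
  induction hx using Submodule.iSup_induction' with
  | zero => simp
  | add x y _ _ hx hy => simp [hx, hy]
  | mem i x hx => exact h i x hx

theorem exists_linearMap {B : Type*} [AddCommGroup B] [Module K B] (g : ∀ i, A.gr i →ₗ[K] B) :
    ∃ f : A.carrier →ₗ[K] B, ∀ i (x : A.gr i), f x = g i x := by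
  let e := LinearEquiv.ofBijective (DirectSum.coeLinearMap A.gr) A.isInternal
  refine ⟨(DirectSum.toModule K ℤ B g).comp e.symm.toLinearMap, fun i x => ?_⟩
  have : e.symm x = DirectSum.lof K ℤ (fun i => A.gr i) i x := by
    rw [LinearEquiv.symm_apply_eq]
    exact (DirectSum.coeLinearMap_lof A.gr i x).symm
  simp [this]

/-- The scalar `(-1)^i`. -/
def sign (K : Type v) [Field K] (i : ℤ) : K := ((i.negOnePow : ℤ) : K)

theorem sign_smul (i : ℤ) {V : Type*} [AddCommGroup V] [Module K V] (x : V) :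
    i.negOnePow • x = sign K i • x := by
  rw [sign, Int.cast_smul_eq_zsmul, Units.smul_def]

theorem sign_add (i j : ℤ) : sign K (i + j) = sign K i * sign K j := by
  simp [sign, Int.negOnePow_add]

theorem sign_zero : sign K 0 = 1 := by simp [sign]

theorem sign_one : sign K 1 = -1 := by simp [sign]

theorem sign_mul_self (i : ℤ) : sign K i * sign K i = 1 := by
  rw [← sign_add, sign, Int.negOnePow_add, Int.units_mul_self]
  simp

theorem sign_sum {ι : Type*} (s : Finset ι) (f : ι → ℤ) :
    sign K (∑ i ∈ s, f i) = ∏ i ∈ s, sign K (f i) := by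
  classical
  induction s using Finset.induction_on with
  | empty => simp [sign_zero]
  | insert a s ha ih => rw [Finset.sum_insert ha, Finset.prod_insert ha, sign_add, ih]

theorem exists_involution : ∃ f : A.carrier →ₗ[K] A.carrier,
    ∀ i, ∀ x ∈ A.gr i, f x = sign K i • x := by
  obtain ⟨f, hf⟩ := A.exists_linearMap (fun i => sign K i • (A.gr i).subtype)
  exact ⟨f, fun i x hx => hf i ⟨x, hx⟩⟩

/-- The grading involution: multiplication by `(-1)^i` in degree `i`. -/
noncomputable def involution : A.carrier →ₗ[K] A.carrier := A.exists_involution.choose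

theorem involution_apply {i : ℤ} {x : A.carrier} (hx : x ∈ A.gr i) :
    A.involution x = sign K i • x := A.exists_involution.choose_spec i x hx

theorem involution_mem {i : ℤ} {x : A.carrier} (hx : x ∈ A.gr i) : A.involution x ∈ A.gr i := by
  rw [A.involution_apply hx]
  exact Submodule.smul_mem _ _ hx

/-- A sign depending on a degree becomes a linear operator, so it can be built into a multilinear
map defined on inhomogeneous elements too. -/
theorem involution_pow_apply {i : ℤ} {x : A.carrier} (hx : x ∈ A.gr i) (n : ℕ) :
    (A.involution ^ n) x = sign K (n * i) • x := by
  induction n with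
  | zero => simp [sign_zero]
  | succ n ih =>
    rw [pow_succ', Module.End.mul_apply, ih, map_smul, A.involution_apply hx, smul_smul, ← sign_add]
    congr 2
    push_cast
    ring

theorem involution_involution (x : A.carrier) : A.involution (A.involution x) = x := by
  have : A.involution.comp A.involution = LinearMap.id := A.linearMap_ext fun i x hx => by
    simp [A.involution_apply hx, smul_smul, sign_mul_self]
  exact LinearMap.congr_fun this x

theorem d_involution (x : A.carrier) : A.d (A.involution x) = -A.involution (A.d x) := by
  have : A.d.comp A.involution = -(A.involution.comp A.d) := A.linearMap_ext fun i x hx => by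
    simp [A.involution_apply hx, A.involution_apply (A.d_mem i x hx), sign_add, sign_one]
  exact LinearMap.congr_fun this x

theorem involution_mul (x y : A.carrier) :
    A.involution (A.mul x y) = A.mul (A.involution x) (A.involution y) := by
  have : A.mul.compr₂ A.involution = A.mul.compl₁₂ A.involution A.involution :=
    A.linearMap_ext fun i x hx => A.linearMap_ext fun j y hy => by
      simp [A.involution_apply hx, A.involution_apply hy,
        A.involution_apply (A.mul_mem _ _ _ _ hx hy), sign_add, smul_smul, mul_comm]
  exact LinearMap.congr_fun₂ this x y

/-- With the involution in place of the sign, the Leibniz rule needs no homogeneity, so the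
recursion below can be manipulated without tracking degrees. -/
theorem d_mul (x y : A.carrier) :
    A.d (A.mul x y) = A.mul (A.d x) y + A.mul (A.involution x) (A.d y) := by
  have : (A.mul.flip y).comp A.d + (A.mul.flip (A.d y)).comp A.involution =
      A.d.comp (A.mul.flip y) := A.linearMap_ext fun i x hx => by
    simp [A.involution_apply hx, A.leibniz i x y hx, sign_smul (K := K) i]
  exact (LinearMap.congr_fun this x).symm

end DGAlgebra

/-! ### Sums over compositions -/

/-- The composition `(i, j)` of `n = i + j`. -/
def Composition.pair {n i j : ℕ} (hi : 0 < i) (hj : 0 < j) (h : i + j = n) : Composition n where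
  blocks := [i, j]
  blocks_pos := by
    intro k hk
    simp only [List.mem_cons, List.not_mem_nil, or_false] at hk
    obtain rfl | rfl := hk <;> assumption
  blocks_sum := by simp [h]

/-- Serves the right-hand side of the morphism relation: a dg-algebra has only m_1 and m_2, so only
one or two blocks count. The pairs (0, n) and (n, 0) are not compositions, whence the last two
hypotheses. -/
theorem Composition.sum_eq_of_length_le_two {M : Type*} [AddCommMonoid M] {n : ℕ} (hn : 0 < n)
    (g : Composition n → M) (hg : ∀ c, 3 ≤ c.length → g c = 0) (g' : ℕ × ℕ → M)
    (hg' : ∀ i j (hi : 0 < i) (hj : 0 < j) (h : i + j = n),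
      g (Composition.pair hi hj h) = g' (i, j))
    (h0 : g' (0, n) = 0) (h0' : g' (n, 0) = 0) :
    ∑ c, g c = g (Composition.single n hn) + ∑ x ∈ antidiagonal n, g' x := by
  classical
  rw [← Finset.add_sum_erase _ _ (Finset.mem_univ (Composition.single n hn))]
  congr 1
  symm
  refine Finset.sum_bij_ne_zero
    (fun x hx h => if hp : 0 < x.1 ∧ 0 < x.2 then
      Composition.pair hp.1 hp.2 (HasAntidiagonal.mem_antidiagonal.1 hx)
      else Composition.single n hn) ?_ ?_ ?_ ?_
  all_goals
    have key : ∀ x ∈ antidiagonal n, g' x ≠ 0 → 0 < x.1 ∧ 0 < x.2 := by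
      rintro ⟨i, j⟩ hx h
      rw [HasAntidiagonal.mem_antidiagonal] at hx
      dsimp only at hx ⊢
      refine ⟨Nat.pos_of_ne_zero ?_, Nat.pos_of_ne_zero ?_⟩
      · rintro rfl
        obtain rfl : j = n := by omega
        exact h h0
      · rintro rfl
        obtain rfl : i = n := by omega
        exact h h0'
  · intro x hx h
    rw [dif_pos (key x hx h), Finset.mem_erase]
    refine ⟨fun e => ?_, Finset.mem_univ _⟩
    have := congrArg Composition.length e
    simp [Composition.pair, Composition.length, Composition.single] at this
  · intro x hx h y hy h' e
    rw [dif_pos (key x hx h), dif_pos (key y hy h')] at e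
    have := congrArg Composition.blocks e
    simp only [Composition.pair, List.cons.injEq, and_true] at this
    exact Prod.ext this.1 this.2
  · rintro c hc h
    have h2 : c.length ≤ 2 := by
      by_contra h'
      exact h (hg c (by omega))
    have h1 : c ≠ Composition.single n hn := (Finset.mem_erase.1 hc).1
    have h3 : c.length ≠ 1 := fun h' => h1 ((Composition.eq_single_iff_length hn).2 h')
    have h4 : 0 < c.length := c.length_pos_of_pos hn
    have h5 : c.blocks.length = 2 := by
      have : c.blocks.length = c.length := rfl
      omega
    obtain ⟨i, j, hij⟩ := List.length_eq_two.1 h5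
    have hi : 0 < i := c.blocks_pos (by rw [hij]; simp)
    have hj : 0 < j := c.blocks_pos (by rw [hij]; simp)
    have hs : i + j = n := by
      have := c.blocks_sum
      rw [hij] at this
      simpa using this
    have hc' : c = Composition.pair hi hj hs := Composition.ext hij
    refine ⟨(i, j), HasAntidiagonal.mem_antidiagonal.2 hs, ?_, ?_⟩
    · rw [← hg' i j hi hj hs, ← hc']
      exact h
    · rw [dif_pos ⟨hi, hj⟩, hc']
  · intro x hx h
    rw [dif_pos (key x hx h), hg']

/-! ### `A_∞`-morphisms from twisting families -/

namespace DGAlgebra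

variable {K : Type v} [Field K]

theorem sign_congr {i j : ℤ} (h : Even (i - j)) : sign K i = sign K j := by
  rw [← sub_add_cancel i j, sign_add, sign, Int.negOnePow_even _ h]
  simp

theorem ops_eq_zero_of_trivial (H : DGAlgebra.{v, w} K) (hd : H.d = 0) (hm : H.mul = 0) (n : ℕ) :
    H.ops n = 0 := by
  match n with
  | 0 => rfl
  | 1 => ext v; simp [ops_one, hd]
  | 2 => ext v; simp [ops_two, hm]
  | n + 3 => rfl

/-- The obstruction `∑ τ(F_i) F_j`, where `τ` is the grading involution. -/
noncomputable def conv (A : DGAlgebra.{v, w} K) {V : Type*} (F : ℕ → (ℕ → V) → A.carrier) (n : ℕ)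
    (v : ℕ → V) : A.carrier :=
  ∑ x ∈ antidiagonal n, A.mul (A.involution (F x.1 v)) (F x.2 (fun k => v (x.1 + k)))

/-- The exponent of the sign that turns a twisting family into an `A_∞`-morphism. -/
def twistExp (n : ℕ) (deg : ℕ → ℤ) : ℤ := ∑ l ∈ range n, ((n - 1 - l : ℕ) : ℤ) * deg l

/-- The weight of an entry is the number of entries to its right; concatenation gives each entry of
the first block j more. -/
theorem twistExp_add (i j : ℕ) (deg : ℕ → ℤ) : twistExp (i + j) deg =
    twistExp i deg + j * ∑ l ∈ range i, deg l + twistExp j (fun k => deg (i + k)) := by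
  simp only [twistExp, Finset.sum_range_add, Finset.mul_sum, ← Finset.sum_add_distrib]
  congr 1
  · refine Finset.sum_congr rfl fun l hl => ?_
    rw [Finset.mem_range] at hl
    rw [← add_mul]
    congr 1
    norm_cast
    omega
  · refine Finset.sum_congr rfl fun l hl => ?_
    rw [Finset.mem_range] at hl
    congr 2
    omega

/-- An `A_∞`-morphism of dg-algebras, with the data stated in terms of the dg-algebras. -/
def homMk (H : DGAlgebra.{v, w} K) (A : DGAlgebra.{v, w'} K)
    (f : (n : ℕ) → MultilinearMap K (fun _ : Fin n => H.carrier) A.carrier)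
    (f_zero : f 0 = 0)
    (f_mem : ∀ (n : ℕ) (v : Fin n → H.carrier) (deg : Fin n → ℤ), (∀ i, v i ∈ H.gr (deg i)) →
      f n v ∈ A.gr (∑ i, deg i + 1 - n))
    (relation : ∀ (n : ℕ) (v : ℕ → H.carrier) (deg : ℕ → ℤ), 1 ≤ n → (∀ i, v i ∈ H.gr (deg i)) →
      ∑ x ∈ antidiagonal n, ∑ y ∈ antidiagonal x.2 with 1 ≤ y.1,
        (((x.1 : ℤ) + y.1 * y.2) + (2 - (y.1 : ℤ)) * ∑ l ∈ range x.1, deg l).negOnePow •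
          f (x.1 + 1 + y.2) (fun i =>
            spliceSeq v x.1 y.1 (H.ops y.1 (fun j => v (x.1 + j))) i) =
      ∑ c : Composition n,
        ((∑ j : Fin c.length, ((c.length : ℤ) - 1 - j) * ((c.blocksFun j : ℤ) - 1)) +
          ∑ j : Fin c.length, (1 - (c.blocksFun j : ℤ)) *
            ∑ l ∈ range (c.sizeUpTo j), deg l).negOnePow •
          A.ops c.length (fun j => f (c.blocksFun j) (fun i => v (c.sizeUpTo j + i)))) :
    AInfAlgebra.Hom H.toAInf A.toAInf where
  f := f
  f_zero := f_zero
  f_mem := f_mem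
  relation := relation

/-- The source has no operations, so the left side of the relation is zero and the right side is d
f_n + ∑ ± f_i f_j. The substitution f_n = -(-1)^{`twistExp n`} F_n turns this into the twisting
equation: the exponent absorbs the Koszul signs, and the overall minus changes the linear term but
not the quadratic one. -/
theorem exists_hom_of_twisting (H : DGAlgebra.{v, w} K) (A : DGAlgebra.{v, w'} K) (hd : H.d = 0)
    (hm : H.mul = 0) (F : ℕ → (ℕ → H.carrier) → A.carrier)
    (hF : ∀ n, IsMultilinearSeq K n (F n)) (h0 : ∀ v, F 0 v = 0)
    (hmem : ∀ n (v : ℕ → H.carrier) (deg : ℕ → ℤ), (∀ i, v i ∈ H.gr (deg i)) →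
      F n v ∈ A.gr (∑ l ∈ range n, deg l + 1 - n))
    (htw : ∀ n (v : ℕ → H.carrier) (deg : ℕ → ℤ), (∀ i, v i ∈ H.gr (deg i)) →
      A.d (F n v) = A.conv F n v) :
    ∃ G : AInfAlgebra.Hom H.toAInf A.toAInf, ∀ x, G.linear x = -F 1 (fun _ => x) := by
  -- The powers of the involution on the entries multiply to the sign with exponent `twistExp n`.
  let f (n : ℕ) : MultilinearMap K (fun _ : Fin n => H.carrier) A.carrier :=
    -((hF n).toMultilinearMap.compLinearMap (fun l : Fin n => H.involution ^ (n - 1 - (l : ℕ))))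
  have hf (n : ℕ) (v : ℕ → H.carrier) (deg : ℕ → ℤ) (hv : ∀ i, v i ∈ H.gr (deg i)) :
      f n (fun i => v i) = -(sign K (twistExp n deg) • F n v) := by
    simp only [f, neg_apply, MultilinearMap.compLinearMap_apply,
      H.involution_pow_apply (hv _)]
    rw [MultilinearMap.map_smul_univ, IsMultilinearSeq.toMultilinearMap_apply, twistExp, sign_sum,
      Finset.prod_range]
  have hfz : f 0 = 0 := by
    ext v
    simp [f, IsMultilinearSeq.toMultilinearMap, h0]
  have hlin (x : H.carrier) : f 1 (fun _ => x) = -F 1 (fun _ => x) := by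
    simp only [f, neg_apply, MultilinearMap.compLinearMap_apply]
    rw [← (hF 1).toMultilinearMap_apply]
    simp
  refine ⟨homMk H A f hfz (fun n v deg hv => ?_) (fun n v deg hn hv => ?_), hlin⟩
  · have hv' : ∀ i, IsMultilinearSeq.extendZero v i ∈
        H.gr (if h : i < n then deg ⟨i, h⟩ else 0) := by
      intro i
      by_cases h : i < n
      · simpa [IsMultilinearSeq.extendZero, h] using hv ⟨i, h⟩
      · simp [IsMultilinearSeq.extendZero, h]
    have e : v = fun i : Fin n => IsMultilinearSeq.extendZero v i := by
      funext i
      simp [IsMultilinearSeq.extendZero]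
    have h := hmem n _ _ hv'
    rw [Finset.sum_range] at h
    simp only [Fin.is_lt, dif_pos, Fin.eta] at h
    rw [e, hf n _ _ hv']
    exact Submodule.neg_mem _ (Submodule.smul_mem _ _ h)
  · rw [Finset.sum_eq_zero, eq_comm, Composition.sum_eq_of_length_le_two hn _
      (fun c hc => by rw [A.ops_eq_zero _ (Or.inr hc)]; simp)
      (fun x => sign K (twistExp n deg) •
        A.mul (A.involution (F x.1 v)) (F x.2 (fun k => v (x.1 + k)))) ?_ (by simp [h0])
      (by simp [h0])]
    · rw [← Finset.smul_sum]
      change _ + _ • A.conv F n v = 0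
      rw [← htw n v deg hv]
      have e : (A.ops (Composition.single n hn).length fun j =>
          f ((Composition.single n hn).blocksFun j)
            fun i => v ((Composition.single n hn).sizeUpTo j + i)) =
          A.d (f n (fun i => v i)) := by
        change A.d (f n (fun i => v (0 + i))) = _
        simp only [zero_add]
      rw [e, hf n v deg hv]
      simp [Composition.sizeUpTo]
    · intro i j hi hj hs
      have e : (A.ops (Composition.pair hi hj hs).length fun k =>
          f ((Composition.pair hi hj hs).blocksFun k)
            fun l => v ((Composition.pair hi hj hs).sizeUpTo k + l)) =
          A.mul (f i (fun l => v l)) (f j (fun l => v (i + l))) := by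
        change A.mul (f i (fun l => v (0 + l))) (f j (fun l => v (i + l))) = _
        simp only [zero_add]
      rw [e, hf i v deg hv, hf j (fun l => v (i + l)) (fun l => deg (i + l)) fun l => hv _,
        A.involution_apply (hmem i v deg hv), sign_smul (K := K)]
      simp only [map_neg, map_smul, LinearMap.neg_apply, LinearMap.smul_apply, neg_neg, smul_neg,
        smul_smul, ← sign_add]
      congr 1
      apply sign_congr
      have e1 : ∑ k : Fin (Composition.pair hi hj hs).length,
          (((Composition.pair hi hj hs).length : ℤ) - 1 - k) *
            (((Composition.pair hi hj hs).blocksFun k : ℤ) - 1) = (i : ℤ) - 1 := by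
        change ∑ k : Fin 2, ((2 : ℤ) - 1 - k) *
            (((Composition.pair hi hj hs).blocksFun k : ℤ) - 1) = (i : ℤ) - 1
        rw [Fin.sum_univ_two]
        change ((2 : ℤ) - 1 - (0 : ℕ)) * ((i : ℤ) - 1) + ((2 : ℤ) - 1 - (1 : ℕ)) * ((j : ℤ) - 1) = _
        push_cast
        ring
      have e2 : ∑ k : Fin (Composition.pair hi hj hs).length,
          (1 - ((Composition.pair hi hj hs).blocksFun k : ℤ)) *
            ∑ l ∈ range ((Composition.pair hi hj hs).sizeUpTo k), deg l =
          (1 - (j : ℤ)) * ∑ l ∈ range i, deg l := by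
        change ∑ k : Fin 2, (1 - ((Composition.pair hi hj hs).blocksFun k : ℤ)) *
            ∑ l ∈ range ((Composition.pair hi hj hs).sizeUpTo k), deg l = _
        rw [Fin.sum_univ_two]
        change (1 - (i : ℤ)) * ∑ l ∈ range 0, deg l + (1 - (j : ℤ)) * ∑ l ∈ range i, deg l = _
        simp
      rw [e1, e2, show twistExp n deg = twistExp (i + j) deg by rw [hs], twistExp_add]
      -- With S the sum of the degrees in the first block, the relation contributes (i - 1) + (1 -
      -- j)S, the involution S + 1 - i, and `twistExp_add` the cross term jS; the exponents differ
      -- by 2(i - 1 - jS).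
      exact ⟨(i : ℤ) - 1 - j * ∑ l ∈ range i, deg l, by ring⟩
    · intro x hx
      refine Finset.sum_eq_zero fun y hy => ?_
      -- Position r of the spliced sequence holds the value of an operation of `H`, which is zero.
      rw [H.ops_eq_zero_of_trivial hd hm]
      rw [MultilinearMap.map_coord_zero (i := ⟨x.1, by omega⟩), smul_zero]
      simp [spliceSeq]

end DGAlgebra

/-! ### Solving the twisting equation by recursion -/

namespace DGAlgebra

variable {K : Type v} [Field K]

theorem isQuasiIso_of_forall {H : DGAlgebra.{v, w} K} {A : DGAlgebra.{v, w'} K} (hd : H.d = 0)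
    (F : AInfAlgebra.Hom H.toAInf A.toAInf) (g : H.carrier → A.carrier) (hg : ∀ x, F.linear x = g x)
    (hinj : ∀ x y, A.d y = g x → x = 0)
    (hsurj : ∀ y, A.d y = 0 → ∃ x z, A.d z = y - g x) : F.IsQuasiIso := by
  constructor
  · refine (injective_iff_map_eq_zero F.cohomologyMap).2 fun q hq => ?_
    obtain ⟨⟨x, hx⟩, rfl⟩ := Submodule.Quotient.mk_surjective _ q
    obtain ⟨y, hy⟩ := (Submodule.Quotient.mk_eq_zero _).1 hq
    have : x = 0 := hinj x y (Eq.trans hy (hg x))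
    subst this
    exact (Submodule.Quotient.mk_eq_zero _).2 (Submodule.zero_mem _)
  · intro q
    obtain ⟨⟨y, hy⟩, rfl⟩ := Submodule.Quotient.mk_surjective _ q
    obtain ⟨x, z, hz⟩ := hsurj y hy
    have hx : x ∈ LinearMap.ker H.toAInf.d := by
      change H.d x = 0
      rw [hd]
      rfl
    refine ⟨Submodule.Quotient.mk ⟨x, hx⟩, ?_⟩
    refine Eq.symm ((Submodule.Quotient.eq _).2 ⟨z, ?_⟩)
    exact hz.trans (congrArg (fun t : A.toAInf.carrier => y - t) (hg x).symm)

/-- The family `F` determined by the recursion `F_n = G_n + h (∑ τ(F_i) F_j - d G_n)`. -/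
noncomputable def twistRec (A : DGAlgebra.{v, w} K) {V : Type*} (h : A.carrier →ₗ[K] A.carrier)
    (G : ℕ → (ℕ → V) → A.carrier) : ℕ → (ℕ → V) → A.carrier
  -- The terms with index 0 or n would refer to F_n itself. They vanish when G_0 = 0, since then F_0
  -- = 0, and leaving them out makes the recursion well-founded.
  | n, v => G n v + h (∑ i : Fin n, (if _ : 0 < (i : ℕ) then
      A.mul (A.involution (twistRec A h G i v)) (twistRec A h G (n - i) (fun k => v (i + k)))
      else 0) - A.d (G n v))
termination_by n => n
decreasing_by all_goals omega

section

variable (A : DGAlgebra.{v, w} K) {V : Type*} (h : A.carrier →ₗ[K] A.carrier)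
  {G : ℕ → (ℕ → V) → A.carrier}

theorem twistRec_zero (hG : ∀ v, G 0 v = 0) (v : ℕ → V) : A.twistRec h G 0 v = 0 := by
  rw [twistRec]
  simp [hG]

theorem twistRec_eq (hG : ∀ v, G 0 v = 0) (n : ℕ) (v : ℕ → V) :
    A.twistRec h G n v = G n v + h (A.conv (A.twistRec h G) n v - A.d (G n v)) := by
  conv_lhs => rw [twistRec]
  congr 3
  rw [conv, Finset.Nat.sum_antidiagonal_eq_sum_range_succ_mk, Finset.sum_range_succ,
    Finset.sum_range]
  simp only [Nat.sub_self, twistRec_zero A h hG, map_zero, add_zero]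
  refine Finset.sum_congr rfl fun i _ => ?_
  split_ifs with hi
  · rfl
  · obtain hi : (i : ℕ) = 0 := by omega
    simp [hi, twistRec_zero A h hG]

/-- Write pr - qs = (p - q)r + q(r - s). A factor of index n is always paired with F_0 = G_0 = 0, so
agreement modulo N in arities below n suffices. -/
theorem conv_sub_conv_mem {N : Submodule K A.carrier}
    (hN₁ : ∀ a ∈ N, ∀ x, A.mul a x ∈ N) (hN₂ : ∀ a ∈ N, ∀ x, A.mul x a ∈ N)
    {F : ℕ → (ℕ → V) → A.carrier} (hF : ∀ v, F 0 v = 0) (hG : ∀ v, G 0 v = 0) {n : ℕ} {v : ℕ → V}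
    (h₁ : ∀ i < n, A.involution (F i v - G i v) ∈ N)
    (h₂ : ∀ i j, i + j = n → j < n → F j (fun k => v (i + k)) - G j (fun k => v (i + k)) ∈ N) :
    A.conv F n v - A.conv G n v ∈ N := by
  rw [conv, conv, ← Finset.sum_sub_distrib]
  refine Submodule.sum_mem _ fun x hx => ?_
  rw [HasAntidiagonal.mem_antidiagonal] at hx
  by_cases hi : x.1 < n
  · by_cases hj : x.2 < n
    · have e : ∀ p q r s : A.carrier, A.mul (A.involution p) r - A.mul (A.involution q) s =
          A.mul (A.involution (p - q)) r + A.mul (A.involution q) (r - s) := by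
        intro p q r s
        simp only [map_sub, LinearMap.sub_apply]
        abel
      rw [e]
      exact add_mem (hN₁ _ (h₁ _ hi) _) (hN₂ _ (h₂ _ _ hx hj) _)
    · simp [show x.1 = 0 by omega, hF, hG]
  · simp [show x.2 = 0 by omega, hF, hG]

theorem sum_antidiagonal_assoc {M : Type*} [AddCommMonoid M] (n : ℕ) (f : ℕ → ℕ → ℕ → M) :
    ∑ x ∈ antidiagonal n, ∑ y ∈ antidiagonal x.1, f y.1 y.2 x.2 =
      ∑ x ∈ antidiagonal n, ∑ y ∈ antidiagonal x.2, f x.1 y.1 y.2 := by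
  simp only [Finset.sum_sigma']
  refine Finset.sum_bij'
    (fun x _ => ⟨(x.2.1, x.2.2 + x.1.2), (x.2.2, x.1.2)⟩)
    (fun x _ => ⟨(x.1.1 + x.2.1, x.2.2), (x.1.1, x.2.1)⟩) ?_ ?_ ?_ ?_ ?_
  all_goals
    rintro ⟨⟨a, b⟩, c, e⟩ h
    simp at h ⊢
    try omega

/-- The Bianchi identity of the twisting equation. By the Leibniz rule d(τ(F_i)F_j) = -τ(dF_i)F_j +
F_i dF_j; inserting the equation in lower arities, both parts become the sum of the F_a τ(F_b) F_c
over a + b + c = n, with opposite signs. -/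
theorem d_conv {F : ℕ → (ℕ → V) → A.carrier} (h0 : ∀ v, F 0 v = 0) {n : ℕ} {v : ℕ → V}
    (h₁ : ∀ i < n, A.d (F i v) = A.conv F i v)
    (h₂ : ∀ i j, i + j = n → j < n →
      A.d (F j (fun k => v (i + k))) = A.conv F j (fun k => v (i + k))) :
    A.d (A.conv F n v) = 0 := by
  have e : ∀ x ∈ antidiagonal n,
      A.d (A.mul (A.involution (F x.1 v)) (F x.2 (fun k => v (x.1 + k)))) =
      -∑ y ∈ antidiagonal x.1, A.mul (F y.1 v) (A.mul (A.involution (F y.2 (fun k => v (y.1 + k))))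
          (F x.2 (fun k => v (y.1 + y.2 + k)))) +
        ∑ y ∈ antidiagonal x.2, A.mul (F x.1 v)
          (A.mul (A.involution (F y.1 (fun k => v (x.1 + k))))
          (F y.2 (fun k => v (x.1 + y.1 + k)))) := by
    rintro ⟨i, j⟩ hx
    rw [HasAntidiagonal.mem_antidiagonal] at hx
    dsimp only at hx ⊢
    rw [d_mul, d_involution, involution_involution]
    congr 1
    · obtain hi | hi := lt_or_ge i n
      · rw [h₁ i hi, conv, map_sum, map_neg, map_sum, LinearMap.neg_apply, LinearMap.sum_apply]
        congr 1
        refine Finset.sum_congr rfl fun y hy => ?_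
        rw [HasAntidiagonal.mem_antidiagonal] at hy
        rw [involution_mul, involution_involution, A.mul_assoc, hy]
      · obtain rfl : j = 0 := by omega
        simp [h0]
    · obtain hj | hj := lt_or_ge j n
      · rw [h₂ i j hx hj, conv, map_sum]
        simp only [add_assoc]
      · obtain rfl : i = 0 := by omega
        simp [h0]
  rw [conv, map_sum, Finset.sum_congr rfl e, Finset.sum_add_distrib, Finset.sum_neg_distrib,
    sum_antidiagonal_assoc n (fun a b c => A.mul (F a v) (A.mul (A.involution
      (F b (fun k => v (a + k)))) (F c (fun k => v (a + b + k)))))]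
  exact neg_add_cancel _

end

section

variable {V : Type*} [AddCommGroup V] [Module K V] (A : DGAlgebra.{v, w} K)

theorem isMultilinearSeq_twistRec (h : A.carrier →ₗ[K] A.carrier) {G : ℕ → (ℕ → V) → A.carrier}
    (hG0 : ∀ v, G 0 v = 0) (hG : ∀ n, IsMultilinearSeq K n (G n)) (n : ℕ) :
    IsMultilinearSeq K n (A.twistRec h G n) := by
  induction n using Nat.strong_induction_on with
  | _ n ih =>
  have e : A.twistRec h G n = fun v => G n v +
      h (A.conv (A.twistRec h G) n v + (-A.d) (G n v)) := by
    funext v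
    rw [twistRec_eq A h hG0, LinearMap.neg_apply, ← sub_eq_add_neg]
  rw [e]
  refine (hG n).add (IsMultilinearSeq.comp h (IsMultilinearSeq.add ?_ ((hG n).comp _)))
  refine IsMultilinearSeq.sum _ fun x hx => ?_
  rw [HasAntidiagonal.mem_antidiagonal] at hx
  by_cases h1 : x.1 = 0
  · simp only [h1, twistRec_zero A h hG0, map_zero, LinearMap.zero_apply]
    exact IsMultilinearSeq.zero _
  by_cases h2 : x.2 = 0
  · simp only [h2, twistRec_zero A h hG0, map_zero]
    exact IsMultilinearSeq.zero _
  exact IsMultilinearSeq.mul A.mul hx ((ih x.1 (by omega)).comp _) (ih x.2 (by omega))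

/-- The family `a(v_0) c(v_1) ⋯ c(v_{n-1})`. -/
noncomputable def prodSeq (a c : V →ₗ[K] A.carrier) : ℕ → (ℕ → V) → A.carrier
  | 0, _ => 0
  | 1, v => a (v 0)
  | n + 2, v => A.mul (prodSeq a c (n + 1) v) (c (v (n + 1)))

variable {A} {a c : V →ₗ[K] A.carrier}

theorem isMultilinearSeq_prodSeq (n : ℕ) : IsMultilinearSeq K n (A.prodSeq a c n) := by
  match n with
  | 0 => exact IsMultilinearSeq.zero _
  | 1 => exact IsMultilinearSeq.apply a
  | n + 2 =>
    exact IsMultilinearSeq.mul A.mul rfl (isMultilinearSeq_prodSeq (n + 1))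
      (IsMultilinearSeq.apply c)

theorem prodSeq_mem {gr : ℤ → Submodule K V} (ha : ∀ i, ∀ x ∈ gr i, a x ∈ A.gr i)
    (hc : ∀ i, ∀ x ∈ gr i, c x ∈ A.gr (i - 1)) (n : ℕ) (v : ℕ → V) (deg : ℕ → ℤ)
    (hv : ∀ i, v i ∈ gr (deg i)) : A.prodSeq a c n v ∈ A.gr (∑ l ∈ range n, deg l + 1 - n) := by
  match n with
  | 0 => exact Submodule.zero_mem _
  | 1 => simpa [prodSeq] using ha _ _ (hv 0)
  | n + 2 =>
    have := A.mul_mem _ _ _ _ (prodSeq_mem ha hc (n + 1) v deg hv) (hc _ _ (hv (n + 1)))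
    rw [prodSeq]
    convert this using 2
    rw [Finset.sum_range_succ _ (n + 1)]
    push_cast
    ring

theorem prodSeq_mem_right_ideal {J : Submodule K A.carrier} (ha : ∀ x, a x ∈ J)
    (hJ : ∀ x ∈ J, ∀ y, A.mul x y ∈ J) (n : ℕ) (v : ℕ → V) : A.prodSeq a c n v ∈ J := by
  match n with
  | 0 => exact Submodule.zero_mem _
  | 1 => exact ha _
  | n + 2 => exact hJ _ (prodSeq_mem_right_ideal ha hJ (n + 1) v) _

/-- For G_{n+1} = G_n c one has dG_{n+1} = (dG_n)c + τ(G_n)a + τ(G_n)(dc - a). In ∑ τ(G_i)G_j of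
total arity n + 1 the term j = 1 is τ(G_n)a, and the others end in c and add up to the sum for n
times c. So the error is the previous one times c plus τ(G_n)(dc - a), which lies in N. -/
theorem d_prodSeq_sub_conv_mem {N : Submodule K A.carrier} (hda : ∀ x, A.d (a x) = 0)
    (hN : ∀ x ∈ N, ∀ y, A.mul x y ∈ N)
    (v : ℕ → V) (hac : ∀ n x, A.mul (A.involution (A.prodSeq a c n v)) (A.d (c x) - a x) ∈ N)
    (n : ℕ) : A.d (A.prodSeq a c n v) - A.conv (A.prodSeq a c) n v ∈ N := by
  match n with
  | 0 => simp [prodSeq, conv]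
  | 1 => simp [prodSeq, conv, hda, Finset.Nat.antidiagonal_succ]
  | n + 2 =>
    have ih := hN _ (d_prodSeq_sub_conv_mem hda hN v hac (n + 1)) (c (v (n + 1)))
    have e : A.conv (A.prodSeq a c) (n + 2) v =
        A.mul (A.conv (A.prodSeq a c) (n + 1) v) (c (v (n + 1))) +
          A.mul (A.involution (A.prodSeq a c (n + 1) v)) (a (v (n + 1))) := by
      rw [conv, conv, Finset.Nat.sum_antidiagonal_succ', Finset.Nat.sum_antidiagonal_succ',
        Finset.Nat.sum_antidiagonal_succ']
      simp only [prodSeq, map_zero, zero_add, map_sum, LinearMap.sum_apply, A.mul_assoc,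
        add_zero]
      rw [add_comm]
      congr 1
      refine Finset.sum_congr rfl fun x hx => ?_
      rw [HasAntidiagonal.mem_antidiagonal] at hx
      rw [← hx]
      congr 3
    rw [e, prodSeq, d_mul]
    have h := add_mem ih (hac (n + 1) (v (n + 1)))
    simp only [map_sub, LinearMap.sub_apply] at h
    convert h using 1
    abel

end

end DGAlgebra

/-! ### Representatives of cohomology and the formality criterion -/

theorem DirectSum.isInternal_range_lof {K : Type*} [Field K] {ι : Type*} [DecidableEq ι]
    (M : ι → Type*) [∀ i, AddCommGroup (M i)] [∀ i, Module K (M i)] :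
    DirectSum.IsInternal (fun i => LinearMap.range (DirectSum.lof K ι M i)) := by
  apply DirectSum.isInternal_submodule_of_iSupIndep_of_iSup_eq_top
  · intro i
    rw [Submodule.disjoint_def]
    rintro _ ⟨x, rfl⟩ hx'
    have h2 : (⨆ j, ⨆ (_ : j ≠ i), LinearMap.range (DirectSum.lof K ι M j)) ≤
        LinearMap.ker (DirectSum.component K ι M i) := by
      refine iSup_le fun j => iSup_le fun hj => ?_
      rintro _ ⟨y, rfl⟩
      rw [LinearMap.mem_ker, DirectSum.component.of, dif_neg hj]
    have h3 := h2 hx'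
    rw [LinearMap.mem_ker, DirectSum.component.lof_self] at h3
    rw [h3, map_zero]
  · rw [eq_top_iff]
    intro x _
    induction x using DirectSum.induction_on with
    | zero => exact Submodule.zero_mem _
    | of i x => exact Submodule.mem_iSup_of_mem i ⟨x, rfl⟩
    | add x y hx hy => exact add_mem (hx trivial) (hy trivial)

/-- Intersect Z with a complement of Z ⊓ B. Since B need not lie in Z, the whole range of d can
serve as B, although Z lives in one degree. -/
theorem Submodule.exists_relative_compl {K V : Type*} [Field K] [AddCommGroup V] [Module K V]
    (Z B : Submodule K V) : ∃ W ≤ Z, (∀ x ∈ W, x ∈ B → x = 0) ∧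
      ∀ z ∈ Z, ∃ w ∈ W, z - w ∈ B := by
  obtain ⟨C, hC⟩ := (Z ⊓ B).exists_isCompl
  refine ⟨C ⊓ Z, inf_le_right, fun x hx hxB => ?_, fun z hz => ?_⟩
  · exact Submodule.disjoint_def.1 hC.disjoint x ⟨hx.2, hxB⟩ hx.1
  · have : z ∈ (Z ⊓ B) ⊔ C := by
      rw [hC.sup_eq_top]
      trivial
    obtain ⟨b, hb, c, hc, rfl⟩ := Submodule.mem_sup.1 this
    refine ⟨c, ⟨hc, ?_⟩, ?_⟩
    · simpa using sub_mem hz hb.1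
    · simpa using hb.2

namespace DGAlgebra

variable {K : Type v} [Field K] (A : DGAlgebra.{v, w} K)

/-- The graded vector space `⨁ W i`, with zero differential and zero product. -/
noncomputable def trivialOfGraded {V : Type w} [AddCommGroup V] [Module K V]
    (W : ℤ → Submodule K V) : DGAlgebra.{v, w} K where
  carrier := DirectSum ℤ (fun i => W i)
  gr i := LinearMap.range (DirectSum.lof K ℤ (fun i => W i) i)
  isInternal := DirectSum.isInternal_range_lof _
  d := 0
  mul := 0
  d_mem _ _ _ := Submodule.zero_mem _
  mul_mem _ _ _ _ _ _ := Submodule.zero_mem _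
  d_d _ := rfl
  mul_assoc _ _ _ := rfl
  leibniz _ _ _ _ := by simp

theorem exists_proj : ∃ π : ℤ → A.carrier →ₗ[K] A.carrier,
    (∀ i, ∀ x ∈ A.gr i, π i x = x) ∧ (∀ i j, j ≠ i → ∀ x ∈ A.gr j, π i x = 0) ∧
    (∀ i x, π i x ∈ A.gr i) ∧ (∀ i x, A.d (π i x) = π (i + 1) (A.d x)) ∧
    ∀ x, ∃ s : Finset ℤ, ∑ i ∈ s, π i x = x := by
  have (i : ℤ) := A.exists_linearMap (fun j => if j = i then (A.gr j).subtype else 0)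
  choose π hπ using this
  have h1 (i x) (hx : x ∈ A.gr i) : π i x = x := by
    have := hπ i i ⟨x, hx⟩
    rwa [if_pos rfl] at this
  have h2 (i j) (hj : j ≠ i) (x) (hx : x ∈ A.gr j) : π i x = 0 := by
    have := hπ i j ⟨x, hx⟩
    rwa [if_neg hj] at this
  have htop (x : A.carrier) : x ∈ ⨆ i, A.gr i := by
    rw [A.isInternal.submodule_iSup_eq_top]
    trivial
  refine ⟨π, h1, h2, fun i x => ?_, fun i x => ?_, fun x => ?_⟩
  · induction htop x using Submodule.iSup_induction' with
    | zero => simp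
    | add x y _ _ hx hy => rw [map_add]; exact add_mem hx hy
    | mem j x hx =>
      by_cases hj : j = i
      · subst hj
        rwa [h1 _ _ hx]
      · rw [h2 _ _ hj _ hx]
        exact Submodule.zero_mem _
  · have : A.d.comp (π i) = (π (i + 1)).comp A.d := A.linearMap_ext fun j x hx => by
      by_cases hj : j = i
      · subst hj
        simp [h1 _ _ hx, h1 _ _ (A.d_mem _ _ hx)]
      · simp [h2 _ _ hj _ hx, h2 (i + 1) (j + 1) (by omega) _ (A.d_mem _ _ hx)]
    exact LinearMap.congr_fun this x
  · suffices ∃ s : Finset ℤ, ∀ t, s ⊆ t → ∑ i ∈ t, π i x = x by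
      obtain ⟨s, hs⟩ := this
      exact ⟨s, hs s subset_rfl⟩
    induction htop x using Submodule.iSup_induction' with
    | zero => exact ⟨∅, by simp⟩
    | add x y _ _ hx hy =>
      obtain ⟨s, hs⟩ := hx
      obtain ⟨s', hs'⟩ := hy
      refine ⟨s ∪ s', fun t ht => ?_⟩
      simp only [map_add, Finset.sum_add_distrib]
      rw [hs t (Finset.union_subset_left ht), hs' t (Finset.union_subset_right ht)]
    | mem j x hx =>
      refine ⟨{j}, fun t ht => ?_⟩
      rw [Finset.sum_eq_single j, h1 _ _ hx]
      · intro i _ hi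
        exact h2 _ _ hi.symm _ hx
      · intro hj
        exact absurd (ht (Finset.mem_singleton_self j)) hj

/-- A linear choice of primitives in each degree. No homotopy identity is required, as h will only
meet homogeneous cocycles of N; linearity keeps the recursion multilinear. -/
theorem exists_contraction {N : Submodule K A.carrier}
    (hN : ∀ i, ∀ x ∈ N, x ∈ A.gr i → A.d x = 0 → ∃ y ∈ N, y ∈ A.gr (i - 1) ∧ A.d y = x) :
    ∃ h : A.carrier →ₗ[K] A.carrier, ∀ i, ∀ x ∈ N, x ∈ A.gr i → A.d x = 0 →
      h x ∈ N ∧ h x ∈ A.gr (i - 1) ∧ A.d (h x) = x := by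
  have (i : ℤ) : ∃ g : A.gr i →ₗ[K] A.carrier, ∀ x : A.gr i, x.1 ∈ N → A.d x = 0 →
      g x ∈ N ∧ g x ∈ A.gr (i - 1) ∧ A.d (g x) = x := by
    let P : Submodule K (A.gr i) := (N ⊓ LinearMap.ker A.d).comap (A.gr i).subtype
    let L : P →ₗ[K] A.carrier := (A.gr i).subtype.comp P.subtype
    let R : Submodule K (P × A.carrier) :=
      (N ⊓ A.gr (i - 1)).comap (LinearMap.snd K _ _) ⊓
        LinearMap.ker (A.d.comp (LinearMap.snd K _ _) - L.comp (LinearMap.fst K _ _))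
    obtain ⟨s, hs⟩ := exists_linearMap_mem_of_forall_exists R (by
      rintro ⟨⟨x, hx⟩, hxN, hxd⟩
      obtain ⟨y, hy, hy', hyx⟩ := hN i x hxN hx hxd
      exact ⟨y, ⟨hy, hy'⟩, sub_eq_zero.2 hyx⟩)
    -- The values away from the cocycles of `N` are arbitrary.
    obtain ⟨g, hg⟩ := s.exists_extend
    refine ⟨g, fun x hx hdx => ?_⟩
    have e : g x = s ⟨x, hx, hdx⟩ := LinearMap.congr_fun hg ⟨x, hx, hdx⟩
    rw [e]
    obtain ⟨⟨h1, h2⟩, h3⟩ := hs ⟨x, hx, hdx⟩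
    exact ⟨h1, h2, sub_eq_zero.1 h3⟩
  choose g hg using this
  obtain ⟨h, hh⟩ := A.exists_linearMap g
  refine ⟨h, fun i x hx hxi hdx => ?_⟩
  have e : h x = g i ⟨x, hxi⟩ := hh i ⟨x, hxi⟩
  rw [e]
  exact hg i ⟨x, hxi⟩ hx hdx

theorem sub_d_mem {i : ℤ} {x y : A.carrier} (hx : x ∈ A.gr i) (hy : y ∈ A.gr (i - 1)) :
    x - A.d y ∈ A.gr i := by
  have := A.d_mem _ _ hy
  rw [sub_add_cancel] at this
  exact sub_mem hx this

/-- If F and G agree modulo N below n, then ∑ τ(F_i)F_j - dG_n is in N: replacing F by G costs an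
element of N, and G solves the equation modulo N. By `d_conv` it is a cocycle, so h of it is a
primitive in N; adding this to G_n gives dF_n = ∑ τ(F_i)F_j and keeps F_n - G_n in N, which lets the
induction continue. -/
theorem twistRec_prodSeq_spec {V : Type*} [AddCommGroup V] [Module K V] {gr : ℤ → Submodule K V}
    {J₁ J₂ N : Submodule K A.carrier} (hJ₁ : ∀ a ∈ J₁, ∀ x, A.mul a x ∈ J₁)
    (hN₁ : ∀ a ∈ N, ∀ x, A.mul a x ∈ N) (hN₂ : ∀ a ∈ N, ∀ x, A.mul x a ∈ N)
    (hJ : ∀ a ∈ J₁, ∀ b ∈ J₂, A.mul a b ∈ N) {h : A.carrier →ₗ[K] A.carrier}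
    (hh : ∀ i, ∀ x ∈ N, x ∈ A.gr i → A.d x = 0 → h x ∈ N ∧ h x ∈ A.gr (i - 1) ∧ A.d (h x) = x)
    {a c : V →ₗ[K] A.carrier} (ha : ∀ i, ∀ x ∈ gr i, a x ∈ A.gr i)
    (hc : ∀ i, ∀ x ∈ gr i, c x ∈ A.gr (i - 1)) (haJ : ∀ x, a x ∈ J₁)
    (hda : ∀ x, A.d (a x) = 0) (hac : ∀ x, A.d (c x) - a x ∈ J₂) (n : ℕ) :
    ∀ (v : ℕ → V) (deg : ℕ → ℤ), (∀ i, v i ∈ gr (deg i)) →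
      A.twistRec h (A.prodSeq a c) n v ∈ A.gr (∑ l ∈ range n, deg l + 1 - n) ∧
      A.twistRec h (A.prodSeq a c) n v - A.prodSeq a c n v ∈ N ∧
      A.d (A.twistRec h (A.prodSeq a c) n v) = A.conv (A.twistRec h (A.prodSeq a c)) n v := by
  have hG0 : ∀ v, A.prodSeq a c 0 v = 0 := fun _ => rfl
  induction n using Nat.strong_induction_on with
  | _ n ih =>
  intro v deg hv
  set F := A.twistRec h (A.prodSeq a c) with hF
  have hF0 : ∀ v, F 0 v = 0 := A.twistRec_zero h hG0
  have hinv {i : ℤ} {x : A.carrier} (hx : x ∈ A.gr i) {M : Submodule K A.carrier} (hxM : x ∈ M) :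
      A.involution x ∈ M := by
    rw [A.involution_apply hx]
    exact M.smul_mem _ hxM
  have hGmem := prodSeq_mem (A := A) (a := a) (c := c) ha hc
  have h1 : A.conv F n v - A.conv (A.prodSeq a c) n v ∈ N := by
    refine A.conv_sub_conv_mem hN₁ hN₂ hF0 hG0 (fun i hi => ?_) (fun i j hij hj => ?_)
    · obtain ⟨h1, h2, -⟩ := ih i hi v deg hv
      exact hinv (sub_mem h1 (hGmem i v deg hv)) h2
    · exact (ih j hj _ (fun k => deg (i + k)) fun k => hv _).2.1
  have h2 := d_prodSeq_sub_conv_mem (A := A) (a := a) (c := c) hda hN₁ v (fun m x =>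
    hJ _ (hinv (hGmem m v deg hv) (prodSeq_mem_right_ideal haJ hJ₁ m v)) _ (hac x)) n
  have h3 : A.conv F n v - A.d (A.prodSeq a c n v) ∈ N := by
    simpa using sub_mem h1 h2
  have h4 : A.conv F n v ∈ A.gr (∑ l ∈ range n, deg l + 1 - n + 1) := by
    refine Submodule.sum_mem _ fun x hx => ?_
    rw [HasAntidiagonal.mem_antidiagonal] at hx
    by_cases hi : x.1 < n
    · by_cases hj : x.2 < n
      · have := A.mul_mem _ _ _ _ (A.involution_mem (ih x.1 hi v deg hv).1)
          (ih x.2 hj _ (fun k => deg (x.1 + k)) fun k => hv _).1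
        convert this using 2
        rw [← hx, Finset.sum_range_add]
        push_cast
        ring
      · simp [show x.1 = 0 by omega, hF0]
    · simp [show x.2 = 0 by omega, hF0]
  have h5 : A.d (A.conv F n v) = 0 := A.d_conv hF0 (fun i hi => (ih i hi v deg hv).2.2)
    (fun i j _ hj => (ih j hj _ (fun k => deg (i + k)) fun k => hv _).2.2)
  obtain ⟨h6, h7, h8⟩ := hh _ _ h3 (sub_mem h4 (A.d_mem _ _ (hGmem n v deg hv)))
    (by rw [map_sub, h5, A.d_d, sub_zero])
  have e : F n v = A.prodSeq a c n v + h (A.conv F n v - A.d (A.prodSeq a c n v)) :=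
    A.twistRec_eq h hG0 n v
  rw [add_sub_cancel_right] at h7
  refine ⟨?_, ?_, ?_⟩
  · rw [e]
    exact add_mem (hGmem n v deg hv) h7
  · rw [e, add_sub_cancel_left]
    exact h6
  · conv_lhs => rw [e, map_add, h8]
    abel

/-- A dg-algebra is formal if every cohomology class has representatives in `J₁` and in `J₂`,
where `J₁` is a right ideal such that `J₁ J₂` lies in an acyclic ideal `N`. -/
theorem isFormal_of_ideals {J₁ J₂ N : Submodule K A.carrier}
    (hJ₁ : ∀ a ∈ J₁, ∀ x, A.mul a x ∈ J₁) (hN₁ : ∀ a ∈ N, ∀ x, A.mul a x ∈ N)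
    (hN₂ : ∀ a ∈ N, ∀ x, A.mul x a ∈ N) (hJ : ∀ a ∈ J₁, ∀ b ∈ J₂, A.mul a b ∈ N)
    (hN : ∀ i, ∀ x ∈ N, x ∈ A.gr i → A.d x = 0 → ∃ y ∈ N, y ∈ A.gr (i - 1) ∧ A.d y = x)
    (h₁ : ∀ i, ∀ x ∈ A.gr i, A.d x = 0 → ∃ y ∈ A.gr (i - 1), x - A.d y ∈ J₁)
    (h₂ : ∀ i, ∀ x ∈ A.gr i, A.d x = 0 → ∃ y ∈ A.gr (i - 1), x - A.d y ∈ J₂) :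
    A.IsFormal := by
  -- W i consists of actual cocycles in J₁, one for each class of degree i, so the map a below is
  -- simply the inclusion.
  have (i : ℤ) := Submodule.exists_relative_compl (A.gr i ⊓ J₁ ⊓ LinearMap.ker A.d)
    (LinearMap.range A.d)
  choose W hWZ hWB hW using this
  -- A representative in J₂ of the class of x is x - dy; the map c chooses y linearly.
  have hc (i : ℤ) : ∃ c : W i →ₗ[K] A.carrier,
      ∀ x, c x ∈ A.gr (i - 1) ∧ A.d (c x) - x ∈ J₂ := by
    let R : Submodule K (W i × A.carrier) := (A.gr (i - 1)).comap (LinearMap.snd K _ _) ⊓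
      J₂.comap (A.d.comp (LinearMap.snd K _ _) - (W i).subtype.comp (LinearMap.fst K _ _))
    obtain ⟨s, hs⟩ := exists_linearMap_mem_of_forall_exists R (by
      rintro ⟨x, hx⟩
      obtain ⟨y, hy, hyx⟩ := h₂ i x (hWZ i hx).1.1 (hWZ i hx).2
      refine ⟨y, hy, ?_⟩
      simpa using J₂.neg_mem hyx)
    exact ⟨s, fun x => hs x⟩
  choose c hc using hc
  obtain ⟨h, hh⟩ := A.exists_contraction hN
  obtain ⟨π, hπ₁, hπ₂, hπ₃, hπ₄, hπ₅⟩ := A.exists_proj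
  -- The zero product is the right one: a product of classes is represented in J₁J₂ ⊆ N, hence is
  -- exact.
  let H := trivialOfGraded W
  let ι (i : ℤ) : W i →ₗ[K] H.carrier := DirectSum.lof K ℤ (fun i => W i) i
  let p (i : ℤ) : H.carrier →ₗ[K] W i := DirectSum.component K ℤ (fun i => W i) i
  have hpι (i) (x : W i) : p i (ι i x) = x := DirectSum.component.lof_self _ _ _
  have hpι' (i j) (h : j ≠ i) (x : W j) : p i (ι j x) = 0 :=
    (DirectSum.component.of _ _ _ _).trans (dif_neg h)
  let a : H.carrier →ₗ[K] A.carrier := DirectSum.coeLinearMap W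
  let c' : H.carrier →ₗ[K] A.carrier := DirectSum.toModule K ℤ A.carrier c
  have ha (i) (x : W i) : a (ι i x) = x :=
    DirectSum.coeLinearMap_lof _ _ _
  have hc' (i) (x : W i) : c' (ι i x) = c i x :=
    DirectSum.toModule_lof _ _ _
  have hind {q : H.carrier → Prop} (x : H.carrier)
      (h1 : ∀ i y, q (ι i y)) (h0 : q 0)
      (hadd : ∀ x y, q x → q y → q (x + y)) : q x :=
    DirectSum.induction_on x h0 h1 hadd
  have hda (x) : A.d (a x) = 0 := hind (q := fun x => A.d (a x) = 0) x
    (fun i y => by rw [ha]; exact (hWZ i y.2).2) (by simp) (fun x y hx hy => by simp [hx, hy])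
  have haJ (x) : a x ∈ J₁ := hind (q := fun x => a x ∈ J₁) x
    (fun i y => by rw [ha]; exact (hWZ i y.2).1.2) (by simp)
    (fun x y hx hy => by rw [map_add]; exact add_mem hx hy)
  have hac (x) : A.d (c' x) - a x ∈ J₂ := hind (q := fun x => A.d (c' x) - a x ∈ J₂) x
    (fun i y => by rw [ha, hc']; exact (hc i y).2) (by simp)
    (fun x y hx hy => by
      simp only [map_add]
      rw [add_sub_add_comm]
      exact add_mem hx hy)
  have haπ (i : ℤ) (x : H.carrier) :
      π i (a x) = (p i x : W i) :=
    hind (q := fun x => π i (a x) = (p i x : W i)) x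
      (fun j y => by
        rw [ha]
        by_cases hj : j = i
        · subst hj
          rw [hpι, hπ₁ _ _ (hWZ j y.2).1.1]
        · rw [hpι' i j hj, hπ₂ _ _ hj _ (hWZ j y.2).1.1]
          simp)
      (by simp) (fun x y hx hy => by simp only [map_add, hx, hy, Submodule.coe_add])
  have spec := A.twistRec_prodSeq_spec (gr := H.gr) hJ₁ hN₁ hN₂ hJ hh (a := a) (c := c')
    (by
      rintro i _ ⟨x, rfl⟩
      change a (ι i x) ∈ _
      rw [ha]
      exact (hWZ i x.2).1.1)
    (by
      rintro i _ ⟨x, rfl⟩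
      change c' (ι i x) ∈ _
      rw [hc']
      exact (hc i x).1) haJ hda hac
  obtain ⟨F, hF⟩ := exists_hom_of_twisting H A rfl rfl (A.twistRec h (A.prodSeq a c'))
    (A.isMultilinearSeq_twistRec h (fun _ => rfl) isMultilinearSeq_prodSeq)
    (A.twistRec_zero h fun _ => rfl) (fun n v deg hv => (spec n v deg hv).1)
    (fun n v deg hv => (spec n v deg hv).2.2)
  have hF' (x : H.carrier) : F.linear x = -a x := by
    refine (hF x).trans (congrArg Neg.neg ?_)
    -- In arity 1 there is nothing to correct: the quadratic sum is empty up to F_0 = 0, and a takes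
    -- values in cocycles.
    refine (A.twistRec_eq h (fun _ => rfl) 1 _).trans ?_
    simp [conv, prodSeq, hda, Finset.Nat.antidiagonal_succ, A.twistRec_zero h (G := A.prodSeq a c')
      (fun _ => rfl)]
  refine ⟨H, rfl, F, isQuasiIso_of_forall rfl F _ hF' (fun x y hy => ?_) (fun y hy => ?_)⟩
  · refine DirectSum.ext_component K fun i => ?_
    -- The degree i part of dy = -a(x) exhibits the component of x in W i as a coboundary, and W i
    -- contains no coboundary but 0.
    have h1 : π i (A.d y) = -π i (a x) := by rw [hy, map_neg]
    rw [haπ, ← sub_add_cancel i 1, ← hπ₄, sub_add_cancel] at h1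
    refine Subtype.ext ?_
    refine hWB i _ (Subtype.mem _) ⟨-π (i - 1) y, ?_⟩
    rw [map_neg, h1, neg_neg]
    rfl
  · have key (i : ℤ) : ∃ w : W i, ∃ z, A.d z = π i y - w := by
      have hd : A.d (π i y) = 0 := by rw [hπ₄, hy, map_zero]
      obtain ⟨z, hz, hzJ⟩ := h₁ i _ (hπ₃ i y) hd
      obtain ⟨w, hw, z', hz'⟩ := hW i (π i y - A.d z)
        ⟨⟨A.sub_d_mem (hπ₃ i y) hz, hzJ⟩, 
          LinearMap.mem_ker.2 (by rw [map_sub, hd, A.d_d, sub_zero])⟩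
      refine ⟨⟨w, hw⟩, z + z', ?_⟩
      rw [map_add, hz']
      abel
    choose w z hwz using key
    obtain ⟨s, hs⟩ := hπ₅ y
    refine ⟨-∑ i ∈ s, ι i (w i), ∑ i ∈ s, z i, ?_⟩
    rw [map_sum, Finset.sum_congr rfl fun i _ => hwz i, Finset.sum_sub_distrib, hs, map_neg,
      neg_neg, map_sum, Finset.sum_congr rfl fun i _ => ha i (w i)]

end DGAlgebra

/-! ### Strict morphisms and formality of an idempotent -/

namespace DGAlgebra

variable {K : Type v} [Field K]

/-- The components of the `A_∞`-morphism given by a linear map. -/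
def strictComponents {V W : Type*} [AddCommGroup V] [Module K V] [AddCommGroup W] [Module K W]
    (g : V →ₗ[K] W) : (n : ℕ) → MultilinearMap K (fun _ : Fin n => V) W
  | 1 => MultilinearMap.ofSubsingleton K V W (0 : Fin 1) g
  | _ => 0

theorem strictComponents_of_eq_one {V W : Type*} [AddCommGroup V] [Module K V] [AddCommGroup W]
    [Module K W] (g : V →ₗ[K] W) {n : ℕ} (hn : n = 1) (v : ℕ → V) :
    strictComponents g n (fun i => v i) = g (v 0) := by
  subst hn
  rfl

theorem strictComponents_of_ne_one {V W : Type*} [AddCommGroup V] [Module K V] [AddCommGroup W]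
    [Module K W] (g : V →ₗ[K] W) {n : ℕ} (hn : n ≠ 1) : strictComponents g n = 0 := by
  match n, hn with
  | 0, _ => rfl
  | n + 2, _ => rfl

/-- On the left only r = t = 0 leaves a component of arity 1, and on the right only the composition
into ones does; both signs are trivial, so the relation says that g commutes with each operation. -/
theorem exists_hom_of_strict {H : DGAlgebra.{v, w} K} {A : DGAlgebra.{v, w'} K}
    (g : H.carrier →ₗ[K] A.carrier) (hgr : ∀ i, ∀ x ∈ H.gr i, g x ∈ A.gr i)
    (hd : ∀ x, g (H.d x) = A.d (g x)) (hm : ∀ x y, g (H.mul x y) = A.mul (g x) (g y)) :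
    ∃ F : AInfAlgebra.Hom H.toAInf A.toAInf, ∀ x, F.linear x = g x := by
  refine ⟨homMk H A (strictComponents g) rfl (fun n v deg hv => ?_) (fun n v deg hn hv => ?_),
    fun x => rfl⟩
  · by_cases h : n = 1
    · subst h
      have := hgr _ _ (hv 0)
      simpa [strictComponents] using this
    · rw [strictComponents_of_ne_one g h]
      exact Submodule.zero_mem _
  · have hops : g (H.ops n (fun j => v j)) = A.ops n (fun j => g (v j)) := by
      match n with
      | 0 => simp [ops_eq_zero]
      | 1 => exact hd _
      | 2 => exact hm _ _
      | n + 3 => simp [ops_eq_zero]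
    have hL : ∀ x ∈ antidiagonal n, x ≠ (0, n) →
        ∑ y ∈ antidiagonal x.2 with 1 ≤ y.1,
        (((x.1 : ℤ) + y.1 * y.2) + (2 - (y.1 : ℤ)) * ∑ l ∈ range x.1, deg l).negOnePow •
          strictComponents g (x.1 + 1 + y.2) (fun i =>
            spliceSeq v x.1 y.1 (H.ops y.1 (fun j => v (x.1 + j))) i) = 0 := by
      rintro ⟨a, b⟩ hx hne
      rw [HasAntidiagonal.mem_antidiagonal] at hx
      refine Finset.sum_eq_zero fun y _ => ?_
      have : a ≠ 0 := by
        rintro rfl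
        exact hne (Prod.ext rfl (by simpa using hx))
      rw [strictComponents_of_ne_one g (by dsimp only; omega)]
      simp
    rw [Finset.sum_eq_single (0, n) hL (fun h => absurd (by simp) h),
      Finset.sum_eq_single (n, 0)]
    · rw [strictComponents_of_eq_one g (by simp)]
      rw [Finset.sum_eq_single (Composition.ones n)]
      · have h1 : ∀ j : Fin (Composition.ones n).length,
            strictComponents g ((Composition.ones n).blocksFun j)
              (fun i => v ((Composition.ones n).sizeUpTo j + i)) = g (v j) := by
          intro j
          rw [strictComponents_of_eq_one g (Composition.ones_blocksFun n j)
            (fun i => v ((Composition.ones n).sizeUpTo j + i)), add_zero,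
            Composition.ones_sizeUpTo, min_eq_left]
          have := j.is_lt
          simp only [Composition.ones_length] at this
          exact this.le
        have h2 : ∀ m, m = n → A.ops m (fun j => g (v j)) = A.ops n (fun j => g (v j)) := by
          rintro _ rfl
          rfl
        simp only [h1, h2 _ (Composition.ones_length n), Composition.ones_blocksFun]
        simp [spliceSeq, ← hops]
      · intro c _ hc
        obtain ⟨b, hb, hb1⟩ := Composition.ne_ones_iff.1 hc
        obtain ⟨j, hj, hjb⟩ := List.getElem_of_mem hb
        rw [MultilinearMap.map_coord_zero (i := (⟨j, hj⟩ : Fin c.length)), smul_zero]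
        rw [strictComponents_of_ne_one g]
        · simp
        · change c.blocks[j] ≠ 1
          omega
      · intro h
        exact absurd (Finset.mem_univ _) h
    · intro y hy hne
      rw [Finset.mem_filter, HasAntidiagonal.mem_antidiagonal] at hy
      dsimp only at hy
      have : y.2 ≠ 0 := fun h0 => hne (Prod.ext (by dsimp only; omega) h0)
      rw [strictComponents_of_ne_one g (by dsimp only; omega)]
      simp
    · intro h
      exact absurd (by simpa using hn) h

/-- The algebra `K`, placed in degree `0`. -/
def base (K : Type v) [Field K] : DGAlgebra.{v, max u v} K where
  carrier := ULift.{u} K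
  gr i := if i = 0 then ⊤ else ⊥
  isInternal := by
    apply DirectSum.isInternal_submodule_of_iSupIndep_of_iSup_eq_top
    · intro i
      by_cases h : i = 0
      · have : (⨆ j, ⨆ (_ : j ≠ i), (if j = 0 then ⊤ else ⊥ : Submodule K (ULift.{u} K))) = ⊥ := by
          simp only [iSup_eq_bot]
          intro j hj
          rw [if_neg (by omega)]
        rw [this]
        exact disjoint_bot_right
      · simp [h]
    · rw [eq_top_iff]
      exact le_iSup_of_le 0 (by simp)
  d := 0
  mul := LinearMap.mul K (ULift.{u} K)
  d_mem _ _ _ := Submodule.zero_mem _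
  mul_mem i j a b ha hb := by
    by_cases hi : i = 0
    · by_cases hj : j = 0
      · simp [hi, hj]
      · rw [if_neg hj, Submodule.mem_bot] at hb
        subst hb
        simp
    · rw [if_neg hi, Submodule.mem_bot] at ha
      subst ha
      simp
  d_d _ := rfl
  mul_assoc a b c := by simp [_root_.mul_assoc]
  leibniz _ _ _ _ := by simp

/-- A dg-algebra whose cohomology is spanned by the class of an idempotent cocycle of degree `0`
is formal. -/
theorem isFormal_of_idempotent (A : DGAlgebra.{v, max u v} K) {e : A.carrier} (he : e ∈ A.gr 0)
    (hd : A.d e = 0) (hm : A.mul e e = e) (hinj : ∀ (c : K) y, A.d y = c • e → c = 0)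
    (hsurj : ∀ i, ∀ y ∈ A.gr i, A.d y = 0 → ∃ (c : K) (z : A.carrier), A.d z = y - c • e) :
    A.IsFormal := by
  obtain ⟨π, hπ₁, hπ₂, hπ₃, hπ₄, hπ₅⟩ := A.exists_proj
  let g : (base.{u} K).carrier →ₗ[K] A.carrier :=
    (LinearMap.toSpanSingleton K A.carrier e).comp (ULift.moduleEquiv (R := K) (M := K)).toLinearMap
  have hg (x : K) : g (ULift.up x : ULift.{u} K) = x • e := rfl
  obtain ⟨F, hF⟩ := exists_hom_of_strict (H := base.{u} K) (A := A) g
    (fun i x hx => by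
      by_cases hi : i = 0
      · subst hi
        exact Submodule.smul_mem _ _ he
      · have hx' : x ∈ (if i = 0 then ⊤ else ⊥ : Submodule K (ULift.{u} K)) := hx
        rw [if_neg hi] at hx'
        have h0 : x = (0 : ULift.{u} K) := (Submodule.mem_bot (M := ULift.{u} K) K).1 hx'
        have h1 : g x = 0 := (congrArg g h0).trans (map_zero g)
        rw [h1]
        exact Submodule.zero_mem _)
    (fun x => by
      obtain ⟨x⟩ := x
      rw [hg, map_smul, hd, smul_zero]
      exact map_zero g)
    (fun x y => by
      obtain ⟨x⟩ := x
      obtain ⟨y⟩ := y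
      rw [hg, hg, map_smul, map_smul, LinearMap.smul_apply, hm, smul_smul]
      exact (hg _).trans (by rw [mul_comm]))
  refine ⟨base.{u} K, rfl, F, isQuasiIso_of_forall rfl F _ hF (fun x y hy => ?_) (fun y hy => ?_)⟩
  · obtain ⟨x⟩ := x
    rw [hg] at hy
    have := hinj x y hy
    subst this
    rfl
  · have key (i : ℤ) : ∃ (c : K) (z : A.carrier), A.d z = π i y - c • e :=
      hsurj i _ (hπ₃ i y) (by rw [hπ₄, hy, map_zero])
    choose c z hcz using key
    obtain ⟨s, hs⟩ := hπ₅ y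
    refine ⟨(ULift.up (∑ i ∈ s, c i) : ULift.{u} K), ∑ i ∈ s, z i, ?_⟩
    rw [hg, map_sum, Finset.sum_congr rfl fun i _ => hcz i, Finset.sum_sub_distrib, hs,
      Finset.sum_smul]

end DGAlgebra

/-! ### Ordered chains and their subdivision -/

namespace ListChain

variable {K : Type*} [Field K] {E E' : Type*}

/-- The cone on an ordered chain: `(p_0, …, p_n) ↦ (b, p_0, …, p_n)`. -/
noncomputable def cone (b : E) : (List E →₀ K) →ₗ[K] (List E →₀ K) :=
  Finsupp.lmapDomain K K (List.cons b)

theorem cone_single (b : E) (l : List E) (c : K) :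
    cone b (Finsupp.single l c) = Finsupp.single (b :: l) c :=
  Finsupp.mapDomain_single

/-- The alternating sum of the faces of the ordered simplex `l`, with values in a vector space. -/
def altSum {M : Type*} [AddCommGroup M] [Module K M] (f : List E → M) (l : List E) : M :=
  ∑ j : Fin l.length, (-1 : K) ^ (j : ℕ) • f (l.eraseIdx j)

theorem map_altSum {M M' : Type*} [AddCommGroup M] [Module K M] [AddCommGroup M'] [Module K M']
    (g : M →ₗ[K] M') (f : List E → M) (l : List E) :
    g (altSum (K := K) f l) = altSum (K := K) (fun l => g (f l)) l := by
  simp [altSum]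

theorem altSum_congr {M : Type*} [AddCommGroup M] [Module K M] {f g : List E → M} {l : List E}
    (h : ∀ l', l'.length < l.length → l' ⊆ l → f l' = g l') :
    altSum (K := K) f l = altSum (K := K) g l :=
  Finset.sum_congr rfl fun j _ => by
    rw [h _ _ (List.eraseIdx_subset)]
    rw [List.length_eraseIdx_of_lt j.is_lt]
    have := j.is_lt
    omega

theorem altSum_cons {M : Type*} [AddCommGroup M] [Module K M] (f : List E → M) (x : E)
    (l : List E) :
    altSum (K := K) f (x :: l) = f l - altSum (K := K) (fun l => f (x :: l)) l := by
  simp [altSum, Fin.sum_univ_succ, pow_succ, sub_eq_add_neg]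

theorem altSum_mem {M : Type*} [AddCommGroup M] [Module K M] {f : List E → M} {l : List E}
    {P : Submodule K M} (h : ∀ l', l'.length + 1 = l.length → l' ⊆ l → f l' ∈ P) :
    altSum (K := K) f l ∈ P :=
  Submodule.sum_mem _ fun j _ => P.smul_mem _ (h _ (by
    rw [List.length_eraseIdx_of_lt j.is_lt]
    have := j.is_lt
    omega) List.eraseIdx_subset)

/-- The boundary of an ordered simplex. -/
noncomputable def bdry (l : List E) : List E →₀ K :=
  altSum (K := K) (fun l => Finsupp.single l 1) l

/-- The boundary of an ordered chain. -/
noncomputable def bdryLin : (List E →₀ K) →ₗ[K] (List E →₀ K) :=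
  Finsupp.linearCombination K bdry

/-- The empty list counts as a simplex of degree -1, so the cone formula needs no exception for a
single vertex. -/
theorem bdry_cons (x : E) (l : List E) :
    bdry (K := K) (x :: l) = Finsupp.single l 1 - cone x (bdry l) := by
  rw [bdry, altSum_cons, bdry, map_altSum]
  simp only [cone_single]

theorem bdryLin_single (l : List E) : bdryLin (Finsupp.single l (1 : K)) = bdry l := by
  simp [bdryLin]

theorem bdryLin_cone (x : E) (y : List E →₀ K) :
    bdryLin (cone x y) = y - cone x (bdryLin y) := by
  have : bdryLin.comp (cone x) = LinearMap.id - (cone (K := K) x).comp bdryLin := by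
    refine Finsupp.lhom_ext' fun l => LinearMap.ext_ring ?_
    simp [cone_single, bdryLin_single, bdry_cons]
  exact LinearMap.congr_fun this y

theorem bdryLin_bdry (l : List E) : bdryLin (bdry (K := K) l) = 0 := by
  induction l with
  | nil => simp [bdry, altSum]
  | cons x l ih => simp [bdry_cons, bdryLin_cone, ih, bdryLin_single]

theorem altSum_bdry (l : List E) : altSum (K := K) (fun l => bdry (K := K) l) l = 0 := by
  rw [← bdryLin_bdry l, bdry, map_altSum]
  simp only [bdryLin_single]

variable (bary : List E → E) (bary' : List E' → E')

/-- The subdivision of an ordered simplex, with respect to a choice of barycenters. -/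
noncomputable def sd (l : List E) : List E →₀ K :=
  if l = [] then Finsupp.single [] 1 else
    cone (bary l) (∑ j : Fin l.length, (-1 : K) ^ (j : ℕ) • sd (l.eraseIdx j))
termination_by l.length
decreasing_by
  rw [List.length_eraseIdx_of_lt j.is_lt]
  have := j.is_lt
  omega

theorem sd_nil : sd (K := K) bary [] = Finsupp.single [] 1 := by
  rw [sd, if_pos rfl]

theorem sd_of_ne_nil {l : List E} (h : l ≠ []) :
    sd (K := K) bary l = cone (bary l) (altSum (K := K) (sd bary) l) := by
  conv_lhs => rw [sd, if_neg h]
  rfl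

/-- The subdivision of ordered chains. -/
noncomputable def sdLin : (List E →₀ K) →ₗ[K] (List E →₀ K) :=
  Finsupp.linearCombination K (sd bary)

theorem sdLin_single (l : List E) : sdLin bary (Finsupp.single l (1 : K)) = sd bary l := by
  simp [sdLin]

theorem sdLin_bdry (l : List E) :
    sdLin bary (bdry (K := K) l) = altSum (K := K) (sd bary) l := by
  rw [bdry, map_altSum]
  simp only [sdLin_single]

/-- With b the barycenter, ∂(b·sd ∂l) = sd ∂l - b·∂ sd ∂l, and the last term is b·sd ∂∂l = 0 by
induction. -/
theorem bdryLin_sd (l : List E) : bdryLin (sd (K := K) bary l) = sdLin bary (bdry l) := by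
  induction hn : l.length using Nat.strong_induction_on generalizing l with
  | _ n ih =>
  by_cases h : l = []
  · subst h
    simp [sd_nil, bdryLin_single, bdry, altSum]
  · rw [sd_of_ne_nil bary h, bdryLin_cone, map_altSum,
      altSum_congr (g := fun l => sdLin bary (bdry l)) fun l' hl' _ => ih _ (hn ▸ hl') _ rfl,
      ← map_altSum, sdLin_bdry]
    rw [altSum_bdry, map_zero, map_zero, sub_zero]

theorem bdryLin_sdLin (x : List E →₀ K) : bdryLin (sdLin bary x) = sdLin bary (bdryLin x) := by
  have : bdryLin.comp (sdLin (K := K) bary) = (sdLin bary).comp bdryLin := by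
    refine Finsupp.lhom_ext' fun l => LinearMap.ext_ring ?_
    simp [sdLin_single, bdryLin_single, bdryLin_sd]
  exact LinearMap.congr_fun this x

/-- The chain homotopy between the identity and the subdivision, on an ordered simplex. -/
noncomputable def htpy (l : List E) : List E →₀ K :=
  if l = [] then 0 else
    cone (bary l) (Finsupp.single l 1 - ∑ j : Fin l.length, (-1 : K) ^ (j : ℕ) • htpy (l.eraseIdx j))
termination_by l.length
decreasing_by
  rw [List.length_eraseIdx_of_lt j.is_lt]
  have := j.is_lt
  omega

theorem htpy_nil : htpy (K := K) bary [] = 0 := by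
  rw [htpy, if_pos rfl]

theorem htpy_of_ne_nil {l : List E} (h : l ≠ []) : htpy (K := K) bary l =
    cone (bary l) (Finsupp.single l 1 - altSum (K := K) (htpy bary) l) := by
  conv_lhs => rw [htpy, if_neg h]
  rfl

/-- The chain homotopy between the identity and the subdivision. -/
noncomputable def htpyLin : (List E →₀ K) →ₗ[K] (List E →₀ K) :=
  Finsupp.linearCombination K (htpy bary)

theorem htpyLin_single (l : List E) : htpyLin bary (Finsupp.single l (1 : K)) = htpy bary l := by
  simp [htpyLin]

theorem htpyLin_bdry (l : List E) :
    htpyLin bary (bdry (K := K) l) = altSum (K := K) (htpy bary) l := by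
  rw [bdry, map_altSum]
  simp only [htpyLin_single]

/-- With b the barycenter and T the homotopy, ∂(b·(l - T∂l)) = l - T∂l - b·(∂l - ∂T∂l). By induction
∂T∂l = ∂l - sd ∂l, so the last cone is b·sd ∂l = sd l. -/
theorem bdryLin_htpy (l : List E) : bdryLin (htpy (K := K) bary l) =
    Finsupp.single l 1 - sd bary l - htpyLin bary (bdry l) := by
  induction hn : l.length using Nat.strong_induction_on generalizing l with
  | _ n ih =>
  by_cases h : l = []
  · subst h
    simp [sd_nil, htpy_nil, bdry, altSum]
  · have e : altSum (K := K) (fun l => bdryLin (htpy (K := K) bary l)) l =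
        bdry l - altSum (K := K) (sd bary) l := by
      rw [altSum_congr fun l' hl' _ => ih _ (hn ▸ hl') _ rfl]
      have h1 : altSum (K := K) (fun l => htpyLin bary (bdry (K := K) l)) l = 0 := by
        rw [← map_altSum, altSum_bdry, map_zero]
      have h2 : altSum (K := K) (fun l => (Finsupp.single l 1 - sd bary l : List E →₀ K)
          - htpyLin bary (bdry (K := K) l)) l =
          bdry l - altSum (K := K) (sd bary) l -
            altSum (K := K) (fun l => htpyLin bary (bdry (K := K) l)) l := by
        simp only [altSum, bdry, smul_sub, Finset.sum_sub_distrib]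
      rw [h2, h1, sub_zero]
    rw [htpy_of_ne_nil bary h, bdryLin_cone, map_sub, map_altSum, e, bdryLin_single,
      sub_sub_cancel, ← sd_of_ne_nil bary h, htpyLin_bdry]
    abel

theorem sub_sdLin (x : List E →₀ K) :
    x - sdLin bary x = bdryLin (htpyLin bary x) + htpyLin bary (bdryLin x) := by
  have : LinearMap.id - sdLin (K := K) bary =
      bdryLin.comp (htpyLin bary) + (htpyLin bary).comp bdryLin := by
    refine Finsupp.lhom_ext' fun l => LinearMap.ext_ring ?_
    simp [sdLin_single, htpyLin_single, bdryLin_single, bdryLin_htpy]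
  exact LinearMap.congr_fun this x

/-! ### Naturality of subdivision in the vertices -/

section Naturality

variable {bary bary'} {g : E → E'} (hg : ∀ l, l ≠ [] → g (bary l) = bary' (l.map g))

/-- The map of ordered chains induced by a map of vertices. -/
noncomputable def push (g : E → E') : (List E →₀ K) →ₗ[K] (List E' →₀ K) :=
  Finsupp.lmapDomain K K (List.map g)

theorem push_single (g : E → E') (l : List E) (c : K) :
    push g (Finsupp.single l c) = Finsupp.single (l.map g) c :=
  Finsupp.mapDomain_single

theorem push_cone (g : E → E') (b : E) (x : List E →₀ K) :
    push g (cone b x) = cone (g b) (push g x) := by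
  have : (push (K := K) g).comp (cone b) = (cone (g b)).comp (push g) := by
    refine Finsupp.lhom_ext' fun l => LinearMap.ext_ring ?_
    simp [push_single, cone_single]
  exact LinearMap.congr_fun this x

theorem altSum_map {M : Type*} [AddCommGroup M] [Module K M] (f : List E' → M) (g : E → E')
    (l : List E) :
    altSum (K := K) f (l.map g) = altSum (K := K) (fun l => f (l.map g)) l := by
  rw [altSum, altSum, ← (finCongr (List.length_map g).symm).sum_comp]
  simp [List.eraseIdx_map]

include hg in
theorem push_sd (l : List E) : push g (sd (K := K) bary l) = sd bary' (l.map g) := by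
  induction hn : l.length using Nat.strong_induction_on generalizing l with
  | _ n ih =>
  by_cases h : l = []
  · subst h
    simp [sd_nil, push_single]
  · rw [sd_of_ne_nil bary h, sd_of_ne_nil bary' (by simpa using h), push_cone, hg l h, map_altSum,
      altSum_map, altSum_congr fun l' hl' _ => ih _ (hn ▸ hl') _ rfl]

include hg in
theorem push_htpy (l : List E) : push g (htpy (K := K) bary l) = htpy bary' (l.map g) := by
  induction hn : l.length using Nat.strong_induction_on generalizing l with
  | _ n ih =>
  by_cases h : l = []
  · subst h
    simp [htpy_nil]
  · rw [htpy_of_ne_nil bary h, htpy_of_ne_nil bary' (by simpa using h), push_cone, hg l h, map_sub,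
      map_altSum, altSum_map, altSum_congr fun l' hl' _ => ih _ (hn ▸ hl') _ rfl, push_single]

include hg in
theorem push_sdLin (x : List E →₀ K) : push g (sdLin bary x) = sdLin bary' (push g x) := by
  have : (push (K := K) g).comp (sdLin bary) = (sdLin bary').comp (push g) := by
    refine Finsupp.lhom_ext' fun l => LinearMap.ext_ring ?_
    simp [push_single, sdLin_single, push_sd hg]
  exact LinearMap.congr_fun this x

include hg in
theorem push_htpyLin (x : List E →₀ K) : push g (htpyLin bary x) = htpyLin bary' (push g x) := by
  have : (push (K := K) g).comp (htpyLin bary) = (htpyLin bary').comp (push g) := by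
    refine Finsupp.lhom_ext' fun l => LinearMap.ext_ring ?_
    simp [push_single, htpyLin_single, push_htpy hg]
  exact LinearMap.congr_fun this x

end Naturality

section Support

theorem cone_mem_supported {b : E} {s t : Set (List E)} (h : ∀ l ∈ s, b :: l ∈ t)
    {x : List E →₀ K} (hx : x ∈ Finsupp.supported K K s) :
    cone b x ∈ Finsupp.supported K K t := by
  have := Finsupp.lmapDomain_supported (M := K) K (List.cons b) s
  refine Finsupp.supported_mono ?_ (this.le (Submodule.mem_map_of_mem hx))
  rintro _ ⟨l, hl, rfl⟩
  exact h l hl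

theorem linearCombination_mem_supported {f : List E → List E →₀ K} {s t : Set (List E)}
    (h : ∀ l ∈ s, f l ∈ Finsupp.supported K K t) {x : List E →₀ K}
    (hx : x ∈ Finsupp.supported K K s) :
    Finsupp.linearCombination K f x ∈ Finsupp.supported K K t :=
  Submodule.sum_mem _ fun l hl => Submodule.smul_mem _ _ (h l (hx hl))

theorem sd_mem_supported_length (l : List E) :
    sd bary l ∈ Finsupp.supported K K {l' | l'.length = l.length} := by
  induction hn : l.length using Nat.strong_induction_on generalizing l with
  | _ n ih =>
  by_cases h : l = []
  · subst h
    rw [sd_nil]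
    exact Finsupp.single_mem_supported _ _ hn
  · rw [sd_of_ne_nil bary h]
    have h0 := List.length_pos_iff.2 h
    refine cone_mem_supported (s := {l' | l'.length + 1 = n}) (fun l' hl' => by simpa using hl')
      (altSum_mem fun l' hl' _ => ?_)
    refine Finsupp.supported_mono ?_ (ih l'.length (by omega) l' rfl)
    intro l'' h''
    simp only [Set.mem_ofPred_eq] at h'' ⊢
    omega

end Support

/-! ### Subdivision shrinks the mesh -/

section Mesh

variable [PseudoMetricSpace E]
  (hb : ∀ l, l ≠ [] → ∀ q, dist (bary l) q ≤ (l.map (dist · q)).sum / l.length)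

include hb in
theorem dist_bary_le_of_forall {l : List E} (h : l ≠ []) {q : E} {r : ℝ}
    (hr : ∀ p ∈ l, dist p q ≤ r) : dist (bary l) q ≤ r := by
  refine (hb l h q).trans ?_
  have h0 : (0 : ℝ) < l.length := by exact_mod_cast List.length_pos_iff.2 h
  rw [div_le_iff₀ h0]
  have := List.sum_le_card_nsmul (l.map (dist · q)) r (by simpa using hr)
  simpa [mul_comm] using this

include hb in
-- The point q is one of the points averaged and contributes 0; this is the source of the
-- contraction factor.
theorem dist_bary_le_of_mem {l : List E} {q : E} (hq : q ∈ l) {r : ℝ}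
    (hr : ∀ p ∈ l, dist p q ≤ r) : dist (bary l) q ≤ (l.length - 1) / l.length * r := by
  have h := List.ne_nil_of_mem hq
  refine (hb l h q).trans ?_
  have h0 : (0 : ℝ) < l.length := by exact_mod_cast List.length_pos_iff.2 h
  rw [div_mul_eq_mul_div]
  gcongr
  obtain ⟨s, t, rfl⟩ := List.append_of_mem hq
  have h1 := List.sum_le_card_nsmul (s.map (dist · q)) r (by
    simpa using fun p hp => hr p (by simp [hp]))
  have h2 := List.sum_le_card_nsmul (t.map (dist · q)) r (by
    simpa using fun p hp => hr p (by simp [hp]))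
  simp at h1 h2 ⊢
  linarith

include hb in
-- The first condition strengthens the induction: a ball that contains l contains every simplex of
-- its subdivision. Applied on faces to the ball of radius N/(N+1)·r about the barycenter, it bounds
-- the distances from the new vertex; the other distances are bounded by induction.
theorem sd_mem_supported_mesh (N : ℕ) (l : List E) (hl : l.length ≤ N + 1) (r : ℝ) (hr0 : 0 ≤ r)
    (hr : ∀ p ∈ l, ∀ q ∈ l, dist p q ≤ r) :
    sd bary l ∈ Finsupp.supported K K
      {l' | (∀ q s, (∀ p ∈ l, dist p q ≤ s) → ∀ p ∈ l', dist p q ≤ s) ∧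
        ∀ p ∈ l', ∀ q ∈ l', dist p q ≤ N / (N + 1) * r} := by
  induction hn : l.length using Nat.strong_induction_on generalizing l with
  | _ n ih =>
  by_cases h : l = []
  · subst h
    rw [sd_nil]
    exact Finsupp.single_mem_supported _ _ (by simp)
  · rw [sd_of_ne_nil bary h]
    have h0 := List.length_pos_iff.2 h
    have hb' : ∀ p ∈ l, dist p (bary l) ≤ N / (N + 1) * r := by
      intro p hp
      rw [dist_comm]
      refine (dist_bary_le_of_mem bary hb hp fun q hq => hr q hq p hp).trans ?_
      refine mul_le_mul_of_nonneg_right ?_ hr0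
      rw [div_le_div_iff₀ (by exact_mod_cast h0) (by positivity)]
      have : (l.length : ℝ) ≤ N + 1 := by exact_mod_cast hl
      nlinarith
    refine cone_mem_supported (s := {l' | (∀ q s, (∀ p ∈ l, dist p q ≤ s) →
        ∀ p ∈ l', dist p q ≤ s) ∧ ∀ p ∈ l', ∀ q ∈ l', dist p q ≤ N / (N + 1) * r}) ?_
      (altSum_mem fun l' hl' hsub => ?_)
    · rintro l' ⟨h1, h2⟩
      refine ⟨fun q s hs p hp => ?_, fun p hp q hq => ?_⟩
      · obtain rfl | hp := List.mem_cons.1 hp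
        · exact dist_bary_le_of_forall bary hb h hs
        · exact h1 q s hs p hp
      · obtain rfl | hp := List.mem_cons.1 hp
        · obtain rfl | hq := List.mem_cons.1 hq
          · rw [dist_self]
            positivity
          · rw [dist_comm]
            exact h1 _ _ hb' q hq
        · obtain rfl | hq := List.mem_cons.1 hq
          · exact h1 _ _ hb' p hp
          · exact h2 p hp q hq
    · refine Finsupp.supported_mono ?_ (ih l'.length (by omega) l' (by omega)
        (fun p hp q hq => hr p (hsub hp) q (hsub hq)) rfl)
      rintro l'' ⟨h1, h2⟩
      exact ⟨fun q s hs => h1 q s fun p hp => hs p (hsub hp), h2⟩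

include hb in
theorem sdLin_pow_mem_supported_mesh (N : ℕ) (l : List E) (hl : l.length ≤ N + 1) (r : ℝ)
    (hr0 : 0 ≤ r) (hr : ∀ p ∈ l, ∀ q ∈ l, dist p q ≤ r) (k : ℕ) :
    (sdLin bary ^ k) (Finsupp.single l 1) ∈ Finsupp.supported K K
      {l' | l'.length = l.length ∧ ∀ p ∈ l', ∀ q ∈ l', dist p q ≤ (N / (N + 1) : ℝ) ^ k * r} := by
  induction k with
  | zero => exact Finsupp.single_mem_supported _ _ (by simpa using hr)
  | succ k ih =>
    rw [pow_succ' (sdLin bary), Module.End.mul_apply]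
    refine linearCombination_mem_supported (fun l' hl' => ?_) ih
    have h1 := sd_mem_supported_length (K := K) bary l'
    have h2 := sd_mem_supported_mesh (K := K) bary hb N l' (by rw [hl'.1]; exact hl) _
      (by positivity) hl'.2
    rw [hl'.1] at h1
    intro l'' h''
    refine ⟨h1 h'', ?_⟩
    rw [pow_succ', mul_assoc]
    exact (h2 h'').2

end Mesh

end ListChain

/-! ### Convex combinations in the standard simplex -/

namespace stdSimplex

variable {ι κ : Type*} [Fintype ι] [Fintype κ]

/-- The convex combination of points of a standard simplex. -/
noncomputable def comb (w : stdSimplex ℝ ι) (p : ι → stdSimplex ℝ κ) : stdSimplex ℝ κ :=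
  ⟨∑ i, w i • (p i : κ → ℝ), (convex_stdSimplex ℝ κ).sum_mem (fun i _ => w.2.1 i) w.2.2
    fun i _ => (p i).2⟩

theorem coe_comb (w : stdSimplex ℝ ι) (p : ι → stdSimplex ℝ κ) :
    (comb w p : κ → ℝ) = ∑ i, w i • (p i : κ → ℝ) := rfl

theorem dist_comb_le (w : stdSimplex ℝ ι) (p : ι → stdSimplex ℝ κ) (q : stdSimplex ℝ κ) :
    dist (comb w p) q ≤ ∑ i, w i * dist (p i) q := by
  have e : (comb w p : κ → ℝ) - q = ∑ i, w i • ((p i : κ → ℝ) - q) := by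
    simp only [smul_sub, Finset.sum_sub_distrib, ← Finset.sum_smul]
    rw [stdSimplex.sum_eq_one, one_smul]
    rfl
  rw [Subtype.dist_eq, dist_eq_norm]
  change ‖(comb w p : κ → ℝ) - q‖ ≤ _
  rw [e]
  refine (norm_sum_le _ _).trans (Finset.sum_le_sum fun i _ => ?_)
  rw [norm_smul, Real.norm_of_nonneg (stdSimplex.zero_le w i), Subtype.dist_eq, dist_eq_norm]
  rfl

theorem dist_comb_le_of_forall (w : stdSimplex ℝ ι) (p : ι → stdSimplex ℝ κ) (q : stdSimplex ℝ κ)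
    {r : ℝ} (hr : ∀ i, dist (p i) q ≤ r) : dist (comb w p) q ≤ r := by
  refine (dist_comb_le w p q).trans ?_
  calc ∑ i, w i * dist (p i) q ≤ ∑ i, w i * r :=
        Finset.sum_le_sum fun i _ => mul_le_mul_of_nonneg_left (hr i) (stdSimplex.zero_le w i)
    _ = r := by rw [← Finset.sum_mul, stdSimplex.sum_eq_one, one_mul]

theorem map_comb {κ' : Type*} [Fintype κ'] (f : κ → κ') (w : stdSimplex ℝ ι)
    (p : ι → stdSimplex ℝ κ) : map f (comb w p) = comb w (fun i => map f (p i)) := by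
  refine stdSimplex.ext ?_
  rw [map_coe]
  change FunOnFinite.linearMap ℝ ℝ f (∑ i, w i • (p i : κ → ℝ)) = ∑ i, w i • _
  rw [map_sum]
  simp only [map_smul]
  rfl

theorem comb_map {ι' : Type*} [Fintype ι'] (f : ι → ι') (w : stdSimplex ℝ ι)
    (p : ι' → stdSimplex ℝ κ) : comb (map f w) p = comb w (fun i => p (f i)) := by
  classical
  refine stdSimplex.ext ?_
  change ∑ j, map f w j • (p j : κ → ℝ) = ∑ i, w i • (p (f i) : κ → ℝ)
  simp only [map_coe, FunOnFinite.linearMap_apply_apply, Finset.sum_smul]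
  rw [← Finset.sum_fiberwise Finset.univ f]
  refine Finset.sum_congr rfl fun j _ => Finset.sum_congr rfl fun i hi => ?_
  rw [(Finset.mem_filter.1 hi).2]

theorem comb_vertex [DecidableEq ι] (w : stdSimplex ℝ ι) : comb w vertex = w := by
  refine stdSimplex.ext ?_
  change ∑ i, w i • (Pi.single i 1 : ι → ℝ) = _
  funext j
  simp [Finset.sum_apply, Pi.single_apply]

theorem continuous_comb (p : ι → stdSimplex ℝ κ) : Continuous (fun w => comb w p) := by
  refine Continuous.subtype_mk ?_ _
  refine continuous_finsetSum _ fun i _ => ?_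
  have h : Continuous fun w : stdSimplex ℝ ι => w i :=
    (continuous_apply i).comp continuous_subtype_val
  exact h.smul continuous_const

/-- The barycenter of the points of a nonempty list. -/
noncomputable def bary {m : ℕ} (l : List (stdSimplex ℝ (Fin (m + 1)))) :
    stdSimplex ℝ (Fin (m + 1)) :=
  -- A default value: `sd` and `htpy` form barycenters of nonempty lists only.
  if h : l = [] then vertex 0 else
    haveI : Nonempty (Fin l.length) := ⟨⟨0, List.length_pos_iff.2 h⟩⟩
    comb barycenter (fun i : Fin l.length => l[i])

theorem coe_bary {m : ℕ} {l : List (stdSimplex ℝ (Fin (m + 1)))} (h : l ≠ []) :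
    (bary l : Fin (m + 1) → ℝ) =
      (l.length : ℝ)⁻¹ • (l.map (fun p : stdSimplex ℝ (Fin (m + 1)) => (⇑p : Fin (m + 1) → ℝ))).sum := by
  have : Nonempty (Fin l.length) := ⟨⟨0, List.length_pos_iff.2 h⟩⟩
  rw [bary, dif_neg h, coe_comb, ← Fin.sum_univ_fun_getElem, Finset.smul_sum]
  refine Finset.sum_congr rfl fun i _ => ?_
  congr 1
  exact (barycenter_apply i).trans (by simp)

theorem dist_bary_le {m : ℕ} (l : List (stdSimplex ℝ (Fin (m + 1)))) (h : l ≠ [])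
    (q : stdSimplex ℝ (Fin (m + 1))) :
    dist (bary l) q ≤ (l.map (dist · q)).sum / l.length := by
  have : Nonempty (Fin l.length) := ⟨⟨0, List.length_pos_iff.2 h⟩⟩
  rw [bary, dif_neg h]
  refine (dist_comb_le _ _ _).trans (le_of_eq ?_)
  rw [← Fin.sum_univ_fun_getElem, div_eq_inv_mul, Finset.mul_sum]
  refine Finset.sum_congr rfl fun i _ => ?_
  congr 1
  exact (barycenter_apply i).trans (by simp)

theorem map_bary {m n : ℕ} (f : Fin (m + 1) → Fin (n + 1))
    (l : List (stdSimplex ℝ (Fin (m + 1)))) (h : l ≠ []) :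
    map f (bary l) = bary (l.map (map f)) := by
  refine stdSimplex.ext ?_
  rw [map_coe, coe_bary h, coe_bary (by simpa using h), map_smul, map_list_sum, List.map_map,
    List.map_map, List.length_map]
  rfl

/-- The affine map from the standard simplex whose vertices are the entries of `l`. -/
noncomputable def affMap {m : ℕ} (n : ℕ) (l : List (stdSimplex ℝ (Fin (m + 1)))) :
    C(stdSimplex ℝ (Fin (n + 1)), stdSimplex ℝ (Fin (m + 1))) :=
  -- Padding with `vertex 0` makes the face formula true for lists of any length; cochains are
  -- evaluated only on lists of length n + 1.
  ⟨fun t => comb t (fun i => l.getD i (vertex 0)), continuous_comb _⟩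

theorem affMap_apply {m : ℕ} (n : ℕ) (l : List (stdSimplex ℝ (Fin (m + 1))))
    (t : stdSimplex ℝ (Fin (n + 1))) :
    affMap n l t = comb t (fun i => l.getD i (vertex 0)) := rfl

theorem affMap_face {m n : ℕ} (l : List (stdSimplex ℝ (Fin (m + 1)))) (j : Fin (n + 2))
    (t : stdSimplex ℝ (Fin (n + 1))) :
    affMap (n + 1) l (map j.succAbove t) = affMap n (l.eraseIdx j) t := by
  rw [affMap_apply, affMap_apply, comb_map]
  congr 1
  funext i
  rw [List.getD_eq_getElem?_getD, List.getD_eq_getElem?_getD, List.getElem?_eraseIdx]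
  congr 1
  have : ((j.succAbove i : Fin (n + 2)) : ℕ) = if (i : ℕ) < j then (i : ℕ) else i + 1 := δ_val j i
  rw [this]
  split_ifs <;> rfl

theorem map_affMap {m m' n : ℕ} (f : Fin (m + 1) → Fin (m' + 1))
    {l : List (stdSimplex ℝ (Fin (m + 1)))} (hl : l.length = n + 1)
    (t : stdSimplex ℝ (Fin (n + 1))) :
    map f (affMap n l t) = affMap n (l.map (map f)) t := by
  rw [affMap_apply, affMap_apply, map_comb]
  congr 1
  funext i
  have hi : (i : ℕ) < l.length := by rw [hl]; exact i.is_lt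
  rw [List.getD_eq_getElem _ _ hi, List.getD_eq_getElem _ _ (by simpa using hi), List.getElem_map]

/-- The vertices of the standard simplex. -/
noncomputable def verts (m : ℕ) : List (stdSimplex ℝ (Fin (m + 1))) := List.ofFn vertex

theorem length_verts (m : ℕ) : (verts m).length = m + 1 := by simp [verts]

theorem affMap_verts {m : ℕ} (t : stdSimplex ℝ (Fin (m + 1))) : affMap m (verts m) t = t := by
  rw [affMap_apply]
  convert comb_vertex t with i
  have hi : (i : ℕ) < (verts m).length := by rw [length_verts]; exact i.is_lt
  rw [List.getD_eq_getElem _ _ hi]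
  simp only [verts, List.getElem_ofFn]

theorem verts_eraseIdx (m : ℕ) (j : Fin (m + 2)) :
    (verts (m + 1)).eraseIdx j = (verts m).map (map j.succAbove) := by
  have hl : ((verts (m + 1)).eraseIdx j).length = m + 1 := by
    rw [List.length_eraseIdx_of_lt (by rw [length_verts]; exact j.is_lt), length_verts]
    rfl
  refine List.ext_getElem (by rw [hl, List.length_map, length_verts]) fun i h1 h2 => ?_
  rw [hl] at h1
  have : ((j.succAbove ⟨i, h1⟩ : Fin (m + 2)) : ℕ) = if i < j then i else i + 1 := δ_val j ⟨i, h1⟩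
  rw [List.getElem_eraseIdx, List.getElem_map]
  simp only [verts, List.getElem_ofFn, map_vertex]
  split_ifs with h <;> congr 1 <;> ext <;> simp [this, h]

end stdSimplex

/-! ### Singular simplices -/

open Simplicial

/-- The singular simplicial set of a space. -/
noncomputable abbrev Sing (X : Type u) [TopologicalSpace X] : SSet.{u} :=
  TopCat.toSSet.obj (TopCat.of X)

namespace Sing

variable {X : Type u} [TopologicalSpace X]

/-- The continuous map underlying a singular simplex. -/
noncomputable def toMap {n : ℕ} (σ : Sing X _⦋n⦌) : C(stdSimplex ℝ (Fin (n + 1)), X) :=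
  TopCat.toSSetObjEquiv (TopCat.of X) (Opposite.op ⦋n⦌) σ

/-- The singular simplex given by a continuous map. -/
noncomputable def ofMap {n : ℕ} (f : C(stdSimplex ℝ (Fin (n + 1)), X)) : Sing X _⦋n⦌ :=
  (TopCat.toSSetObjEquiv (TopCat.of X) (Opposite.op ⦋n⦌)).symm f

theorem toMap_ofMap {n : ℕ} (f : C(stdSimplex ℝ (Fin (n + 1)), X)) : toMap (ofMap f) = f :=
  Equiv.apply_symm_apply _ _

theorem ofMap_toMap {n : ℕ} (σ : Sing X _⦋n⦌) : ofMap (toMap σ) = σ :=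
  Equiv.symm_apply_apply _ _

theorem toMap_δ {n : ℕ} (σ : Sing X _⦋n + 1⦌) (j : Fin (n + 2)) (z : stdSimplex ℝ (Fin (n + 1))) :
    toMap ((Sing X).δ j σ) z = toMap σ (stdSimplex.map j.succAbove z) := rfl

theorem ext_toMap {n : ℕ} {σ τ : Sing X _⦋n⦌} (h : ∀ z, toMap σ z = toMap τ z) : σ = τ := by
  rw [← ofMap_toMap σ, ← ofMap_toMap τ]
  congr 1
  ext z
  exact h z

/-- The singular simplex `σ` has its image in `U`. -/
def Inside (U : Set X) {n : ℕ} (σ : Sing X _⦋n⦌) : Prop := ∀ z, toMap σ z ∈ U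

theorem Inside.δ {U : Set X} {n : ℕ} {σ : Sing X _⦋n + 1⦌} (h : Inside U σ) (j : Fin (n + 2)) :
    Inside U ((Sing X).δ j σ) := fun _ => h _

theorem Inside.intervalFace {U : Set X} {n : ℕ} {σ : Sing X _⦋n⦌} (h : Inside U σ) (a k : ℕ) :
    Inside U (intervalFace σ a k) := fun _ => h _

end Sing

/-! ### Subdivision of singular cochains and acyclicity of N -/

namespace Sing

variable {X : Type u} [TopologicalSpace X] {K : Type v} [Field K]

/-- The differential of a cochain of degree `n`. -/
noncomputable def cobdry {n : ℕ} (φ : Sing X _⦋n⦌ → K) (σ : Sing X _⦋n + 1⦌) : K :=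
  ∑ j : Fin (n + 2), (-1 : K) ^ (j : ℕ) * φ ((Sing X).δ j σ)

/-- The value of a cochain on the image under `f` of an ordered affine chain. -/
noncomputable def evalChain {n m : ℕ} (φ : Sing X _⦋n⦌ → K) (f : C(stdSimplex ℝ (Fin (m + 1)), X)) :
    (List (stdSimplex ℝ (Fin (m + 1))) →₀ K) →ₗ[K] K :=
  Finsupp.linearCombination K fun l =>
    if l.length = n + 1 then φ (ofMap (f.comp (stdSimplex.affMap n l))) else 0

theorem evalChain_single {n m : ℕ} (φ : Sing X _⦋n⦌ → K) (f : C(stdSimplex ℝ (Fin (m + 1)), X))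
    (l : List (stdSimplex ℝ (Fin (m + 1)))) : evalChain φ f (Finsupp.single l 1) =
      if l.length = n + 1 then φ (ofMap (f.comp (stdSimplex.affMap n l))) else 0 := by
  simp [evalChain]

theorem evalChain_eq_zero {n m : ℕ} {φ : Sing X _⦋n⦌ → K} {f : C(stdSimplex ℝ (Fin (m + 1)), X)}
    {s : Set (List (stdSimplex ℝ (Fin (m + 1))))} {x : List (stdSimplex ℝ (Fin (m + 1))) →₀ K}
    (hx : x ∈ Finsupp.supported K K s)
    (h : ∀ l ∈ s, l.length = n + 1 → φ (ofMap (f.comp (stdSimplex.affMap n l))) = 0) :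
    evalChain φ f x = 0 := by
  rw [evalChain, Finsupp.linearCombination_apply]
  refine Finset.sum_eq_zero fun l hl => ?_
  dsimp only
  split_ifs with hl'
  · rw [h l (hx hl) hl', smul_zero]
  · rw [smul_zero]

theorem δ_ofMap_affMap {n m : ℕ} (f : C(stdSimplex ℝ (Fin (m + 1)), X))
    (l : List (stdSimplex ℝ (Fin (m + 1)))) (j : Fin (n + 2)) :
    (Sing X).δ j (ofMap (f.comp (stdSimplex.affMap (n + 1) l))) =
      ofMap (f.comp (stdSimplex.affMap n (l.eraseIdx j))) := by
  refine ext_toMap fun z => ?_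
  rw [toMap_δ, toMap_ofMap, toMap_ofMap, ContinuousMap.comp_apply, ContinuousMap.comp_apply,
    stdSimplex.affMap_face]

/-- Sending ordered affine simplices into X along f is compatible with faces, so identities between
ordered chains yield identities between cochains. -/
theorem evalChain_bdryLin {n m : ℕ} (φ : Sing X _⦋n⦌ → K) (f : C(stdSimplex ℝ (Fin (m + 1)), X))
    (x : List (stdSimplex ℝ (Fin (m + 1))) →₀ K) :
    evalChain φ f (ListChain.bdryLin x) = evalChain (cobdry φ) f x := by
  have : (evalChain φ f).comp ListChain.bdryLin = evalChain (cobdry φ) f := by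
    refine Finsupp.lhom_ext' fun l => LinearMap.ext_ring ?_
    simp only [LinearMap.comp_apply, Finsupp.lsingle_apply, ListChain.bdryLin_single,
      evalChain_single, ListChain.bdry, ListChain.map_altSum]
    split_ifs with hl
    · rw [ListChain.altSum, cobdry, ← (finCongr hl).sum_comp]
      refine Finset.sum_congr rfl fun j _ => ?_
      rw [if_pos (by rw [List.length_eraseIdx_of_lt j.is_lt, hl]; rfl), δ_ofMap_affMap]
      rfl
    · refine Finset.sum_eq_zero fun j _ => ?_
      have := j.is_lt
      dsimp only
      rw [if_neg (by rw [List.length_eraseIdx_of_lt j.is_lt]; omega), smul_zero]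
  exact LinearMap.congr_fun this x

theorem evalChain_push {n m m' : ℕ} (φ : Sing X _⦋n⦌ → K) (f : C(stdSimplex ℝ (Fin (m' + 1)), X))
    (g : Fin (m + 1) → Fin (m' + 1)) (x : List (stdSimplex ℝ (Fin (m + 1))) →₀ K) :
    evalChain φ f (ListChain.push (stdSimplex.map g) x) =
      evalChain φ (f.comp ⟨stdSimplex.map g, stdSimplex.continuous_map g⟩) x := by
  have : (evalChain φ f).comp (ListChain.push (stdSimplex.map g)) =
      evalChain φ (f.comp ⟨stdSimplex.map g, stdSimplex.continuous_map g⟩) := by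
    refine Finsupp.lhom_ext' fun l => LinearMap.ext_ring ?_
    simp only [LinearMap.comp_apply, Finsupp.lsingle_apply, ListChain.push_single,
      evalChain_single, List.length_map]
    split_ifs with hl
    · congr 2
      ext z
      simp [stdSimplex.map_affMap g hl]
    · rfl
  exact LinearMap.congr_fun this x

/-- The cochain `φ` evaluated on the `k`-fold subdivision. -/
noncomputable def sdCochain (k : ℕ) {n : ℕ} (φ : Sing X _⦋n⦌ → K) (σ : Sing X _⦋n⦌) : K :=
  evalChain φ (toMap σ)
    ((ListChain.sdLin stdSimplex.bary ^ k) (Finsupp.single (stdSimplex.verts n) 1))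

theorem sdCochain_zero {n : ℕ} (φ : Sing X _⦋n⦌ → K) (σ : Sing X _⦋n⦌) :
    sdCochain 0 φ σ = φ σ := by
  rw [sdCochain, pow_zero, Module.End.one_apply, evalChain_single,
    if_pos (stdSimplex.length_verts n)]
  congr 1
  refine ext_toMap fun z => ?_
  rw [toMap_ofMap, ContinuousMap.comp_apply, stdSimplex.affMap_verts]

/-- The cochain homotopy between two consecutive subdivisions. -/
noncomputable def sdHtpy (k : ℕ) {n : ℕ} (φ : Sing X _⦋n + 1⦌ → K) (τ : Sing X _⦋n⦌) : K :=
  evalChain φ (toMap τ) (ListChain.htpyLin stdSimplex.bary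
    ((ListChain.sdLin stdSimplex.bary ^ k) (Finsupp.single (stdSimplex.verts n) 1)))

theorem push_sdLin_pow {m m' : ℕ} (g : Fin (m + 1) → Fin (m' + 1)) (k : ℕ)
    (x : List (stdSimplex ℝ (Fin (m + 1))) →₀ K) :
    ListChain.push (stdSimplex.map g) ((ListChain.sdLin stdSimplex.bary ^ k) x) =
      (ListChain.sdLin stdSimplex.bary ^ k) (ListChain.push (stdSimplex.map g) x) := by
  induction k with
  | zero => rfl
  | succ k ih =>
    rw [pow_succ', Module.End.mul_apply, ListChain.push_sdLin (stdSimplex.map_bary g), ih,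
      pow_succ', Module.End.mul_apply]

theorem bdryLin_sdLin_pow {E : Type*} (bary : List E → E) (k : ℕ) (x : List E →₀ K) :
    ListChain.bdryLin ((ListChain.sdLin bary ^ k) x) =
      (ListChain.sdLin bary ^ k) (ListChain.bdryLin x) := by
  induction k with
  | zero => rfl
  | succ k ih =>
    rw [pow_succ', Module.End.mul_apply, ListChain.bdryLin_sdLin, ih, Module.End.mul_apply]

theorem bdry_verts (n : ℕ) : ListChain.bdry (K := K) (stdSimplex.verts (n + 1)) =
    ∑ j : Fin (n + 2), (-1 : K) ^ (j : ℕ) • ListChain.push (stdSimplex.map j.succAbove)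
      (Finsupp.single (stdSimplex.verts n) 1) := by
  rw [ListChain.bdry, ListChain.altSum,
    ← (finCongr (stdSimplex.length_verts (n + 1)).symm).sum_comp]
  refine Finset.sum_congr rfl fun j _ => ?_
  rw [ListChain.push_single, ← stdSimplex.verts_eraseIdx]
  rfl

/-- Apply `ListChain.sub_sdLin` to the k-fold subdivision of the standard simplex. The boundary term
dies because φ is a cocycle; in the other one the boundary is a sum of pushed-forward standard
simplices, and naturality turns it into the coboundary of `sdHtpy`. -/
theorem sdCochain_eq_succ {n : ℕ} {φ : Sing X _⦋n + 1⦌ → K} (hφ : ∀ σ, cobdry φ σ = 0) (k : ℕ)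
    (σ : Sing X _⦋n + 1⦌) :
    sdCochain k φ σ = sdCochain (k + 1) φ σ + cobdry (sdHtpy k φ) σ := by
  rw [← sub_eq_iff_eq_add', sdCochain, sdCochain, pow_succ', Module.End.mul_apply, ← map_sub,
    ListChain.sub_sdLin, map_add, evalChain_bdryLin,
    evalChain_eq_zero (s := Set.univ) (by simp) fun l _ _ => hφ _, zero_add, bdryLin_sdLin_pow,
    ListChain.bdryLin_single, bdry_verts, map_sum, map_sum, map_sum]
  refine Finset.sum_congr rfl fun j _ => ?_
  rw [map_smul, map_smul, map_smul, ← push_sdLin_pow,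
    ← ListChain.push_htpyLin (stdSimplex.map_bary _), evalChain_push, smul_eq_mul]
  rfl

variable {U V : Set X}

/-- Once the mesh is below a Lebesgue number of the cover pulled back along σ, every piece lies
inside U or V. The bound depends on σ. -/
theorem exists_sdCochain_eq_zero (hU : IsOpen U) (hV : IsOpen V) (hUV : U ∪ V = Set.univ) {n : ℕ}
    {φ : Sing X _⦋n⦌ → K} (hφU : ∀ σ, Inside U σ → φ σ = 0) (hφV : ∀ σ, Inside V σ → φ σ = 0)
    (σ : Sing X _⦋n⦌) : ∃ k₀, ∀ k ≥ k₀, sdCochain k φ σ = 0 := by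
  obtain ⟨δ, hδ, hball⟩ := lebesgue_number_lemma_of_metric
    (isCompact_univ (X := stdSimplex ℝ (Fin (n + 1))))
    (c := fun b : Bool => toMap σ ⁻¹' (if b then U else V))
    (fun b => by
      cases b
      · exact hV.preimage (toMap σ).continuous
      · exact hU.preimage (toMap σ).continuous)
    (fun z _ => by
      have : toMap σ z ∈ U ∪ V := by rw [hUV]; trivial
      obtain h | h := this
      · exact Set.mem_iUnion.2 ⟨true, h⟩
      · exact Set.mem_iUnion.2 ⟨false, h⟩)
  have hr (p q : stdSimplex ℝ (Fin (n + 1))) :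
      dist p q ≤ Metric.diam (Set.univ : Set (stdSimplex ℝ (Fin (n + 1)))) :=
    Metric.dist_le_diam_of_mem isCompact_univ.isBounded trivial trivial
  set r := Metric.diam (Set.univ : Set (stdSimplex ℝ (Fin (n + 1))))
  have hr0 : 0 ≤ r := Metric.diam_nonneg
  have hlt : (n / (n + 1) : ℝ) < 1 := by
    rw [div_lt_one (by positivity)]
    linarith
  -- The denominator r + 1 allows for diameter 0, as for a point.
  obtain ⟨k₀, hk₀⟩ := exists_pow_lt_of_lt_one (show 0 < δ / (r + 1) by positivity) hlt
  refine ⟨k₀, fun k hk => ?_⟩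
  have hk' : (n / (n + 1) : ℝ) ^ k * r < δ := by
    have h1 : (n / (n + 1) : ℝ) ^ k ≤ (n / (n + 1) : ℝ) ^ k₀ :=
      pow_le_pow_of_le_one (by positivity) hlt.le hk
    calc (n / (n + 1) : ℝ) ^ k * r ≤ (n / (n + 1) : ℝ) ^ k₀ * (r + 1) := by
          gcongr
          linarith
      _ < δ := by rwa [← lt_div_iff₀ (by positivity)]
  refine evalChain_eq_zero (ListChain.sdLin_pow_mem_supported_mesh stdSimplex.bary
    stdSimplex.dist_bary_le n _ (stdSimplex.length_verts n).le r hr0 (fun p _ q _ => hr p q) k) ?_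
  rintro l ⟨-, hl⟩ hlen
  have h0 : 0 < l.length := by omega
  obtain ⟨b, hb⟩ := hball l[0] trivial
  have key (z) : toMap σ (stdSimplex.affMap n l z) ∈ (if b then U else V) := by
    refine hb (Metric.mem_ball.2 (lt_of_le_of_lt ?_ hk'))
    refine stdSimplex.dist_comb_le_of_forall _ _ _ fun i => hl _ ?_ _ (List.getElem_mem h0)
    have hi : (i : ℕ) < l.length := by rw [hlen]; exact i.is_lt
    rw [List.getD_eq_getElem _ _ hi]
    exact List.getElem_mem hi
  have key' : Inside (if b then U else V)
      (ofMap ((toMap σ).comp (stdSimplex.affMap n l))) := fun z => by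
    rw [toMap_ofMap]
    exact key z
  cases b
  · exact hφV _ key'
  · exact hφU _ key'

/-- All simplices that occur are affine simplices composed with τ, so they stay in the image of τ.
-/
theorem sdHtpy_eq_zero {W : Set X} {n : ℕ} {φ : Sing X _⦋n + 1⦌ → K}
    (hφ : ∀ σ, Inside W σ → φ σ = 0) (k : ℕ) {τ : Sing X _⦋n⦌} (hτ : Inside W τ) :
    sdHtpy k φ τ = 0 :=
  evalChain_eq_zero (s := Set.univ) (by simp) fun l _ _ => hφ _ fun z => by
    rw [toMap_ofMap]
    exact hτ _

/-- The boundary of singular chains. -/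
noncomputable def chainBdry (K : Type v) [Field K] (X : Type u) [TopologicalSpace X] (n : ℕ) :
    ((Sing X _⦋n + 1⦌) →₀ K) →ₗ[K] ((Sing X _⦋n⦌) →₀ K) :=
  Finsupp.linearCombination K fun σ =>
    ∑ j : Fin (n + 2), (-1 : K) ^ (j : ℕ) • Finsupp.single ((Sing X).δ j σ) 1

theorem linearCombination_cobdry {n : ℕ} (ψ : Sing X _⦋n⦌ → K) (x : (Sing X _⦋n + 1⦌) →₀ K) :
    Finsupp.linearCombination K (cobdry ψ) x =
      Finsupp.linearCombination K ψ (chainBdry K X n x) := by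
  have : Finsupp.linearCombination K (cobdry ψ) =
      (Finsupp.linearCombination K ψ).comp (chainBdry K X n) := by
    refine Finsupp.lhom_ext' fun σ => LinearMap.ext_ring ?_
    simp [chainBdry, cobdry]
  exact LinearMap.congr_fun this x

/-- The complex of the cochains that vanish on the simplices inside the sets of an open cover is
acyclic. -/
theorem exists_cobdry_eq (hU : IsOpen U) (hV : IsOpen V) (hUV : U ∪ V = Set.univ) {n : ℕ}
    {φ : Sing X _⦋n + 1⦌ → K} (hφ : ∀ σ, cobdry φ σ = 0) (hφU : ∀ σ, Inside U σ → φ σ = 0)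
    (hφV : ∀ σ, Inside V σ → φ σ = 0) :
    ∃ ψ : Sing X _⦋n⦌ → K, (∀ σ, Inside U σ → ψ σ = 0) ∧ (∀ σ, Inside V σ → ψ σ = 0) ∧
      ∀ σ, cobdry ψ σ = φ σ := by
  let S : Submodule K ((Sing X _⦋n⦌) →₀ K) := Finsupp.supported K K {σ | Inside U σ ∨ Inside V σ}
  let L := S.mkQ.comp (chainBdry K X n)
  -- A primitive that vanishes on small simplices is a factorization of φ through L, and over a
  -- field it exists as soon as φ kills ker L, the chains with small boundary. Testing one chain at
  -- a time avoids the lack of a number of subdivisions valid for all simplices.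
  have h1 : Finsupp.linearCombination K φ ∈ LinearMap.range L.dualMap := by
    rw [LinearMap.range_dualMap_eq_dualAnnihilator_ker, Submodule.mem_dualAnnihilator]
    intro x hx
    have hx' : chainBdry K X n x ∈ S := by
      rw [LinearMap.mem_ker, LinearMap.comp_apply, Submodule.mkQ_apply,
        Submodule.Quotient.mk_eq_zero] at hx
      exact hx
    -- Successive subdivisions of φ differ by the coboundary of `sdHtpy`; on x this is `sdHtpy` on
    -- the small chain ∂x, where it vanishes.
    have h2 (k : ℕ) : Finsupp.linearCombination K φ x =
        Finsupp.linearCombination K (sdCochain k φ) x := by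
      induction k with
      | zero =>
        congr 2
        funext σ
        exact (sdCochain_zero φ σ).symm
      | succ k ih =>
        have e : sdCochain k φ = sdCochain (k + 1) φ + cobdry (sdHtpy k φ) :=
          funext fun σ => sdCochain_eq_succ hφ k σ
        have e2 : Finsupp.linearCombination K (cobdry (sdHtpy k φ)) x = 0 := by
          rw [linearCombination_cobdry, Finsupp.linearCombination_apply]
          refine Finset.sum_eq_zero fun τ hτ => ?_
          obtain h | h := hx' hτ
          · simp [sdHtpy_eq_zero hφU k h]
          · simp [sdHtpy_eq_zero hφV k h]
        rw [ih, e, ← add_zero (Finsupp.linearCombination K (sdCochain (k + 1) φ) x), ← e2]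
        simp only [Finsupp.linearCombination_apply, Finsupp.sum, Pi.add_apply, smul_add,
          Finset.sum_add_distrib]
    choose k₀ hk₀ using exists_sdCochain_eq_zero hU hV hUV hφU hφV
    -- The chain has finite support, so one k serves all its simplices.
    rw [h2 (x.support.sup k₀), Finsupp.linearCombination_apply]
    refine Finset.sum_eq_zero fun σ hσ => ?_
    dsimp only
    rw [hk₀ σ _ (Finset.le_sup hσ), smul_zero]
  obtain ⟨g, hg⟩ := h1
  refine ⟨fun σ => g (S.mkQ (Finsupp.single σ 1)), fun σ hσ => ?_, fun σ hσ => ?_, fun σ => ?_⟩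
  · dsimp only
    rw [Submodule.mkQ_apply, (Submodule.Quotient.mk_eq_zero S).2
      (Finsupp.single_mem_supported _ _ (Or.inl hσ)), map_zero]
  · dsimp only
    rw [Submodule.mkQ_apply, (Submodule.Quotient.mk_eq_zero S).2
      (Finsupp.single_mem_supported _ _ (Or.inr hσ)), map_zero]
  · have := LinearMap.congr_fun hg (Finsupp.single σ 1)
    rw [Finsupp.linearCombination_single, one_smul] at this
    rw [← this, ← one_smul K (cobdry _ σ), ← Finsupp.linearCombination_single,
      linearCombination_cobdry]
    have e : Finsupp.linearCombination K (fun σ => g (S.mkQ (Finsupp.single σ 1))) =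
        g.comp S.mkQ := by
      refine Finsupp.lhom_ext' fun σ => LinearMap.ext_ring ?_
      simp
    rw [e]
    rfl

end Sing

/-! ### Cones on singular simplices -/

namespace stdSimplex

theorem smul_vertex_add_smul_map_succ_mem {n : ℕ} (t : unitInterval)
    (s : stdSimplex ℝ (Fin (n + 1))) :
    (t : ℝ) • (vertex 0 : stdSimplex ℝ (Fin (n + 2))).1 + (1 - t : ℝ) • (map Fin.succ s).1 ∈
      stdSimplex ℝ (Fin (n + 2)) :=
  convex_stdSimplex ℝ _ (Subtype.mem _) (Subtype.mem _) t.2.1 (by linarith [t.2.2]) (by ring)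

/-- The point of the segment from `s` in the face opposite to the vertex `0` to this vertex. -/
noncomputable def join {n : ℕ} (t : unitInterval) (s : stdSimplex ℝ (Fin (n + 1))) :
    stdSimplex ℝ (Fin (n + 2)) :=
  ⟨(t : ℝ) • (vertex 0 : stdSimplex ℝ (Fin (n + 2))).1 + (1 - t : ℝ) • (map Fin.succ s).1,
    smul_vertex_add_smul_map_succ_mem t s⟩

theorem join_zero_left {n : ℕ} (s : stdSimplex ℝ (Fin (n + 1))) :
    join 0 s = map (Fin.succAbove 0) s := by
  refine Subtype.ext ?_
  simp [join]

theorem join_one_left {n : ℕ} (s : stdSimplex ℝ (Fin (n + 1))) : join 1 s = vertex 0 := by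
  refine Subtype.ext ?_
  simp [join]

theorem map_join {n m : ℕ} (f : Fin (n + 1) → Fin (m + 1)) (g : Fin (n + 2) → Fin (m + 2))
    (hg : g 0 = 0) (hgf : ∀ i, g i.succ = (f i).succ) (t : unitInterval)
    (s : stdSimplex ℝ (Fin (n + 1))) : map g (join t s) = join t (map f s) := by
  have h1 : map g (vertex 0 : stdSimplex ℝ (Fin (n + 2))) = vertex 0 := by rw [map_vertex, hg]
  have h2 : map g (map Fin.succ s) = map Fin.succ (map f s) := by
    rw [map_comp_apply, map_comp_apply]
    congr 1
    exact funext hgf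
  refine Subtype.ext ?_
  change FunOnFinite.linearMap ℝ ℝ g ((t : ℝ) • (vertex 0 : stdSimplex ℝ (Fin (n + 2))).1 +
    (1 - t : ℝ) • (map Fin.succ s).1) = _
  rw [map_add, map_smul, map_smul]
  change (t : ℝ) • (map g (vertex 0 : stdSimplex ℝ (Fin (n + 2)))).1 +
    (1 - t : ℝ) • (map g (map Fin.succ s)).1 = _
  rw [h1, h2]
  rfl

theorem map_succ_zero {n : ℕ} (s : stdSimplex ℝ (Fin (n + 1))) : (map Fin.succ s).1 0 = 0 := by
  change FunOnFinite.linearMap ℝ ℝ Fin.succ s 0 = 0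
  rw [FunOnFinite.linearMap_apply_apply]
  refine Finset.sum_eq_zero fun i hi => ?_
  exact absurd (Finset.mem_filter.1 hi).2 (Fin.succ_ne_zero i)

theorem map_succ_succ {n : ℕ} (s : stdSimplex ℝ (Fin (n + 1))) (i : Fin (n + 1)) :
    (map Fin.succ s).1 i.succ = s i := by
  change FunOnFinite.linearMap ℝ ℝ Fin.succ s i.succ = s i
  rw [FunOnFinite.linearMap_apply_apply]
  rw [Finset.sum_eq_single i]
  · intro j hj hji
    exact absurd (Fin.succ_injective _ (Finset.mem_filter.1 hj).2) hji
  · simp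

theorem join_apply_zero {n : ℕ} (t : unitInterval) (s : stdSimplex ℝ (Fin (n + 1))) :
    (join t s).1 0 = t := by
  simp [join, map_succ_zero]

theorem join_apply_succ {n : ℕ} (t : unitInterval) (s : stdSimplex ℝ (Fin (n + 1)))
    (i : Fin (n + 1)) : (join t s).1 i.succ = (1 - t) * s i := by
  simp [join, map_succ_succ]

theorem continuous_join {n : ℕ} :
    Continuous (fun x : unitInterval × stdSimplex ℝ (Fin (n + 1)) => join x.1 x.2) := by
  refine Continuous.subtype_mk ?_ _
  have h1 : Continuous fun x : unitInterval × stdSimplex ℝ (Fin (n + 1)) => (x.1 : ℝ) := by fun_prop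
  have h2 : Continuous fun x : unitInterval × stdSimplex ℝ (Fin (n + 1)) =>
      (map Fin.succ x.2).1 :=
    continuous_subtype_val.comp ((continuous_map _).comp continuous_snd)
  exact (h1.smul continuous_const).add ((continuous_const.sub h1).smul h2)

theorem exists_join_eq {n : ℕ} (p : stdSimplex ℝ (Fin (n + 2))) :
    ∃ (t : unitInterval) (s : stdSimplex ℝ (Fin (n + 1))), join t s = p := by
  have hsum : p.1 0 + ∑ i : Fin (n + 1), p.1 i.succ = 1 := by
    rw [← Fin.sum_univ_succ]
    exact p.2.2
  have h0 : p.1 0 ≤ 1 := stdSimplex.le_one p 0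
  obtain h | h := eq_or_lt_of_le h0
  · refine ⟨1, vertex 0, ?_⟩
    rw [join_one_left]
    have hz : ∀ i : Fin (n + 1), p.1 i.succ = 0 := fun i => by
      have : ∑ i : Fin (n + 1), p.1 i.succ = 0 := by linarith
      exact (Finset.sum_eq_zero_iff_of_nonneg fun i _ => p.2.1 i.succ).1 this i (Finset.mem_univ i)
    refine Subtype.ext (funext fun i => ?_)
    cases i using Fin.cases with
    | zero => simp [h]
    | succ i => simp [hz i]
  · have h1 : 0 < 1 - p.1 0 := by linarith
    refine ⟨⟨p.1 0, p.2.1 0, h0⟩, ⟨fun i => p.1 i.succ / (1 - p.1 0), fun i =>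
      div_nonneg (p.2.1 _) h1.le, ?_⟩, ?_⟩
    · rw [← Finset.sum_div, div_eq_one_iff_eq h1.ne']
      linarith
    · refine Subtype.ext (funext fun i => ?_)
      cases i using Fin.cases with
      | zero => rw [join_apply_zero]
      | succ i =>
        rw [join_apply_succ]
        exact mul_div_cancel₀ _ h1.ne'

/-- The map `join` is a continuous surjection from a compact space to a Hausdorff one, hence a
quotient map. It identifies points only at t = 1: t is the coordinate 0, and for t ≠ 1 the other
coordinates determine s. -/
theorem exists_extend_join {n : ℕ} {Y : Type*} [TopologicalSpace Y]
    (g : C(unitInterval × stdSimplex ℝ (Fin (n + 1)), Y)) (hg : ∀ s s', g (1, s) = g (1, s')) :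
    ∃ G : C(stdSimplex ℝ (Fin (n + 2)), Y), ∀ t s, G (join t s) = g (t, s) := by
  let j : C(unitInterval × stdSimplex ℝ (Fin (n + 1)), stdSimplex ℝ (Fin (n + 2))) :=
    ⟨fun x => join x.1 x.2, continuous_join⟩
  have hj : Topology.IsQuotientMap j :=
    (j.continuous.isClosedMap).isQuotientMap j.continuous fun p => by
      obtain ⟨t, s, h⟩ := exists_join_eq p
      exact ⟨(t, s), h⟩
  have hf : Function.FactorsThrough g j := by
    rintro ⟨t, s⟩ ⟨t', s'⟩ h
    have h' : join t s = join t' s' := h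
    obtain rfl : t = t' := Subtype.ext (by rw [← join_apply_zero t s, h', join_apply_zero])
    by_cases ht : t = 1
    · subst ht
      exact hg s s'
    · have ht' : (1 - t : ℝ) ≠ 0 := fun e => ht (Subtype.ext (by rw [Set.Icc.coe_one]; linarith))
      obtain rfl : s = s' := by
        refine Subtype.ext (funext fun i => ?_)
        have := congrArg (fun p => p.1 i.succ) h'
        simp only [join_apply_succ] at this
        exact mul_left_cancel₀ ht' this
      rfl
  refine ⟨hj.lift g hf, fun t s => ?_⟩
  exact congrArg (fun f => f (t, s)) (hj.lift_comp g hf)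

end stdSimplex

/-! ### Cones along a null-homotopy -/

namespace Sing

variable {X : Type u} [TopologicalSpace X] {K : Type v} [Field K] {U : Set X}

/-- The end of the homotopy is constant, so it descends to the cone. As joins fill the simplex, the
formula determines τ, and cones on faces are automatically faces of cones. -/
theorem exists_cone {y : X} (H : (⟨Subtype.val, continuous_subtype_val⟩ : C(U, X)).Homotopy
    (ContinuousMap.const U y)) {n : ℕ} (σ : Sing X _⦋n⦌) (hσ : Inside U σ) :
    ∃ τ : Sing X _⦋n + 1⦌, ∀ t s, toMap τ (stdSimplex.join t s) = H (t, ⟨toMap σ s, hσ s⟩) := by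
  obtain ⟨G, hG⟩ := stdSimplex.exists_extend_join
    (⟨fun x => H (x.1, ⟨toMap σ x.2, hσ x.2⟩), by fun_prop⟩ :
      C(unitInterval × stdSimplex ℝ (Fin (n + 1)), X)) (fun s s' => by simp)
  exact ⟨ofMap G, fun t s => by rw [toMap_ofMap, hG]; rfl⟩

/-- Take ψ = φ ∘ C, with C the cone. Face 0 of Cσ is σ and the others are cones on the faces of σ,
so evaluating the cocycle condition on Cσ gives φ(σ) = (dψ)(σ). Cones may leave U, so φ must be a
cocycle on all of X. -/
theorem exists_cobdry_eq_inside (hU : (⟨Subtype.val, continuous_subtype_val⟩ : C(U, X)).Nullhomotopic)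
    {n : ℕ} {φ : Sing X _⦋n + 1⦌ → K} (hφ : ∀ σ, cobdry φ σ = 0) :
    ∃ ψ : Sing X _⦋n⦌ → K, ∀ σ, Inside U σ → φ σ = cobdry ψ σ := by
  classical
  obtain ⟨y, ⟨H⟩⟩ := hU
  choose C hC using fun (n : ℕ) (σ : Sing X _⦋n⦌) hσ => exists_cone H σ hσ
  refine ⟨fun τ => if h : Inside U τ then φ (C n τ h) else 0, fun σ hσ => ?_⟩
  have h0 : (Sing X).δ 0 (C (n + 1) σ hσ) = σ := ext_toMap fun z => by
    rw [toMap_δ, ← stdSimplex.join_zero_left, hC, H.apply_zero]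
    rfl
  have h1 (j : Fin (n + 2)) :
      (Sing X).δ j.succ (C (n + 1) σ hσ) = C n ((Sing X).δ j σ) (hσ.δ j) := ext_toMap fun z => by
    obtain ⟨t, s, rfl⟩ := stdSimplex.exists_join_eq z
    rw [hC, toMap_δ, stdSimplex.map_join j.succAbove j.succ.succAbove (by simp) (by simp), hC]
    rfl
  have := hφ (C (n + 1) σ hσ)
  rw [cobdry, Fin.sum_univ_succ, h0] at this
  simp only [Fin.val_zero, pow_zero, one_mul, h1, Fin.val_succ, pow_succ, mul_neg, mul_one, neg_mul,
    Finset.sum_neg_distrib] at this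
  rw [cobdry, ← sub_eq_zero, sub_eq_add_neg]
  simp only [dif_pos (hσ.δ _)]
  exact this

/-- The null-homotopy supplies a path from each point of U to one fixed point. -/
theorem exists_eq_const_inside (hU : (⟨Subtype.val, continuous_subtype_val⟩ : C(U, X)).Nullhomotopic)
    {φ : Sing X _⦋0⦌ → K} (hφ : ∀ σ, cobdry φ σ = 0) :
    ∃ c, ∀ σ, Inside U σ → φ σ = c := by
  obtain ⟨y, ⟨H⟩⟩ := hU
  refine ⟨φ (ofMap (ContinuousMap.const _ y)), fun σ hσ => ?_⟩
  obtain ⟨τ, hτ⟩ := exists_cone H σ hσ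
  have h0 : (Sing X).δ 0 τ = σ := ext_toMap fun z => by
    rw [toMap_δ, ← stdSimplex.join_zero_left, hτ, H.apply_zero]
    rfl
  have h1 : (Sing X).δ 1 τ = ofMap (ContinuousMap.const _ y) := ext_toMap fun z => by
    have e : stdSimplex.map (Fin.succAbove 1) z = stdSimplex.join 1 z := by
      rw [stdSimplex.join_one_left, Subsingleton.elim z (stdSimplex.vertex 0),
        stdSimplex.map_vertex]
      rfl
    rw [toMap_δ, e, hτ, H.apply_one, toMap_ofMap]
    rfl
  have := hφ τ
  rw [cobdry, Fin.sum_univ_two, h0, h1] at this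
  simp only [Fin.val_zero, pow_zero, one_mul, Fin.val_one, pow_one, neg_mul] at this
  exact add_neg_eq_zero.1 this

end Sing

/-! ### The augmented singular cochain algebra -/

namespace Sing

variable {X : Type u} [TopologicalSpace X] {K : Type v} [Field K]

/-- The cochain concentrated in degree `n` with the value `φ` there. -/
noncomputable def single (n : ℕ) (φ : Sing X _⦋n⦌ → K) : cochains K (Sing X) :=
  ⟨Pi.single (M := fun k => Sing X _⦋k⦌ → K) n φ, n + 1, fun k hk =>
    Pi.single_eq_of_ne (M := fun k => Sing X _⦋k⦌ → K) (show k ≠ n by omega) φ⟩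

theorem single_same (n : ℕ) (φ : Sing X _⦋n⦌ → K) : (single n φ).1 n = φ :=
  Pi.single_eq_same (M := fun k => Sing X _⦋k⦌ → K) n φ

theorem single_of_ne {n k : ℕ} (h : k ≠ n) (φ : Sing X _⦋n⦌ → K) : (single n φ).1 k = 0 :=
  Pi.single_eq_of_ne (M := fun k => Sing X _⦋k⦌ → K) h φ

theorem single_sub (n : ℕ) (φ ψ : Sing X _⦋n⦌ → K) :
    single n φ - single n ψ = single n (fun σ => φ σ - ψ σ) :=
  by
  ext k σ
  change (single n φ).1 k σ - (single n ψ).1 k σ = _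
  by_cases h : k = n
  · subst h
    simp only [single_same]
  · simp only [single_of_ne h, Pi.zero_apply, sub_zero]

theorem cochainDLin_single (n : ℕ) (φ : Sing X _⦋n⦌ → K) :
    cochainDLin K (Sing X) (single n φ) = single (n + 1) (cobdry φ) := by
  ext k σ
  change cochainD (single n φ).1 k σ = _
  match k with
  | 0 => rw [single_of_ne (by omega)]; rfl
  | k + 1 =>
    by_cases h : k = n
    · subst h
      rw [single_same]
      simp only [cochainD, single_same]
      rfl
    · rw [single_of_ne (by omega)]
      simp [cochainD, single_of_ne h]

theorem smul_unitCochain (c : K) : c • unitCochain K (Sing X) = single 0 (fun _ => c) := by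
  ext k σ
  match k with
  | 0 => rw [single_same]; simp [unitCochain]
  | k + 1 => rw [single_of_ne (by omega)]; simp [unitCochain]

theorem augProj_of_apply_eq_zero {s₀ : Sing X _⦋0⦌} {φ : cochains K (Sing X)}
    (h : φ.1 0 s₀ = 0) : augProj K s₀ φ = φ := by
  rw [augProj_apply, h, zero_smul, sub_zero]

/-- The cochains that vanish on the simplices inside `U`. -/
noncomputable def vanishing (K : Type v) [Field K] (U : Set X) : Submodule K (cochains K (Sing X)) where
  carrier := {φ | ∀ (n : ℕ) (σ : Sing X _⦋n⦌), Inside U σ → φ.1 n σ = 0}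
  add_mem' hφ hψ n σ hσ := by simp [hφ n σ hσ, hψ n σ hσ]
  zero_mem' _ _ _ := rfl
  smul_mem' c φ hφ n σ hσ := by simp [hφ n σ hσ]

theorem cupLin_mem_vanishing_left {U : Set X} {φ : cochains K (Sing X)}
    (hφ : φ ∈ vanishing K U) (ψ : cochains K (Sing X)) :
    cupLin K (Sing X) φ ψ ∈ vanishing K U := fun n σ hσ => by
  change cup φ.1 ψ.1 n σ = 0
  exact Finset.sum_eq_zero fun x _ => by rw [hφ _ _ (hσ.intervalFace _ _), zero_mul]

theorem cupLin_mem_vanishing_right {U : Set X} (φ : cochains K (Sing X))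
    {ψ : cochains K (Sing X)} (hψ : ψ ∈ vanishing K U) :
    cupLin K (Sing X) φ ψ ∈ vanishing K U := fun n σ hσ => by
  change cup φ.1 ψ.1 n σ = 0
  exact Finset.sum_eq_zero fun x _ => by rw [hψ _ _ (hσ.intervalFace _ _), mul_zero]

theorem single_mem_vanishing {U : Set X} {n : ℕ} {φ : Sing X _⦋n⦌ → K}
    (h : ∀ σ, Inside U σ → φ σ = 0) : single n φ ∈ vanishing K U := fun k σ hσ => by
  by_cases hk : k = n
  · subst hk
    rw [single_same]
    exact h σ hσ
  · rw [single_of_ne hk]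
    rfl

variable (s₀ : Sing X _⦋0⦌)

theorem augCochains_d_single (n : ℕ) (φ : Sing X _⦋n⦌ → K) :
    (augCochains K s₀).d ((0 : K), single n φ) = ((0 : K), single (n + 1) (cobdry φ)) := by
  rw [augCochains_d_apply, cochainDLin_single, zero_smul, add_zero]

theorem augCochains_d_base (c : K) :
    (augCochains K s₀).d (c, (0 : cochains K (Sing X))) = ((0 : K), single 0 (fun _ => c)) := by
  rw [augCochains_d_apply, map_zero, zero_add, smul_unitCochain]

theorem single_mem_augGr (n : ℕ) (φ : Sing X _⦋n⦌ → K) :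
    ((0 : K), single n φ) ∈ augGr K (Sing X) n :=
  ⟨fun _ => rfl, fun k hk => single_of_ne (by omega) φ⟩

/-- The vertex s₀ makes the augmentation injective, so there is no cocycle in degree -1. -/
theorem eq_zero_or_eq_single_of_cocycle {i : ℤ} {x : K × cochains K (Sing X)}
    (hx : x ∈ augGr K (Sing X) i) (hd : (augCochains K s₀).d x = (0 : K × cochains K (Sing X))) :
    x = 0 ∨ ∃ (n : ℕ) (φ : Sing X _⦋n⦌ → K), i = n ∧ x = ((0 : K), single n φ) ∧
      ∀ σ, cobdry φ σ = 0 := by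
  obtain ⟨c, φ⟩ := x
  obtain ⟨h1, h2⟩ := hx
  have hd' : cochainDLin K (Sing X) φ + c • unitCochain K (Sing X) = 0 :=
    congrArg Prod.snd hd
  obtain hi | ⟨n, rfl⟩ : i < 0 ∨ ∃ n : ℕ, i = n := by
    obtain hi | hi := lt_or_ge i 0
    · exact Or.inl hi
    · exact Or.inr ⟨i.toNat, by omega⟩
  · left
    have hφ : φ = 0 := by
      ext n σ
      exact congrFun (h2 n (by omega)) σ
    subst hφ
    rw [map_zero, zero_add, smul_unitCochain] at hd'
    have hc := congrFun (congrFun (congrArg Subtype.val hd') 0) s₀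
    rw [single_same] at hc
    exact Prod.ext hc rfl
  · right
    have hc : c = 0 := h1 (by omega)
    subst hc
    have hφ : φ = single n (φ.1 n) := by
      ext k σ
      by_cases hk : k = n
      · subst hk
        rw [single_same]
      · rw [single_of_ne hk, h2 k (by omega)]
    refine ⟨n, φ.1 n, rfl, Prod.ext rfl hφ, fun σ => ?_⟩
    rw [zero_smul, add_zero, hφ, cochainDLin_single] at hd'
    have := congrFun (congrFun (congrArg Subtype.val hd') (n + 1)) σ
    rwa [single_same] at this

/-- The elements of the augmented cochain algebra whose projection to the augmentation ideal
vanishes on the simplices inside `U`. -/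
noncomputable def augVanishing (K : Type v) [Field K] (U : Set X) : Submodule K (augCochains K s₀).carrier :=
  (vanishing K U).comap (augProj K s₀ ∘ₗ LinearMap.snd K K (cochains K (Sing X)))

variable {s₀}

/-- In positive degree, subtract the coboundary of the primitive over U. In degree 0 the cocycle is
constant and is itself the differential of an element of degree -1. -/
theorem exists_sub_d_mem_augVanishing {U : Set X}
    (hU : (⟨Subtype.val, continuous_subtype_val⟩ : C(U, X)).Nullhomotopic)
    (hconst : ∀ φ : Sing X _⦋0⦌ → K, (∀ σ, cobdry φ σ = 0) → ∃ c, ∀ σ, φ σ = c)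
    {i : ℤ} {x : (augCochains K s₀).carrier} (hx : x ∈ (augCochains K s₀).gr i)
    (hd : (augCochains K s₀).d x = 0) :
    ∃ y ∈ (augCochains K s₀).gr (i - 1), x - (augCochains K s₀).d y ∈ augVanishing s₀ K U := by
  obtain rfl | ⟨n, φ, rfl, rfl, hφ⟩ := eq_zero_or_eq_single_of_cocycle s₀ hx hd
  · refine ⟨0, Submodule.zero_mem _, ?_⟩
    rw [map_zero (augCochains K s₀).d]
    exact Submodule.sub_mem _ (Submodule.zero_mem _) (Submodule.zero_mem _)
  match n with
  | 0 =>
    obtain ⟨c, hc⟩ := hconst φ hφ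
    obtain rfl : φ = fun _ => c := funext hc
    refine ⟨(c, 0), ⟨fun h => absurd rfl h, fun _ _ => rfl⟩, ?_⟩
    rw [show (augCochains K s₀).d (c, (0 : cochains K (Sing X))) = _ from augCochains_d_base s₀ c]
    exact (congrArg (· ∈ augVanishing s₀ K U)
      (sub_self (G := (augCochains K s₀).carrier) _)).mpr (Submodule.zero_mem _)
  | n + 1 =>
    obtain ⟨ψ, hψ⟩ := exists_cobdry_eq_inside hU hφ
    refine ⟨((0 : K), single n ψ), ?_, ?_⟩
    · have := single_mem_augGr n ψ
      have e : ((n + 1 : ℕ) : ℤ) - 1 = n := by push_cast; ring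
      rw [e]
      exact this
    · rw [augCochains_d_single]
      change augProj K s₀ (single (n + 1) φ - single (n + 1) (cobdry ψ)) ∈ vanishing K U
      rw [single_sub, augProj_of_apply_eq_zero (by rw [single_of_ne (by omega)]; rfl)]
      exact single_mem_vanishing fun σ hσ => sub_eq_zero.2 (hψ σ hσ)

theorem isFormal_augCochains_of_const {U V : Set X} (hU : IsOpen U) (hV : IsOpen V)
    (hUV : U ∪ V = Set.univ)
    (hU' : (⟨Subtype.val, continuous_subtype_val⟩ : C(U, X)).Nullhomotopic)
    (hV' : (⟨Subtype.val, continuous_subtype_val⟩ : C(V, X)).Nullhomotopic)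
    (hconst : ∀ φ : Sing X _⦋0⦌ → K, (∀ σ, cobdry φ σ = 0) → ∃ c, ∀ σ, φ σ = c)
    (hvert : ∀ σ : Sing X _⦋0⦌, Inside U σ ∨ Inside V σ) :
    (augCochains K s₀).IsFormal := by
  have hproj {φ : cochains K (Sing X)} (h : φ ∈ vanishing K U ⊓ vanishing K V) :
      augProj K s₀ φ = φ := augProj_of_apply_eq_zero (by
    obtain h' | h' := hvert s₀
    · exact h.1 0 s₀ h'
    · exact h.2 0 s₀ h')
  refine DGAlgebra.isFormal_of_ideals (augCochains K s₀) (J₁ := augVanishing s₀ K U)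
    (J₂ := augVanishing s₀ K V)
    -- Unlike J₁ and J₂, N is defined without the augmentation projection, so it omits the complex K
    -- → K·1. Since s₀ lies in U or V, the projection fixes the cochains of N.
    (N := (⊥ : Submodule K K).prod (vanishing K U ⊓ vanishing K V)) ?_ ?_ ?_ ?_ ?_ ?_ ?_
  · rintro ⟨c, φ⟩ hφ ⟨e, ψ⟩
    change augProj K s₀ (cupLin K (Sing X) (augProj K s₀ φ) (augProj K s₀ ψ)) ∈ vanishing K U
    rw [augProj_cup]
    exact cupLin_mem_vanishing_left hφ _
  · rintro ⟨c, φ⟩ ⟨-, hφ⟩ ⟨e, ψ⟩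
    refine ⟨rfl, ?_⟩
    change cupLin K (Sing X) (augProj K s₀ φ) (augProj K s₀ ψ) ∈ vanishing K U ⊓ vanishing K V
    rw [hproj hφ]
    exact ⟨cupLin_mem_vanishing_left hφ.1 _, cupLin_mem_vanishing_left hφ.2 _⟩
  · rintro ⟨c, φ⟩ ⟨-, hφ⟩ ⟨e, ψ⟩
    refine ⟨rfl, ?_⟩
    change cupLin K (Sing X) (augProj K s₀ ψ) (augProj K s₀ φ) ∈ vanishing K U ⊓ vanishing K V
    rw [hproj hφ]
    exact ⟨cupLin_mem_vanishing_right _ hφ.1, cupLin_mem_vanishing_right _ hφ.2⟩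
  · rintro ⟨c, φ⟩ hφ ⟨e, ψ⟩ hψ
    exact ⟨rfl, cupLin_mem_vanishing_left hφ _, cupLin_mem_vanishing_right _ hψ⟩
  · rintro i x ⟨-, hxU, hxV⟩ hx hd
    obtain rfl | ⟨n, φ, rfl, rfl, hφ⟩ := eq_zero_or_eq_single_of_cocycle s₀ hx hd
    · exact ⟨0, Submodule.zero_mem _, Submodule.zero_mem _, map_zero (augCochains K s₀).d⟩
    have hφU (σ) (hσ : Inside U σ) : φ σ = 0 := by
      have := hxU n σ hσ
      rwa [single_same] at this
    have hφV (σ) (hσ : Inside V σ) : φ σ = 0 := by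
      have := hxV n σ hσ
      rwa [single_same] at this
    match n with
    | 0 =>
      -- In degree 0 every simplex is a point, hence small.
      have : φ = 0 := funext fun σ => (hvert σ).elim (hφU σ) (hφV σ)
      subst this
      refine ⟨0, Submodule.zero_mem _, Submodule.zero_mem _, ?_⟩
      refine (map_zero (augCochains K s₀).d).trans (Prod.ext rfl (Subtype.ext ?_))
      exact (Pi.single_zero (M := fun k => Sing X _⦋k⦌ → K) 0).symm
    | n + 1 =>
      obtain ⟨ψ, hψU, hψV, hψ⟩ := exists_cobdry_eq hU hV hUV hφ hφU hφV
      refine ⟨((0 : K), single n ψ), ⟨rfl, single_mem_vanishing hψU, single_mem_vanishing hψV⟩,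
        ?_, ?_⟩
      · have := single_mem_augGr n ψ
        have e : ((n + 1 : ℕ) : ℤ) - 1 = n := by push_cast; ring
        rw [e]
        exact this
      · refine (augCochains_d_single s₀ n ψ).trans ?_
        rw [show cobdry ψ = φ from funext hψ]
  · intro i x hx hd
    exact exists_sub_d_mem_augVanishing hU' hconst hx hd
  · intro i x hx hd
    exact exists_sub_d_mem_augVanishing hV' hconst hx hd

end Sing

/-! ### The two cases: constant 0-cocycles, or a disjoint cover -/

namespace Sing

variable {X : Type u} [TopologicalSpace X] {K : Type v} [Field K]

theorem inside_zero_of_mem {U : Set X} {σ : Sing X _⦋0⦌} {z : stdSimplex ℝ (Fin 1)}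
    (h : toMap σ z ∈ U) : Inside U σ := fun z' => by rwa [Subsingleton.elim z' z]

theorem Inside.not_inside_of_disjoint {U V : Set X} (h : Disjoint U V) {n : ℕ} {σ : Sing X _⦋n⦌}
    (hσ : Inside U σ) : ¬Inside V σ := fun hσ' =>
  Set.disjoint_left.1 h (hσ (stdSimplex.vertex 0)) (hσ' _)

theorem inside_or_inside_vertex {U V : Set X} (hUV : U ∪ V = Set.univ) (σ : Sing X _⦋0⦌) :
    Inside U σ ∨ Inside V σ := by
  have h : toMap σ (stdSimplex.vertex 0) ∈ U ∪ V := hUV ▸ Set.mem_univ _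
  exact h.imp inside_zero_of_mem inside_zero_of_mem

theorem inside_or_inside_of_disjoint {U V : Set X} (hU : IsOpen U) (hV : IsOpen V)
    (hUV : U ∪ V = Set.univ) (hdisj : Disjoint U V) {n : ℕ} (σ : Sing X _⦋n⦌) :
    Inside U σ ∨ Inside V σ := by
  have hpre : IsPreconnected (Set.range (toMap σ)) := by
    have : PreconnectedSpace (stdSimplex ℝ (Fin (n + 1))) :=
      Subtype.preconnectedSpace (convex_stdSimplex ℝ _).isPreconnected
    exact isPreconnected_range (toMap σ).continuous
  have hsub : Set.range (toMap σ) ⊆ U ∪ V := hUV ▸ Set.subset_univ _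
  obtain h | h := hpre.subset_or_subset hU hV hdisj hsub
  · exact Or.inl fun z => h ⟨z, rfl⟩
  · exact Or.inr fun z => h ⟨z, rfl⟩

theorem inside_const {U : Set X} {x : X} (hx : x ∈ U) (n : ℕ) :
    Inside U (ofMap (n := n) (ContinuousMap.const _ x)) := fun z => by
  rw [toMap_ofMap]
  exact hx

/-- A 0-cocycle is constant on U and on V; a common point forces the two values to agree, and an
empty set imposes no second value. -/
theorem forall_eq_const {U V : Set X} (hUV : U ∪ V = Set.univ)
    (hU : (⟨Subtype.val, continuous_subtype_val⟩ : C(U, X)).Nullhomotopic)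
    (hV : (⟨Subtype.val, continuous_subtype_val⟩ : C(V, X)).Nullhomotopic)
    (h : U = ∅ ∨ V = ∅ ∨ (U ∩ V).Nonempty) {φ : Sing X _⦋0⦌ → K} (hφ : ∀ σ, cobdry φ σ = 0) :
    ∃ c, ∀ σ, φ σ = c := by
  obtain ⟨a, ha⟩ := exists_eq_const_inside hU hφ
  obtain ⟨b, hb⟩ := exists_eq_const_inside hV hφ
  obtain rfl | rfl | ⟨p, hpU, hpV⟩ := h
  · exact ⟨b, fun σ => (inside_or_inside_vertex hUV σ).elim
      (fun h => (h (stdSimplex.vertex 0)).elim) (hb σ)⟩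
  · exact ⟨a, fun σ => (inside_or_inside_vertex hUV σ).elim (ha σ)
      fun h => (h (stdSimplex.vertex 0)).elim⟩
  · have hab : a = b := (ha _ (inside_const hpU 0)).symm.trans (hb _ (inside_const hpV 0))
    subst hab
    exact ⟨a, fun σ => (inside_or_inside_vertex hUV σ).elim (ha σ) (hb σ)⟩

/-- Simplices are connected, so each lies in exactly one of U, V, and each piece is acyclic apart
from constants. The indicator χ of V vanishes at the base point, so its product in A is the cup
product and χχ = χ. -/
theorem isFormal_augCochains_of_disjoint {U V : Set X} (hU : IsOpen U) (hV : IsOpen V)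
    (hUV : U ∪ V = Set.univ)
    (hU' : (⟨Subtype.val, continuous_subtype_val⟩ : C(U, X)).Nullhomotopic)
    (hV' : (⟨Subtype.val, continuous_subtype_val⟩ : C(V, X)).Nullhomotopic)
    (hdisj : Disjoint U V) (hne : V.Nonempty) {s₀ : Sing X _⦋0⦌} (hs₀ : Inside U s₀) :
    (augCochains K s₀).IsFormal := by
  classical
  have hcase {n : ℕ} (σ : Sing X _⦋n⦌) := inside_or_inside_of_disjoint hU hV hUV hdisj σ
  have hVU {n : ℕ} {σ : Sing X _⦋n⦌} (h : Inside V σ) : ¬Inside U σ :=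
    h.not_inside_of_disjoint hdisj.symm
  have hUV' {n : ℕ} {σ : Sing X _⦋n⦌} (h : Inside U σ) : ¬Inside V σ :=
    h.not_inside_of_disjoint hdisj
  let χ : Sing X _⦋0⦌ → K := fun σ => if Inside V σ then 1 else 0
  have hχU {σ} (h : Inside U σ) : χ σ = 0 := if_neg (hUV' h)
  have hχV {σ} (h : Inside V σ) : χ σ = 1 := if_pos h
  have hχ : cobdry χ = 0 := by
    funext τ
    rw [cobdry, Fin.sum_univ_two]
    obtain h | h := hcase τ
    · rw [hχU (h.δ 0), hχU (h.δ 1)]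
      simp
    · rw [hχV (h.δ 0), hχV (h.δ 1)]
      simp
  have hzero (n : ℕ) : single n (0 : Sing X _⦋n⦌ → K) = 0 :=
    Subtype.ext (Pi.single_zero (M := fun k => Sing X _⦋k⦌ → K) n)
  have hsmul (c : K) : c • single 0 χ = single 0 (fun σ => c * χ σ) := by
    ext k σ
    change c * (single 0 χ).1 k σ = _
    by_cases hk : k = 0
    · subst hk
      rw [single_same, single_same]
    · rw [single_of_ne hk, single_of_ne hk]
      exact mul_zero c
  refine DGAlgebra.isFormal_of_idempotent (augCochains K s₀) (e := ((0 : K), single 0 χ))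
    (single_mem_augGr 0 χ) ?_ ?_ ?_ ?_
  · refine (augCochains_d_single s₀ 0 χ).trans ?_
    rw [hχ, hzero]
    rfl
  · refine (augCochains_mul_apply K s₀ 0 0 _ _).trans ?_
    rw [augProj_of_apply_eq_zero (by rw [single_same]; exact hχU hs₀)]
    refine Prod.ext rfl ?_
    ext n σ
    change cup (single 0 χ).1 (single 0 χ).1 n σ = (single 0 χ).1 n σ
    match n with
    | 0 =>
      rw [cup_zero_apply, single_same]
      simp only [χ]
      split_ifs <;> simp
    | n + 1 =>
      rw [single_of_ne (by omega)]
      refine Finset.sum_eq_zero fun x hx => ?_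
      rw [Finset.HasAntidiagonal.mem_antidiagonal] at hx
      by_cases h1 : x.1 = 0
      · rw [single_of_ne (k := x.2) (by omega)]
        exact mul_zero _
      · rw [single_of_ne h1]
        exact zero_mul _
  · rintro c ⟨a, φ⟩ h
    have h' : cochainDLin K (Sing X) φ + a • unitCochain K (Sing X) = c • single 0 χ :=
      congrArg Prod.snd h
    rw [hsmul] at h'
    -- In degree 0 the equation says that cχ is the constant a; comparing a point of V with s₀,
    -- where χ is 0, gives c = 0.
    have key (σ : Sing X _⦋0⦌) : a = c * χ σ := by
      have := congrFun (congrFun (congrArg Subtype.val h') 0) σ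
      rw [single_same, smul_unitCochain] at this
      rw [← this]
      change a = 0 + (single 0 fun _ => a).1 0 σ
      rw [single_same, zero_add]
    obtain ⟨p, hp⟩ := hne
    have h1 := key s₀
    have h2 := (key (ofMap (ContinuousMap.const _ p))).symm.trans h1
    rw [hχU hs₀, mul_zero, hχV (inside_const hp 0), mul_one] at h2
    exact h2
  · intro i y hy hd
    obtain rfl | ⟨n, φ, rfl, rfl, hφ⟩ := eq_zero_or_eq_single_of_cocycle s₀ hy hd
    · refine ⟨0, 0, (map_zero (augCochains K s₀).d).trans (Prod.ext ?_ ?_)⟩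
      · change (0 : K) = 0 - (0 : K) * 0
        ring
      · change (0 : cochains K (Sing X)) = 0 - (0 : K) • single 0 χ
        rw [zero_smul, sub_zero]
    match n with
    | 0 =>
      obtain ⟨a, ha⟩ := exists_eq_const_inside hU' hφ
      obtain ⟨b, hb⟩ := exists_eq_const_inside hV' hφ
      -- A 0-cocycle with values a on U and b on V is a·1 + (b - a)χ, and a·1 is exact.
      refine ⟨b - a, (a, 0), (augCochains_d_base s₀ a).trans ?_⟩
      refine Prod.ext ?_ ?_
      · change (0 : K) = 0 - (b - a) * 0
        ring
      change single 0 (fun _ => a) = single 0 φ - (b - a) • single 0 χ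
      rw [hsmul, single_sub]
      refine congrArg (single 0) (funext fun σ => ?_)
      obtain h | h := hcase σ
      · rw [ha σ h, hχU h, mul_zero, sub_zero]
      · rw [hb σ h, hχV h]
        ring
    | n + 1 =>
      obtain ⟨ψU, hψU⟩ := exists_cobdry_eq_inside hU' hφ
      obtain ⟨ψV, hψV⟩ := exists_cobdry_eq_inside hV' hφ
      -- Faces of a simplex stay in its piece, so the two local primitives glue without correction.
      refine ⟨0, ((0 : K), single n (fun τ => if Inside U τ then ψU τ else ψV τ)),
        (augCochains_d_single s₀ n _).trans ?_⟩
      have hc : cobdry (fun τ => if Inside U τ then ψU τ else ψV τ) = φ := by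
        funext σ
        obtain h | h := hcase σ
        · rw [hψU σ h]
          exact Finset.sum_congr rfl fun j _ => congrArg _ (if_pos (h.δ j))
        · rw [hψV σ h]
          exact Finset.sum_congr rfl fun j _ => congrArg _ (if_neg (hVU (h.δ j)))
      rw [hc]
      refine Prod.ext ?_ ?_
      · change (0 : K) = 0 - (0 : K) * 0
        ring
      · change single (n + 1) φ = single (n + 1) φ - (0 : K) • single 0 χ
        rw [zero_smul, sub_zero]

theorem isFormal_augCochains {U V : Set X} (hU : IsOpen U) (hV : IsOpen V)
    (hUV : U ∪ V = Set.univ)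
    (hU' : (⟨Subtype.val, continuous_subtype_val⟩ : C(U, X)).Nullhomotopic)
    (hV' : (⟨Subtype.val, continuous_subtype_val⟩ : C(V, X)).Nullhomotopic)
    (s₀ : Sing X _⦋0⦌) : (augCochains K s₀).IsFormal := by
  by_cases h : U = ∅ ∨ V = ∅ ∨ (U ∩ V).Nonempty
  · exact isFormal_augCochains_of_const hU hV hUV hU' hV'
      (fun φ hφ => forall_eq_const hUV hU' hV' h hφ) (inside_or_inside_vertex hUV)
  push Not at h
  have hdisj : Disjoint U V := Set.disjoint_iff_inter_eq_empty.2 h.2.2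
  obtain hs₀ | hs₀ := inside_or_inside_vertex hUV s₀
  -- The roles of U and V are chosen so that the base point lies in the first set.
  · exact isFormal_augCochains_of_disjoint hU hV hUV hU' hV' hdisj h.2.1 hs₀
  · exact isFormal_augCochains_of_disjoint hV hU (by rw [Set.union_comm, hUV]) hV' hU' hdisj.symm
      h.1 hs₀

end Sing

/-! ### From category at most one to a cover by two sets -/

theorem exists_open_cover_of_lsCat_le_one {X : Type u} [TopologicalSpace X] (hX : lsCat X ≤ 1) :
    ∃ U V : Set X, IsOpen U ∧ IsOpen V ∧ U ∪ V = Set.univ ∧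
      (⟨Subtype.val, continuous_subtype_val⟩ : C(U, X)).Nullhomotopic ∧
      (⟨Subtype.val, continuous_subtype_val⟩ : C(V, X)).Nullhomotopic := by
  have h2 : lsCat X < 2 := hX.trans_lt (by exact_mod_cast one_lt_two)
  obtain ⟨_, ⟨n, rfl, W, hW₁, hW₂, hW₃⟩, hn⟩ := sInf_lt_iff.1 h2
  have hn2 : n < 2 := by exact_mod_cast hn
  -- Here n is 0 or 1, so these two indices are all of them; for n = 0 they give the same set.
  refine ⟨W 0, W (Fin.last n), hW₁ _, hW₁ _, Set.eq_univ_of_forall fun x => ?_, hW₃ _, hW₃ _⟩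
  obtain ⟨i, hi⟩ := Set.mem_iUnion.1 (hW₂ ▸ Set.mem_univ x)
  obtain h | h : i = 0 ∨ i = Fin.last n := by
    have := i.is_lt
    simp only [Fin.ext_iff, Fin.val_last, Fin.val_zero]
    omega
  · exact Or.inl (h ▸ hi)
  · exact Or.inr (h ▸ hi)

theorem mainTheorem3 {K : Type v} [Field K] [CharZero K] {X : Type u} [TopologicalSpace X]
    (x₀ : X) (hX : lsCat X ≤ 1) : (augSingularCochains K X x₀).IsFormal := by
  obtain ⟨U, V, hU, hV, hUV, hU', hV'⟩ := exists_open_cover_of_lsCat_le_one hX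
  exact Sing.isFormal_augCochains hU hV hUV hU' hV' _
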